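/- Manifolds and Lie groups are smooth, real, finite-dimensional, Hausdorff and second countable. Let $\Phi:G\times P\to P$ be a smooth action of a Lie group $G$ on a manifold $P$ (without boundary), and let $X$ be a smooth vector field on $P$ preserved by $\Phi$. For a closed subgroup $H\subseteq G$ let $P_H=\{p\in P\mid G_p=H\}$ be the set of points with isotropy group exactly $H$, let $N^H$ be the normalizer of $H$ in $G$, and let $G_H=N^H/H$, which acts on $P_H$ by $[n]\cdot p=np$. The action $\Phi$ is called polite if for every closed subgroup $H$ of $G$ the set $P_H$ is an embedded submanifold of $P$ (its components may have different dimensions) and the action of $G_H$ on $P_H$ is proper. **Theorem.** A polite action $\Phi$ that preserves $X$ admits reduction and reconstruction, in the following sense. By an interval we mean any (open, closed, half-open, bounded or unbounded) interval in $\mathbb{R}$. 1. For every closed subgroup $H$ the flow of $X$ preserves $P_H$: an integral curve of $X$ on an interval $J$ that meets $P_H$ stays in $P_H$. Every integral curve of $X$ on a nonempty interval lies in $P_H$ for some closed $H$, and there in the part of $P_H$ of one fixed dimension. 2. For every closed subgroup $H$, $G_H$ with the quotient topology is a Lie group, whose smooth functions are those whose pull-backs to $N^H$ are locally restrictions of smooth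 functions on $G$. The parts $P_H^d$ of $P_H$ of dimension $d$ are open in $P_H$, $G_H$-invariant and disjoint, and their union is $P_H$. For each $d$, $P_H^d$ is a manifold smoothly embedded in $P$, the orbit space $P_H^d/G_H$ with the quotient topology is a (Hausdorff, second countable) manifold, and the orbit map $\rho_H:P_H^d\to P_H^d/G_H$ is a smooth left principal $G_H$-bundle. A function $f$ on $P_H^d/G_H$ is smooth if and only if $f\circ\rho_H$ is smooth, and the natural map $\epsilon_H:P_H^d/G_H\to P/G$ is injective. 3. $X$ restricts to a smooth vector field $X_H$ on $P_H^d$, and $X_H$ projects to a smooth vector field $\bar X_H$ on $P_H^d/G_H$, that is, $T\rho_H\circ X_H=\bar X_H\circ\rho_H$. With $\rho:P\to P/G$ the orbit map, for every $f:P/G\to\mathbb{R}$ with $\rho^*f\in C^\infty(P)$ the function $\epsilon_H^*f$ is smooth and $\bar X_H(\epsilon_H^*f)\circ\rho_H=X(\rho^*f)|_{P_H^d}$. If $\gamma$ is an integral curve of $X$ on an interval $J$ with values in $P_H^d$, then $\rho_H\circ\gamma$ is an integral curve of $\bar X_H$ on $J$ (reduced equation). 4. Conversely, let $c$ be an integral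 curve of $\bar X_H$ on an interval $J$, let $t_0\in J$ and let $p_0\in P_H^d$ with $\rho_H(p_0)=c(t_0)$. Then there is an integral curve $\gamma$ of $X$ on $J$ with values in $P_H^d$ such that $\gamma(t_0)=p_0$ and $\rho_H\circ\gamma=c$ on $J$. Moreover, if $b:J\to P_H^d$ is a smooth lift of an integral curve of $\bar X_H$ on $J$, there is a smooth curve $\xi:J\to\mathfrak g_H$ in the Lie algebra of $G_H$ such that, for every $g:J\to G_H$, the curve $t\mapsto g(t)\cdot b(t)$ is an integral curve of $X$ if and only if $g$ is differentiable and solves the differential equation $g'(t)=T_eL_{g(t)}\,\xi(t)$ on $G_H$ (reconstruction equation). -/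

import Mathlib

open Set Filter Topology
open scoped Manifold ContDiff

noncomputable section

namespace PoliteAction

section Isotropy

variable {G P : Type*} [Group G] [MulAction G P]

/-- The set `P_H` of points whose isotropy group is exactly `H`. -/
def isotropySet (P : Type*) [MulAction G P] (H : Subgroup G) : Set P :=
  {p | MulAction.stabilizer G p = H}

/-- The group `G_H = N^H / H`, where `N^H` is the normalizer of `H` in `G`.  If `G` is a topological
group it carries the quotient topology of the subspace topology of `N^H`. -/
abbrev NormalizerQuotient (H : Subgroup G) : Type _ :=
  ↥(Subgroup.normalizer (H : Set G)) ⧸ H.subgroupOf (Subgroup.normalizer (H : Set G))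

theorem smul_mem_isotropySet {H : Subgroup G} {n : G}
    (hn : n ∈ Subgroup.normalizer (H : Set G)) {p : P} (hp : p ∈ isotropySet P H) :
    n • p ∈ isotropySet P H := by
  have hp' : MulAction.stabilizer G p = H := hp
  change MulAction.stabilizer G (n • p) = H
  ext g
  have hn' := (Subgroup.inv_mem _ hn)
  rw [Subgroup.mem_normalizer_iff] at hn'
  have h := hn' g
  rw [inv_inv] at h
  have hst : n⁻¹ * g * n ∈ H ↔ n⁻¹ * g * n ∈ MulAction.stabilizer G p := by rw [hp']
  rw [h, hst, MulAction.mem_stabilizer_iff, MulAction.mem_stabilizer_iff, mul_smul, mul_smul,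
    inv_smul_eq_iff]

/-- The action `[n] • p = n • p` of `G_H = N^H / H` on `P_H`. -/
instance isotropyAction (H : Subgroup G) :
    MulAction (NormalizerQuotient H) ↥(isotropySet P H) where
  smul a p := Quotient.liftOn' a
    (fun n => (⟨(n : G) • (p : P), smul_mem_isotropySet n.2 p.2⟩ : ↥(isotropySet P H)))
    (by
      intro m n hmn
      rw [QuotientGroup.leftRel_apply, Subgroup.mem_subgroupOf] at hmn
      have hp : MulAction.stabilizer G (p : P) = H := p.2
      have hst : (m : G)⁻¹ * (n : G) ∈ MulAction.stabilizer G (p : P) := hp.symm ▸ hmn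
      rw [MulAction.mem_stabilizer_iff, mul_smul, inv_smul_eq_iff] at hst
      exact Subtype.ext hst.symm)
  one_smul p := Subtype.ext (one_smul G (p : P))
  mul_smul a b p := by
    induction a using QuotientGroup.induction_on with | H m => ?_
    induction b using QuotientGroup.induction_on with | H n => ?_
    exact Subtype.ext (mul_smul (m : G) (n : G) (p : P))

theorem coe_mk_smul (H : Subgroup G) (n : ↥(Subgroup.normalizer (H : Set G)))
    (p : ↥(isotropySet P H)) :
    (((n : NormalizerQuotient H) • p : ↥(isotropySet P H)) : P) = (n : G) • (p : P) := rfl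

end Isotropy

section Submanifold

variable (E : Type*) [NormedAddCommGroup E] [NormedSpace ℝ E]
  {P : Type*} [TopologicalSpace P] [ChartedSpace E P]

/-- There are smooth coordinates of `P` around `p` (a diffeomorphism `φ` of an open neighbourhood
of `p` onto an open subset of `E`) in which `S` is a piece of a `d`-dimensional affine subspace. -/
def HasSliceChart (S : Set P) (p : P) (d : ℕ) : Prop :=
  ∃ φ : OpenPartialHomeomorph P E, p ∈ φ.source ∧
    ContMDiffOn 𝓘(ℝ, E) 𝓘(ℝ, E) ∞ φ φ.source ∧
    ContMDiffOn 𝓘(ℝ, E) 𝓘(ℝ, E) ∞ φ.symm φ.target ∧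
    ∃ F : Submodule ℝ E, Module.finrank ℝ F = d ∧
      ∀ q ∈ φ.source, q ∈ S ↔ φ q - φ p ∈ F

/-- `S` is an embedded submanifold of `P`; its components may have different dimensions. -/
def IsEmbeddedSubmanifold (S : Set P) : Prop :=
  ∀ p ∈ S, ∃ d : ℕ, HasSliceChart E S p d

end Submanifold

section Polite

variable (EG E : Type*) [NormedAddCommGroup EG] [NormedSpace ℝ EG]
  [NormedAddCommGroup E] [NormedSpace ℝ E]
  {G P : Type*} [Group G] [TopologicalSpace G] [ChartedSpace EG G]
  [TopologicalSpace P] [ChartedSpace E P] [MulAction G P]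

/-- The action of `G` on `P` is polite if, for every closed subgroup `H`, the set `P_H` is a
manifold (an embedded submanifold of `P`) and the action of `G_H = N^H / H` on it is proper. -/
def IsPolite (G P : Type*) [Group G] [TopologicalSpace G]
    [TopologicalSpace P] [ChartedSpace E P] [MulAction G P] : Prop :=
  ∀ H : Subgroup G, IsClosed (H : Set G) →
    IsEmbeddedSubmanifold E (isotropySet P H) ∧
      ProperSMul (NormalizerQuotient H) ↥(isotropySet P H)

theorem HasSliceChart.smul [ContMDiffSMul 𝓘(ℝ, EG) 𝓘(ℝ, E) ∞ G P] {H : Subgroup G} {n : G}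
    (hn : n ∈ Subgroup.normalizer (H : Set G)) {p : P} {d : ℕ}
    (h : HasSliceChart E (isotropySet P H) p d) :
    HasSliceChart E (isotropySet P H) (n • p) d := by
  have hsm : ∀ g : G, ContMDiff 𝓘(ℝ, E) 𝓘(ℝ, E) ∞ (fun q : P => g • q) := fun g =>
    (ContMDiffSMul.contMDiff_smul (I := 𝓘(ℝ, EG)) (I' := 𝓘(ℝ, E)) (n := ∞) (G := G)
      (M := P)).comp (contMDiff_const.prodMk contMDiff_id)
  obtain ⟨φ, hp, h1, h2, F, hF, h3⟩ := h
  let τ : P ≃ₜ P :=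
    { toFun := fun q => n⁻¹ • q
      invFun := fun q => n • q
      left_inv := fun q => smul_inv_smul n q
      right_inv := fun q => inv_smul_smul n q
      continuous_toFun := (hsm n⁻¹).continuous
      continuous_invFun := (hsm n).continuous }
  refine ⟨τ.transOpenPartialHomeomorph φ, ?_, ?_, ?_, F, hF, ?_⟩
  · change n⁻¹ • n • p ∈ φ.source
    rwa [inv_smul_smul]
  · exact h1.comp (hsm n⁻¹).contMDiffOn (fun q hq => hq)
  · exact (hsm n).comp_contMDiffOn h2
  · intro q hq
    change q ∈ isotropySet P H ↔ φ (n⁻¹ • q) - φ (n⁻¹ • n • p) ∈ F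
    rw [inv_smul_smul, ← h3 (n⁻¹ • q) hq]
    constructor
    · exact smul_mem_isotropySet (Subgroup.inv_mem _ hn)
    · intro h
      have := smul_mem_isotropySet hn h
      rwa [smul_inv_smul] at this

/-- The part of `P_H` where it has dimension `d`, as a `G_H`-invariant subset of `P_H`.  The manifold
`P_H` is the disjoint union of these open parts. -/
def dimPart [ContMDiffSMul 𝓘(ℝ, EG) 𝓘(ℝ, E) ∞ G P] (H : Subgroup G) (d : ℕ) :
    SubMulAction (NormalizerQuotient H) ↥(isotropySet P H) where
  carrier := {p | HasSliceChart E (isotropySet P H) (p : P) d}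
  smul_mem' a p hp := by
    induction a using QuotientGroup.induction_on with | H n => ?_
    exact HasSliceChart.smul EG E n.2 hp

end Polite

section Reduction

/-- A smooth left principal `K`-bundle `ρ : M → Q`: `K` acts smoothly on `M`, `ρ` is smooth, and
`ρ` has smooth `K`-equivariant local trivializations `ρ⁻¹(U) ≅ U × K` around every point of `Q`. -/
structure IsSmoothPrincipalBundle {k d m : ℕ} (K M Q : Type*) [Group K] [TopologicalSpace K]
    [ChartedSpace (EuclideanSpace ℝ (Fin k)) K] [TopologicalSpace M]
    [ChartedSpace (EuclideanSpace ℝ (Fin d)) M] [TopologicalSpace Q]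
    [ChartedSpace (EuclideanSpace ℝ (Fin m)) Q] [MulAction K M] (ρ : M → Q) : Prop where
  smooth_action : ContMDiffSMul (𝓡 k) (𝓡 d) ∞ K M
  smooth_proj : ContMDiff (𝓡 d) (𝓡 m) ∞ ρ
  locally_trivial : ∀ q : Q, ∃ e : Bundle.Trivialization K ρ, q ∈ e.baseSet ∧
    ContMDiffOn (𝓡 d) ((𝓡 m).prod (𝓡 k)) ∞ e e.source ∧
    ContMDiffOn ((𝓡 m).prod (𝓡 k)) (𝓡 d) ∞ e.toOpenPartialHomeomorph.symm e.target ∧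
    ∀ (a : K), ∀ x ∈ e.source, e (a • x) = ((e x).1, a * (e x).2)

/-- A smooth vector field on a manifold. -/
def IsSmoothVectorField {E : Type*} [NormedAddCommGroup E] [NormedSpace ℝ E] {M : Type*}
    [TopologicalSpace M] [ChartedSpace E M] [IsManifold 𝓘(ℝ, E) ∞ M]
    (X : (x : M) → TangentSpace 𝓘(ℝ, E) x) : Prop :=
  ContMDiff 𝓘(ℝ, E) 𝓘(ℝ, E).tangent ∞ (fun x => (⟨x, X x⟩ : TangentBundle 𝓘(ℝ, E) M))

variable (EG E : Type*) [NormedAddCommGroup EG] [NormedSpace ℝ EG]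
  [NormedAddCommGroup E] [NormedSpace ℝ E]
  {G P : Type*} [Group G] [TopologicalSpace G] [ChartedSpace EG G]
  [TopologicalSpace P] [ChartedSpace E P] [MulAction G P]

/-- The action of `G` preserves the vector field `X`. -/
def PreservesVectorField (G : Type*) {P : Type*} [Group G] [TopologicalSpace P] [ChartedSpace E P]
    [MulAction G P] (X : (p : P) → TangentSpace 𝓘(ℝ, E) p) : Prop :=
  ∀ (g : G) (p : P), mfderiv 𝓘(ℝ, E) 𝓘(ℝ, E) (fun q : P => g • q) p (X p) = X (g • p)

variable [ContMDiffSMul 𝓘(ℝ, EG) 𝓘(ℝ, E) ∞ G P]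

/-- The inclusion into `P` of the `d`-dimensional part of `P_H`. -/
def dimPartIncl (H : Subgroup G) (d : ℕ) (p : ↥(dimPart EG E (P := P) H d)) : P :=
  ((p : ↥(isotropySet P H)) : P)

/-- The orbit space of the action of `G_H` on the `d`-dimensional part of `P_H`, with the quotient
topology; the disjoint union over `d` of these spaces is `P_H / G_H`. -/
abbrev ReducedSpace (P : Type*) [TopologicalSpace P] [ChartedSpace E P] [MulAction G P]
    [ContMDiffSMul 𝓘(ℝ, EG) 𝓘(ℝ, E) ∞ G P] (H : Subgroup G) (d : ℕ) : Type _ :=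
  MulAction.orbitRel.Quotient (NormalizerQuotient H) ↥(dimPart EG E (P := P) H d)

/-- The orbit map `ρ_H` of the action of `G_H` on the `d`-dimensional part of `P_H`. -/
def reducedProj (H : Subgroup G) (d : ℕ) (p : ↥(dimPart EG E (P := P) H d)) :
    ReducedSpace EG E P H d :=
  Quotient.mk _ p

/-- The orbit map `ρ : P → P / G`. -/
def orbitProj (G : Type*) {P : Type*} [Group G] [MulAction G P] (p : P) :
    MulAction.orbitRel.Quotient G P :=
  Quotient.mk _ p

/-- The map `P_H / G_H → P / G` that sends the `G_H`-orbit of `p` to the `G`-orbit of `p`. -/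
def reducedIncl (H : Subgroup G) (d : ℕ) :
    ReducedSpace EG E P H d → MulAction.orbitRel.Quotient G P :=
  Quotient.lift (fun p => orbitProj G (dimPartIncl EG E H d p)) (by
    intro p q hpq
    obtain ⟨a, rfl⟩ := hpq
    induction a using QuotientGroup.induction_on with | H n => ?_
    exact Quotient.sound ⟨(n : G), rfl⟩)

/-- The reduced and the reconstruction equations on the `d`-dimensional part of `P_H`, for given
manifold structures on `G_H`, on that part of `P_H` and on its orbit space. -/
structure IsReductionOn {k d m : ℕ} (X : (p : P) → TangentSpace 𝓘(ℝ, E) p) (H : Subgroup G)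
    [ChartedSpace (EuclideanSpace ℝ (Fin k)) (NormalizerQuotient H)]
    [ChartedSpace (EuclideanSpace ℝ (Fin d)) ↥(dimPart EG E (P := P) H d)]
    [ChartedSpace (EuclideanSpace ℝ (Fin m)) (ReducedSpace EG E P H d)]
    (XH : (p : ↥(dimPart EG E (P := P) H d)) → TangentSpace (𝓡 d) p)
    (Xred : (q : ReducedSpace EG E P H d) → TangentSpace (𝓡 m) q) : Prop where
  /-- `XH` is the restriction of `X` to `P_H`. -/
  restrict : ∀ p, mfderiv (𝓡 d) 𝓘(ℝ, E) (dimPartIncl EG E H d) p (XH p)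
    = X (dimPartIncl EG E H d p)
  /-- `Xred` is the projection of `XH` to the orbit space. -/
  project : ∀ p, mfderiv (𝓡 d) (𝓡 m) (reducedProj EG E H d) p (XH p) = Xred (reducedProj EG E H d p)
  /-- `Xred` presents the derivation `ρ_* X` of the algebra of functions on `P / G` whose pull-backs
  to `P` are smooth. -/
  derivation : ∀ f : MulAction.orbitRel.Quotient G P → ℝ,
    ContMDiff 𝓘(ℝ, E) 𝓘(ℝ, ℝ) ∞ (f ∘ orbitProj G) →
      ContMDiff (𝓡 m) 𝓘(ℝ, ℝ) ∞ (f ∘ reducedIncl EG E H d) ∧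
      ∀ p, (mfderiv (𝓡 m) 𝓘(ℝ, ℝ) (f ∘ reducedIncl EG E H d) (reducedProj EG E H d p)
          (Xred (reducedProj EG E H d p)) : ℝ) =
        mfderiv 𝓘(ℝ, E) 𝓘(ℝ, ℝ) (f ∘ orbitProj G) (dimPartIncl EG E H d p)
          (X (dimPartIncl EG E H d p))
  /-- Reduction: evolutions in `P_H` project to integral curves of `Xred`. -/
  reduction : ∀ (J : Set ℝ), J.OrdConnected → ∀ γ : ℝ → ↥(dimPart EG E (P := P) H d),
    IsMIntegralCurveOn (I := 𝓘(ℝ, E)) (dimPartIncl EG E H d ∘ γ) X J →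
      IsMIntegralCurveOn (I := 𝓡 m) (reducedProj EG E H d ∘ γ) Xred J
  /-- Reconstruction: every integral curve of `Xred` is the projection of an evolution, with any
  prescribed initial point in the fibre. -/
  reconstruction : ∀ (J : Set ℝ), J.OrdConnected → ∀ c : ℝ → ReducedSpace EG E P H d,
    IsMIntegralCurveOn (I := 𝓡 m) c Xred J →
      ∀ t₀ ∈ J, ∀ p₀, reducedProj EG E H d p₀ = c t₀ →
        ∃ γ : ℝ → ↥(dimPart EG E (P := P) H d), γ t₀ = p₀ ∧
          IsMIntegralCurveOn (I := 𝓘(ℝ, E)) (dimPartIncl EG E H d ∘ γ) X J ∧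
          ∀ t ∈ J, reducedProj EG E H d (γ t) = c t
  /-- The reconstruction equation: if `b` is a smooth lift to `P_H` of an integral curve of `Xred`,
  then `t ↦ g t • b t` is an evolution if and only if `g` solves a differential equation
  `g' = g · ξ(t)` on the Lie group `G_H`, where `ξ` is a smooth curve in its Lie algebra,
  the tangent space at the identity, whose underlying space is the model space `ℝ^k`. -/
  reconstruction_equation : ∀ (J : Set ℝ), J.OrdConnected →
    ∀ b : ℝ → ↥(dimPart EG E (P := P) H d), ContMDiffOn 𝓘(ℝ, ℝ) (𝓡 d) ∞ b J →
      IsMIntegralCurveOn (I := 𝓡 m) (reducedProj EG E H d ∘ b) Xred J →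
        ∃ ξ : ℝ → EuclideanSpace ℝ (Fin k), ContDiffOn ℝ ∞ ξ J ∧
          ∀ g : ℝ → NormalizerQuotient H,
            IsMIntegralCurveOn (I := 𝓘(ℝ, E)) (fun t => dimPartIncl EG E H d (g t • b t)) X J ↔
              ∀ t ∈ J, HasMFDerivWithinAt 𝓘(ℝ, ℝ) (𝓡 k) g J t
                ((1 : ℝ →L[ℝ] ℝ).smulRight (mulInvariantVectorField
                  (ξ t : GroupLieAlgebra (𝓡 k) (NormalizerQuotient H)) (g t)))

/-- The action of `G` on `P`, which preserves `X`, admits reduction and reconstruction: the reduced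
equation and the reconstruction equations are differential equations on manifolds. -/
structure AdmitsReductionAndReconstruction (G : Type*) {P : Type*} [Group G] [TopologicalSpace G]
    [ChartedSpace EG G] [TopologicalSpace P] [ChartedSpace E P] [MulAction G P]
    [ContMDiffSMul 𝓘(ℝ, EG) 𝓘(ℝ, E) ∞ G P] (X : (p : P) → TangentSpace 𝓘(ℝ, E) p) : Prop where
  /-- The flow of `X` preserves `P_H`. -/
  flow_preserves : ∀ H : Subgroup G, IsClosed (H : Set G) →
    ∀ (J : Set ℝ), J.OrdConnected → ∀ γ : ℝ → P, IsMIntegralCurveOn (I := 𝓘(ℝ, E)) γ X J →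
      ∀ t₀ ∈ J, γ t₀ ∈ isotropySet P H → ∀ t ∈ J, γ t ∈ isotropySet P H
  /-- Every evolution takes place in one of the manifolds to which the next field applies. -/
  evolution : ∀ (J : Set ℝ), J.OrdConnected → J.Nonempty →
    ∀ γ : ℝ → P, IsMIntegralCurveOn (I := 𝓘(ℝ, E)) γ X J →
      ∃ H : Subgroup G, IsClosed (H : Set G) ∧ ∃ d : ℕ,
        ∀ t ∈ J, γ t ∈ range (dimPartIncl EG E (P := P) H d)
  /-- `G_H` is a Lie group, `P_H` is a manifold and a principal `G_H`-bundle over the manifold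
  `P_H / G_H`, and the reduced and reconstruction equations are differential equations on these. -/
  bundle : ∀ H : Subgroup G, IsClosed (H : Set G) →
    T2Space (NormalizerQuotient H) ∧ SecondCountableTopology (NormalizerQuotient H) ∧
    (∀ p : ↥(isotropySet P H), ∃! d : ℕ, p ∈ dimPart EG E (P := P) H d) ∧
    (∀ d, IsOpen (dimPart EG E (P := P) H d : Set ↥(isotropySet P H))) ∧
    ∃ (k : ℕ) (_ : ChartedSpace (EuclideanSpace ℝ (Fin k)) (NormalizerQuotient H))
      (_ : LieGroup (𝓡 k) ∞ (NormalizerQuotient H)),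
      (∀ f : NormalizerQuotient H → ℝ, ContMDiff (𝓡 k) 𝓘(ℝ, ℝ) ∞ f ↔
        ∀ n : ↥(Subgroup.normalizer (H : Set G)), ∃ F : G → ℝ,
          ContMDiff 𝓘(ℝ, EG) 𝓘(ℝ, ℝ) ∞ F ∧
          ∀ᶠ l : ↥(Subgroup.normalizer (H : Set G)) in 𝓝 n,
            f (l : NormalizerQuotient H) = F (l : G)) ∧
      ∀ d : ℕ,
        ∃ (_ : ChartedSpace (EuclideanSpace ℝ (Fin d)) ↥(dimPart EG E (P := P) H d))
          (_ : IsManifold (𝓡 d) ∞ ↥(dimPart EG E (P := P) H d)) (m : ℕ)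
          (_ : ChartedSpace (EuclideanSpace ℝ (Fin m)) (ReducedSpace EG E P H d))
          (_ : IsManifold (𝓡 m) ∞ (ReducedSpace EG E P H d)),
          Manifold.IsSmoothEmbedding (𝓡 d) 𝓘(ℝ, E) ∞ (dimPartIncl EG E (P := P) H d) ∧
          T2Space (ReducedSpace EG E P H d) ∧
          SecondCountableTopology (ReducedSpace EG E P H d) ∧
          IsSmoothPrincipalBundle (k := k) (d := d) (m := m) (NormalizerQuotient H)
            ↥(dimPart EG E (P := P) H d) (ReducedSpace EG E P H d) (reducedProj EG E H d) ∧
          (∀ f : ReducedSpace EG E P H d → ℝ, ContMDiff (𝓡 m) 𝓘(ℝ, ℝ) ∞ f ↔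
            ContMDiff (𝓡 d) 𝓘(ℝ, ℝ) ∞ (f ∘ reducedProj EG E H d)) ∧
          Function.Injective (reducedIncl EG E (P := P) H d) ∧
          ∃ (XH : (p : ↥(dimPart EG E (P := P) H d)) → TangentSpace (𝓡 d) p)
            (Xred : (q : ReducedSpace EG E P H d) → TangentSpace (𝓡 m) q),
            IsSmoothVectorField XH ∧ IsSmoothVectorField Xred ∧
            IsReductionOn (k := k) EG E X H XH Xred

end Reduction

end PoliteAction

end

/-! Flow. Every `g` in `G` maps integral curves of `X` to integral curves of `X`. If `g` fixes one
point of such a curve, uniqueness makes it fix the whole curve, so the isotropy group is constant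
along it (`stabilizer_eq_of_isMIntegralCurveOn`). The dimension of `P_H` is locally constant, hence
also constant along a curve on an interval. The isotropy group of a point is closed because `P` is
Hausdorff, so every curve is covered by some closed `H`.

Geometry. Since isotropy groups on `P_H` equal `H` exactly, `G_H` acts freely there, and politeness
says that it acts properly. The rest is the classical theory of closed subgroups and of free proper
actions. Cartan's argument (`oneParam_mem_of_tendsto`) shows that limits of rescaled small elements
of a closed subgroup generate one-parameter subgroups of it. This yields smooth local cross-sections
of `N^H → N^H/H` (`exists_local_cross_section`), hence charts of `G_H`. For the action, orbit maps
are immersions, so a transversal to an orbit together with the group gives product coordinates, and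
properness makes the transversal meet each orbit at most once (`nonempty_localSlice`). Slices give
the charts of the orbit space and the local trivializations.

All three new manifolds, `G_H`, `P_H^d` and `P_H^d/G_H`, are treated as subquotients `M ← S → Q` of
known ones (`SpanChart`, `IsSmoothSpan`): smooth local sections `Q → S`, and local smooth extensions
to `M` of the projection `S → Q`. Maps into `Q` are smooth when they lift smoothly, maps out of `Q`
when they extend smoothly.

Dynamics. `X` is tangent to `P_H^d` because its flow preserves it; the restriction is
`G_H`-invariant and so descends. To lift an integral curve `c` of the reduced field, take an
integral curve upstairs through one point over `c s`. By uniqueness below it projects to `c` near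
`s`, and its translates start at every point of the fibre with the same time of existence. Hence
lifts never stop inside `J` (`IsSmoothVectorField.exists_isMIntegralCurveOn_of_local`). Given a
smooth lift `b`, one solution has the form `g₀ • b`. Put `ξ = g₀⁻¹ g₀'`. Solutions `g • b` are those
with `g = a g₀` for constant `a`, which are also the solutions of `g' = g ξ`
(`isMIntegralCurveOn_smul_iff`). -/

open Set Filter Topology
open scoped Manifold ContDiff

noncomputable section

namespace PoliteAction

/-! ### Inverse function theorem on manifolds -/

section InverseFunction

variable {V E N : Type*} [NormedAddCommGroup V] [NormedSpace ℝ V]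
  [NormedAddCommGroup E] [NormedSpace ℝ E] [TopologicalSpace N] [ChartedSpace E N]

/-- The inverse function theorem for a smooth map from a Banach space to a manifold. -/
theorem exists_openPartialHomeomorph_of_hasMFDerivAt [CompleteSpace V] [IsManifold 𝓘(ℝ, E) ∞ N]
    {f : V → N} {U : Set V} (hU : IsOpen U) (hf : ContMDiffOn 𝓘(ℝ, V) 𝓘(ℝ, E) ∞ f U)
    {x : V} (hx : x ∈ U) (f' : V ≃L[ℝ] E)
    (hf' : HasMFDerivAt 𝓘(ℝ, V) 𝓘(ℝ, E) f x (f' : V →L[ℝ] E)) :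
    ∃ Φ : OpenPartialHomeomorph V N, x ∈ Φ.source ∧ Φ.source ⊆ U ∧ EqOn Φ f Φ.source ∧
      ContMDiffOn 𝓘(ℝ, E) 𝓘(ℝ, V) ∞ Φ.symm Φ.target ∧
      HasMFDerivAt 𝓘(ℝ, E) 𝓘(ℝ, V) Φ.symm (f x) (f'.symm : E →L[ℝ] V) := by
  suffices h : ∃ Φ : OpenPartialHomeomorph V N, x ∈ Φ.source ∧ Φ.source ⊆ U ∧ EqOn Φ f Φ.source ∧
      ContMDiffOn 𝓘(ℝ, E) 𝓘(ℝ, V) ∞ Φ.symm Φ.target by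
    obtain ⟨Φ, h1, h2, h3, h4⟩ := h
    refine ⟨Φ, h1, h2, h3, h4, ?_⟩
    have h5 : f x ∈ Φ.target := h3 h1 ▸ Φ.map_source h1
    have h6 := ((h4.contMDiffAt (Φ.open_target.mem_nhds h5)).mdifferentiableAt
      (by simp)).hasMFDerivAt
    have h7 := h6.comp x hf'
    -- The derivative of the inverse is forced by the chain rule, because `Φ.symm ∘ f` is the
    -- identity near `x`.
    have h8 : HasMFDerivAt 𝓘(ℝ, V) 𝓘(ℝ, V) (Φ.symm ∘ f) x (ContinuousLinearMap.id ℝ V) := by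
      refine (hasMFDerivAt_id x).congr_of_eventuallyEq ?_
      filter_upwards [Φ.open_source.mem_nhds h1] with y hy
      rw [Function.comp_apply, ← h3 hy, Φ.left_inv hy, id]
    refine h6.congr_mfderiv (ContinuousLinearMap.ext fun w => ?_)
    obtain ⟨w, rfl⟩ := f'.surjective w
    refine (DFunLike.congr_fun (hasMFDerivAt_unique h7 h8) w).trans ?_
    exact (f'.symm_apply_apply w).symm
  set c := chartAt E (f x) with hc
  set O := U ∩ f ⁻¹' c.source with hO
  have hOo : IsOpen O := hf.continuousOn.isOpen_inter_preimage hU c.open_source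
  have hxO : x ∈ O := ⟨hx, mem_chart_source E (f x)⟩
  have hg : ContDiffOn ℝ ∞ (c ∘ f) O := by
    rw [← contMDiffOn_iff_contDiffOn]
    exact (contMDiffOn_chart (I := 𝓘(ℝ, E)) (x := f x)).comp (hf.mono inter_subset_left)
      (fun y hy => hy.2)
  have hg' : HasFDerivAt (c ∘ f) (f' : V →L[ℝ] E) x := by
    have h : HasFDerivWithinAt (writtenInExtChartAt 𝓘(ℝ, V) 𝓘(ℝ, E) x f) (f' : V →L[ℝ] E)
      (range 𝓘(ℝ, V)) (extChartAt 𝓘(ℝ, V) x x) := hf'.2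
    simpa [writtenInExtChartAt, mfld_simps, chartAt_self_eq, ← hc] using h
  have hgx : ContDiffAt ℝ ∞ (c ∘ f) x := hg.contDiffAt (hOo.mem_nhds hxO)
  have hne : (∞ : WithTop ℕ∞) ≠ 0 := by simp
  set ψ := hgx.toOpenPartialHomeomorph (c ∘ f) hg' hne with hψ
  -- The inverse is smooth at an image point when the derivative is invertible there. Invertibility
  -- is an open condition, so restricting to `D` gives smoothness on the whole target rather than at
  -- one point.
  set D := O ∩ (fderiv ℝ (c ∘ f)) ⁻¹' (range ((↑) : (V ≃L[ℝ] E) → V →L[ℝ] E)) with hD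
  have hDo : IsOpen D :=
    (hg.continuousOn_fderiv_of_isOpen hOo (by simp)).isOpen_inter_preimage hOo
      (ContinuousLinearEquiv.isOpen)
  have hxD : x ∈ D := ⟨hxO, by rw [mem_preimage, hg'.fderiv]; exact ⟨f', rfl⟩⟩
  have hsrc : ∀ y ∈ ((ψ.restrOpen D hDo) ≫ₕ c.symm).source, y ∈ D := by
    intro y hy
    simp only [mfld_simps] at hy
    exact hy.1.2
  refine ⟨(ψ.restrOpen D hDo) ≫ₕ c.symm, ?_, fun y hy => (hsrc y hy).1.1, ?_, ?_⟩
  · simp only [mfld_simps]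
    exact ⟨⟨hgx.mem_toOpenPartialHomeomorph_source hg' hne, hxD⟩, c.map_source hxO.2⟩
  · intro y hy
    exact c.left_inv (hsrc y hy).1.2
  · have h1 : ContMDiffOn 𝓘(ℝ, E) 𝓘(ℝ, V) ∞ ψ.symm (ψ.restrOpen D hDo).target := by
      rw [contMDiffOn_iff_contDiffOn]
      intro z hz
      have hz' := (ψ.restrOpen D hDo).map_target hz
      have hzD : ψ.symm z ∈ D := hz'.2
      obtain ⟨e, he⟩ := hzD.2
      have h2 : ContDiffAt ℝ ∞ (c ∘ f) (ψ.symm z) := hg.contDiffAt (hOo.mem_nhds hzD.1)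
      have hzt : z ∈ ψ.target := by
        have := hz
        simp only [mfld_simps] at this
        exact this.1
      refine (ψ.contDiffAt_symm hzt (f₀' := e) ?_ h2).contDiffWithinAt
      have := (h2.differentiableAt hne).hasFDerivAt
      rw [← he] at this
      exact this
    have h3 : ContMDiffOn 𝓘(ℝ, E) 𝓘(ℝ, E) ∞ c c.source := contMDiffOn_chart
    have : (((ψ.restrOpen D hDo) ≫ₕ c.symm).symm : N → V) = ψ.symm ∘ c := rfl
    rw [this]
    refine h1.comp (h3.mono ?_) ?_
    · intro y hy
      simp only [mfld_simps] at hy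
      exact hy.1
    · intro y hy
      have := (((ψ.restrOpen D hDo) ≫ₕ c.symm)).map_target hy
      rw [OpenPartialHomeomorph.trans_target] at hy
      exact hy.2

end InverseFunction

/-! ### Integral curves on arbitrary intervals: extension, uniqueness, smoothness -/

section IntegralCurves

variable {E M : Type*} [NormedAddCommGroup E] [NormedSpace ℝ E]
  [TopologicalSpace M] [ChartedSpace E M]
  {X : (x : M) → TangentSpace 𝓘(ℝ, E) x} {γ δ : ℝ → M}

/-- Only `b` needs care. There the derivatives within the two pieces coincide, both being the value
of `X` at the common point, so they combine to a derivative within the union. -/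
theorem isMIntegralCurveOn_ite {s t : Set ℝ} {b : ℝ} (hs : ∀ x ∈ s, x ≤ b) (ht : ∀ x ∈ t, b ≤ x)
    (hγ : IsMIntegralCurveOn γ X s) (hδ : IsMIntegralCurveOn δ X t) (hb : γ b = δ b)
    (hbs : b ∈ s) (hbt : b ∈ t) :
    IsMIntegralCurveOn (fun x => if x ≤ b then γ x else δ x) X (s ∪ t) := by
  set η : ℝ → M := fun x => if x ≤ b then γ x else δ x with hη
  have h1 : EqOn η γ s := fun x hx => if_pos (hs x hx)
  have h2 : EqOn η δ t := by
    intro x hx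
    rcases eq_or_lt_of_le (ht x hx) with h | h
    · subst h
      exact (if_pos le_rfl).trans hb
    · exact if_neg (not_le.2 h)
  have h3 : ∀ x ∈ s, HasMFDerivWithinAt 𝓘(ℝ, ℝ) 𝓘(ℝ, E) η s x
      ((1 : ℝ →L[ℝ] ℝ).smulRight (X (η x))) := by
    intro x hx
    rw [h1 hx]
    exact (hγ x hx).congr_mono h1 (h1 hx) subset_rfl
  have h4 : ∀ x ∈ t, HasMFDerivWithinAt 𝓘(ℝ, ℝ) 𝓘(ℝ, E) η t x
      ((1 : ℝ →L[ℝ] ℝ).smulRight (X (η x))) := by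
    intro x hx
    rw [h2 hx]
    exact (hδ x hx).congr_mono h2 (h2 hx) subset_rfl
  intro x hx
  rcases lt_trichotomy x b with h | h | h
  · have hxs : x ∈ s := hx.resolve_right (fun h' => absurd (ht _ h') (not_le.2 h))
    refine (h3 x hxs).mono_of_mem_nhdsWithin ?_
    filter_upwards [self_mem_nhdsWithin, mem_nhdsWithin_of_mem_nhds (Iio_mem_nhds h)] with y hy hy'
    exact hy.resolve_right (fun h' => absurd (ht _ h') (not_le.2 (mem_Iio.1 hy')))
  · subst h
    exact (h3 x hbs).union (h4 x hbt)
  · have hxs : x ∈ t := hx.resolve_left (fun h' => absurd (hs _ h') (not_le.2 h))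
    refine (h4 x hxs).mono_of_mem_nhdsWithin ?_
    filter_upwards [self_mem_nhdsWithin, mem_nhdsWithin_of_mem_nhds (Ioi_mem_nhds h)] with y hy hy'
    exact hy.resolve_left (fun h' => absurd (hs _ h') (not_le.2 (mem_Ioi.1 hy')))

variable [IsManifold 𝓘(ℝ, E) ∞ M]

theorem IsSmoothVectorField.exists_isMIntegralCurveOn_Ioo [CompleteSpace E]
    (hX : IsSmoothVectorField X) (x : M) (t : ℝ) :
    ∃ γ : ℝ → M, γ t = x ∧ ∃ ε > 0, IsMIntegralCurveOn γ X (Ioo (t - ε) (t + ε)) := by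
  have : IsManifold 𝓘(ℝ, E) 1 M := .of_le (n := ∞) (by simp)
  obtain ⟨γ, h, h'⟩ := exists_isMIntegralCurveAt_of_contMDiffAt_boundaryless t
    ((hX x).of_le (by simp) : ContMDiffAt 𝓘(ℝ, E) 𝓘(ℝ, E).tangent 1
      (fun x => (⟨x, X x⟩ : TangentBundle 𝓘(ℝ, E) M)) x)
  obtain ⟨ε, hε, h''⟩ := isMIntegralCurveAt_iff'.1 h'
  exact ⟨γ, h, ε, hε, by rwa [Real.ball_eq_Ioo] at h''⟩

/-- An integral curve on an interval extends to an open interval. -/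
theorem IsSmoothVectorField.exists_extend_isOpen [CompleteSpace E] (hX : IsSmoothVectorField X)
    {J : Set ℝ} (hJ : J.OrdConnected) (hγ : IsMIntegralCurveOn γ X J) :
    ∃ (J' : Set ℝ) (γ' : ℝ → M), IsOpen J' ∧ J'.OrdConnected ∧ J ⊆ J' ∧ EqOn γ' γ J ∧
      IsMIntegralCurveOn γ' X J' := by
  -- Openness can fail only at an endpoint that belongs to `J`. There a local solution through the
  -- endpoint is glued on, first on the right and then on the left.
  have right : ∃ (J' : Set ℝ) (γ' : ℝ → M), (∀ t ∈ J', ∃ s ∈ J', t < s) ∧ J'.OrdConnected ∧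
      J ⊆ J' ∧ EqOn γ' γ J ∧ IsMIntegralCurveOn γ' X J' := by
    by_cases h : ∃ b ∈ J, ∀ t ∈ J, t ≤ b
    · obtain ⟨b, hb, hmax⟩ := h
      obtain ⟨δ, hδb, ε, hε, hδ⟩ := hX.exists_isMIntegralCurveOn_Ioo (γ b) b
      refine ⟨J ∪ Ico b (b + ε), fun x => if x ≤ b then γ x else δ x, ?_, ?_, subset_union_left,
        fun x hx => if_pos (hmax x hx), isMIntegralCurveOn_ite hmax (fun x hx => hx.1) hγ
          (hδ.mono fun x hx => ⟨by linarith [hx.1], hx.2⟩) hδb.symm hb ⟨le_rfl, by linarith⟩⟩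
      · intro t ht
        have h1 : t < b + ε := by
          rcases ht with ht | ht
          · linarith [hmax t ht]
          · exact ht.2
        have h2 : b < b + ε := by linarith
        refine ⟨max ((t + (b + ε)) / 2) b, Or.inr ⟨le_max_right _ _, max_lt (by linarith) h2⟩,
          lt_max_of_lt_left (by linarith)⟩
      · refine ⟨?_⟩
        rintro x hx y hy z ⟨hz1, hz2⟩
        by_cases hzb : z ≤ b
        · rcases hx with hx | hx
          · exact Or.inl (hJ.out hx hb ⟨hz1, hzb⟩)
          · exact Or.inl (le_antisymm hzb (hx.1.trans hz1) ▸ hb)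
        · rcases hy with hy | hy
          · exact absurd (hz2.trans (hmax y hy)) hzb
          · exact Or.inr ⟨(not_le.1 hzb).le, hz2.trans_lt hy.2⟩
    · push Not at h
      exact ⟨J, γ, h, hJ, subset_rfl, fun _ _ => rfl, hγ⟩
  obtain ⟨J₁, γ₁, hr, hJ₁, hJJ, heq, hγ₁⟩ := right
  have left : ∃ (J' : Set ℝ) (γ' : ℝ → M), (∀ t ∈ J', ∃ s ∈ J', t < s) ∧ 
      (∀ t ∈ J', ∃ s ∈ J', s < t) ∧ J'.OrdConnected ∧
      J₁ ⊆ J' ∧ EqOn γ' γ₁ J₁ ∧ IsMIntegralCurveOn γ' X J' := by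
    by_cases h : ∃ b ∈ J₁, ∀ t ∈ J₁, b ≤ t
    · obtain ⟨b, hb, hmin⟩ := h
      obtain ⟨δ, hδb, ε, hε, hδ⟩ := hX.exists_isMIntegralCurveOn_Ioo (γ₁ b) b
      refine ⟨Ioc (b - ε) b ∪ J₁, fun x => if x ≤ b then δ x else γ₁ x, ?_, ?_, ?_,
        subset_union_right, ?_, isMIntegralCurveOn_ite (fun x hx => hx.2) hmin
          (hδ.mono fun x hx => ⟨hx.1, by linarith [hx.2]⟩) hγ₁ hδb ⟨by linarith, le_rfl⟩ hb⟩
      · rintro t (ht | ht)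
        · obtain ⟨s, hs, hs'⟩ := hr b hb
          exact ⟨s, Or.inr hs, ht.2.trans_lt hs'⟩
        · obtain ⟨s, hs, hs'⟩ := hr t ht
          exact ⟨s, Or.inr hs, hs'⟩
      · intro t ht
        have h1 : b - ε < t := by
          rcases ht with ht | ht
          · exact ht.1
          · linarith [hmin t ht]
        have h2 : b - ε < b := by linarith
        refine ⟨min ((t + (b - ε)) / 2) b, Or.inl ⟨lt_min (by linarith) h2, min_le_right _ _⟩,
          min_lt_of_left_lt (by linarith)⟩
      · refine ⟨?_⟩
        rintro x hx y hy z ⟨hz1, hz2⟩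
        by_cases hzb : b ≤ z
        · rcases hy with hy | hy
          · exact Or.inr (le_antisymm hzb (hz2.trans hy.2) ▸ hb)
          · exact Or.inr (hJ₁.out hb hy ⟨hzb, hz2⟩)
        · rcases hx with hx | hx
          · exact Or.inl ⟨hx.1.trans_le hz1, (not_le.1 hzb).le⟩
          · exact absurd ((hmin x hx).trans hz1) hzb
      · intro x hx
        rcases eq_or_lt_of_le (hmin x hx) with h | h
        · subst h
          simpa using hδb
        · exact if_neg (not_le.2 h)
    · push Not at h
      exact ⟨J₁, γ₁, hr, h, hJ₁, subset_rfl, fun _ _ => rfl, hγ₁⟩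
  obtain ⟨J₂, γ₂, hr₂, hl₂, hJ₂, hJJ₂, heq₂, hγ₂⟩ := left
  refine ⟨J₂, γ₂, isOpen_iff_mem_nhds.2 fun t ht => ?_, hJ₂, hJJ.trans hJJ₂,
    fun x hx => (heq₂ (hJJ hx)).trans (heq hx), hγ₂⟩
  obtain ⟨a, ha, hat⟩ := hl₂ t ht
  obtain ⟨b, hb, htb⟩ := hr₂ t ht
  exact mem_of_superset (Icc_mem_nhds hat htb) (hJ₂.out ha hb)

/-- Uniqueness of integral curves on an arbitrary interval. -/
theorem IsSmoothVectorField.eqOn_of_isMIntegralCurveOn [CompleteSpace E] [T2Space M]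
    (hX : IsSmoothVectorField X) {J : Set ℝ} (hJ : J.OrdConnected)
    (hγ : IsMIntegralCurveOn γ X J) (hδ : IsMIntegralCurveOn δ X J) {t₀ : ℝ} (ht₀ : t₀ ∈ J)
    (h : γ t₀ = δ t₀) : EqOn γ δ J := by
  have : IsManifold 𝓘(ℝ, E) 1 M := .of_le (n := ∞) (by simp)
  obtain ⟨J₁, γ₁, ho₁, hc₁, hs₁, he₁, hγ₁⟩ := hX.exists_extend_isOpen hJ hγ
  obtain ⟨J₂, δ₂, ho₂, hc₂, hs₂, he₂, hδ₂⟩ := hX.exists_extend_isOpen hJ hδ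
  intro t ht
  have aux : ∀ t ∈ J₁ ∩ J₂, ∃ a ∈ J₁ ∩ J₂, ∃ b ∈ J₁ ∩ J₂, t ∈ Ioo a b := by
    intro t ht
    obtain ⟨ε, hε, hsub⟩ := Metric.isOpen_iff.1 (ho₁.inter ho₂) t ht
    rw [Real.ball_eq_Ioo] at hsub
    exact ⟨t - ε / 2, hsub ⟨by linarith, by linarith⟩, t + ε / 2, hsub ⟨by linarith, by linarith⟩,
      by linarith, by linarith⟩
  obtain ⟨a, ha, b, hb, hab⟩ := aux t ⟨hs₁ ht, hs₂ ht⟩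
  obtain ⟨a', ha', b', hb', hab'⟩ := aux t₀ ⟨hs₁ ht₀, hs₂ ht₀⟩
  -- An open interval around both `t` and `t₀` on which both extensions are defined, as uniqueness
  -- on open intervals requires.
  have hsub : Ioo (min a a') (max b b') ⊆ J₁ ∩ J₂ := by
    refine Ioo_subset_Icc_self.trans ((hc₁.inter hc₂).out ?_ ?_)
    · rcases min_choice a a' with h | h <;> rw [h] <;> assumption
    · rcases max_choice b b' with h | h <;> rw [h] <;> assumption
  have := isMIntegralCurveOn_Ioo_eqOn_of_contMDiff_boundaryless
    (t₀ := t₀) (a := min a a') (b := max b b')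
    ⟨min_lt_of_right_lt hab'.1, lt_max_of_lt_right hab'.2⟩ (hX.of_le (by simp))
    (hγ₁.mono fun x hx => (hsub hx).1) (hδ₂.mono fun x hx => (hsub hx).2)
    (by rw [he₁ ht₀, he₂ ht₀, h])
  rw [← he₁ ht, ← he₂ ht]
  exact this ⟨min_lt_of_left_lt hab.1, lt_max_of_lt_left hab.2⟩

/-- Bootstrapping: in a chart the derivative of `γ` is the coordinate expression of the smooth field
composed with `γ`, so `C^n` regularity of `γ` implies `C^(n+1)`. -/
theorem IsSmoothVectorField.contMDiffOn_of_isOpen (hX : IsSmoothVectorField X)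
    {J : Set ℝ} (hJ : IsOpen J) (hγ : IsMIntegralCurveOn γ X J) :
    ContMDiffOn 𝓘(ℝ, ℝ) 𝓘(ℝ, E) ∞ γ J := by
  have : IsManifold 𝓘(ℝ, E) 1 M := .of_le (n := ∞) (by simp)
  rw [contMDiffOn_infty]
  intro n
  induction n with
  | zero => exact contMDiffOn_zero_iff.2 hγ.continuousOn
  | succ n ih =>
    intro t₀ ht₀
    refine ContMDiffAt.contMDiffWithinAt ?_
    set c := chartAt E (γ t₀) with hc
    set O := J ∩ γ ⁻¹' c.source with hO
    have hOo : IsOpen O := hγ.continuousOn.isOpen_inter_preimage hJ c.open_source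
    have htO : t₀ ∈ O := ⟨ht₀, mem_chart_source E (γ t₀)⟩
    set h : M → E := fun p => (trivializationAt E (TangentSpace 𝓘(ℝ, E)) (γ t₀)
      (⟨p, X p⟩ : TangentBundle 𝓘(ℝ, E) M)).2 with hh
    have hhs : ContMDiffOn 𝓘(ℝ, E) 𝓘(ℝ, E) ∞ h c.source := by
      have := (Bundle.Trivialization.contMDiffOn_section_iff (IB := 𝓘(ℝ, E)) (n := ∞)
        (trivializationAt E (TangentSpace 𝓘(ℝ, E)) (γ t₀)) (s := X) (a := c.source) c.open_source
          (by rw [TangentBundle.trivializationAt_baseSet])).1 hX.contMDiffOn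
      exact this
    have hder : ∀ t ∈ O, HasDerivAt (c ∘ γ) (h (γ t)) t := by
      intro t ht
      have h1 := hγ.hasDerivWithinAt (t₀ := t₀) ht.1 (by rw [extChartAt_source]; exact ht.2)
      have h2 : (extChartAt 𝓘(ℝ, E) (γ t₀) ∘ γ) = c ∘ γ := by
        ext; simp [mfld_simps, hc]
      rw [h2] at h1
      exact h1.hasDerivAt (hJ.mem_nhds ht.1)
    have hy : ContDiffOn ℝ (n + 1 : ℕ) (c ∘ γ) O := by
      push_cast
      rw [contDiffOn_succ_iff_deriv_of_isOpen hOo]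
      refine ⟨fun t ht => (hder t ht).differentiableAt.differentiableWithinAt, by simp, ?_⟩
      have h3 : ContDiffOn ℝ n (h ∘ γ) O := by
        rw [← contMDiffOn_iff_contDiffOn]
        exact (hhs.of_le (by exact_mod_cast le_top)).comp (ih.mono inter_subset_left) fun t ht => ht.2
      exact h3.congr fun t ht => (hder t ht).deriv
    have h4 : ContMDiffOn 𝓘(ℝ, ℝ) 𝓘(ℝ, E) (n + 1 : ℕ) (c.symm ∘ (c ∘ γ)) O := by
      refine ((contMDiffOn_chart_symm (I := 𝓘(ℝ, E)) (n := ∞) (x := γ t₀)).of_le 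
        (by exact_mod_cast le_top)).comp (contMDiffOn_iff_contDiffOn.2 hy) ?_
      intro t ht
      exact c.map_source ht.2
    refine (h4.contMDiffAt (hOo.mem_nhds htO)).congr_of_eventuallyEq ?_
    filter_upwards [hOo.mem_nhds htO] with t ht
    exact (c.left_inv ht.2).symm

/-- Integral curves of a smooth vector field on an interval are smooth. -/
theorem IsSmoothVectorField.contMDiffOn_of_isMIntegralCurveOn [CompleteSpace E]
    (hX : IsSmoothVectorField X) {J : Set ℝ} (hJ : J.OrdConnected)
    (hγ : IsMIntegralCurveOn γ X J) : ContMDiffOn 𝓘(ℝ, ℝ) 𝓘(ℝ, E) ∞ γ J := by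
  obtain ⟨J₁, γ₁, ho₁, hc₁, hs₁, he₁, hγ₁⟩ := hX.exists_extend_isOpen hJ hγ
  exact ((hX.contMDiffOn_of_isOpen ho₁ hγ₁).mono hs₁).congr fun t ht => (he₁ ht).symm

end IntegralCurves

/-! ### Related vector fields -/

section Related

variable {E M E' M' : Type*} [NormedAddCommGroup E] [NormedSpace ℝ E]
  [TopologicalSpace M] [ChartedSpace E M] [NormedAddCommGroup E'] [NormedSpace ℝ E']
  [TopologicalSpace M'] [ChartedSpace E' M']

/-- Maps send integral curves to integral curves of related vector fields. -/
theorem isMIntegralCurveOn_comp_of_related {X : (x : M) → TangentSpace 𝓘(ℝ, E) x}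
    {Y : (x : M') → TangentSpace 𝓘(ℝ, E') x} {γ : ℝ → M} {J : Set ℝ} {f : M → M'}
    (hf : ∀ t ∈ J, MDifferentiableAt 𝓘(ℝ, E) 𝓘(ℝ, E') f (γ t))
    (hXY : ∀ t ∈ J, mfderiv 𝓘(ℝ, E) 𝓘(ℝ, E') f (γ t) (X (γ t)) = Y (f (γ t)))
    (hγ : IsMIntegralCurveOn γ X J) : IsMIntegralCurveOn (f ∘ γ) Y J := by
  intro t ht
  refine ((hf t ht).hasMFDerivAt.comp_hasMFDerivWithinAt t (hγ t ht)).congr_mfderiv ?_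
  refine ContinuousLinearMap.ext fun (a : ℝ) => ?_
  change mfderiv 𝓘(ℝ, E) 𝓘(ℝ, E') f (γ t) (a • X (γ t)) = a • Y (f (γ t))
  rw [map_smul, hXY t ht]

end Related

/-! ### One-parameter subgroups of a Lie group -/

section OneParameter

variable {E G : Type*} [NormedAddCommGroup E] [NormedSpace ℝ E]
  [Group G] [TopologicalSpace G] [ChartedSpace E G]

theorem mulInvariantVectorField_one (v : GroupLieAlgebra 𝓘(ℝ, E) G) :
    mulInvariantVectorField v (1 : G) = v := by
  unfold mulInvariantVectorField
  have : ((1 : G) * ·) = id := by ext x; simp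
  rw [mfderiv_congr this, mfderiv_id]
  rfl

variable [LieGroup 𝓘(ℝ, E) ∞ G]

/-- The tangent map of multiplication, applied to a zero vector in the first factor, is left
translation. This gives joint smoothness, needed for left invariant fields and for `g⁻¹ g'`. -/
theorem contMDiff_tangent_mul_left : ContMDiff (𝓘(ℝ, E).prod 𝓘(ℝ, E).tangent) 𝓘(ℝ, E).tangent ∞
    (fun p : G × TangentBundle 𝓘(ℝ, E) G =>
      (⟨p.1 * p.2.1, mfderiv 𝓘(ℝ, E) 𝓘(ℝ, E) (p.1 * ·) p.2.1 p.2.2⟩ :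
        TangentBundle 𝓘(ℝ, E) G)) := by
  have h1 : ContMDiff (𝓘(ℝ, E).prod 𝓘(ℝ, E).tangent) (𝓘(ℝ, E).tangent.prod 𝓘(ℝ, E).tangent) ∞
      (fun p : G × TangentBundle 𝓘(ℝ, E) G =>
        ((Bundle.TotalSpace.mk' E p.1 0 : TangentBundle 𝓘(ℝ, E) G), p.2)) :=
    ((Bundle.contMDiff_zeroSection ℝ (TangentSpace 𝓘(ℝ, E) : G → Type _)).comp
      contMDiff_fst).prodMk contMDiff_snd
  have h2 : ContMDiff (𝓘(ℝ, E).tangent.prod 𝓘(ℝ, E).tangent) (𝓘(ℝ, E).prod 𝓘(ℝ, E)).tangent ∞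
      (equivTangentBundleProd 𝓘(ℝ, E) G 𝓘(ℝ, E) G).symm := contMDiff_equivTangentBundleProd_symm
  have h3 : ContMDiff (𝓘(ℝ, E).prod 𝓘(ℝ, E)).tangent 𝓘(ℝ, E).tangent ∞
      (tangentMap (𝓘(ℝ, E).prod 𝓘(ℝ, E)) 𝓘(ℝ, E) (fun p : G × G => p.1 * p.2)) :=
    (contMDiff_mul 𝓘(ℝ, E) ∞).contMDiff_tangentMap (by simp)
  have hd : ∀ p : G × G, MDifferentiableAt (𝓘(ℝ, E).prod 𝓘(ℝ, E)) 𝓘(ℝ, E)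
      (fun p : G × G => p.1 * p.2) p := fun p =>
    (contMDiff_mul 𝓘(ℝ, E) ∞).mdifferentiableAt (by simp)
  convert! (h3.comp h2).comp h1 with p
  simp only [Function.comp_apply, tangentMap]
  rw [mfderiv_prod_eq_add_apply (hd _)]
  change _ = mfderiv 𝓘(ℝ, E) 𝓘(ℝ, E) (fun z => z * p.2.1) p.1 (0 : TangentSpace 𝓘(ℝ, E) p.1)
    + mfderiv 𝓘(ℝ, E) 𝓘(ℝ, E) (fun z => p.1 * z) p.2.1 p.2.2
  rw [map_zero, zero_add]

theorem isSmoothVectorField_mulInvariantVectorField (v : GroupLieAlgebra 𝓘(ℝ, E) G) :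
    IsSmoothVectorField (mulInvariantVectorField v : (g : G) → TangentSpace 𝓘(ℝ, E) g) := by
  have h : ContMDiff 𝓘(ℝ, E) (𝓘(ℝ, E).prod 𝓘(ℝ, E).tangent) ∞ (fun g : G =>
      (g, (⟨1, v⟩ : TangentBundle 𝓘(ℝ, E) G))) := contMDiff_id.prodMk contMDiff_const
  have := contMDiff_tangent_mul_left.comp h
  unfold IsSmoothVectorField
  convert! this with g
  simp

theorem mfderiv_mul_left_mulInvariantVectorField (v : GroupLieAlgebra 𝓘(ℝ, E) G) (h g : G) :
    mfderiv 𝓘(ℝ, E) 𝓘(ℝ, E) (h * ·) g (mulInvariantVectorField v g)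
      = mulInvariantVectorField v (h * g) := by
  have hd : ∀ h g : G, MDifferentiableAt 𝓘(ℝ, E) 𝓘(ℝ, E) (h * ·) g := fun h g =>
    (contMDiff_mul_left (I := 𝓘(ℝ, E)) (n := ∞)).mdifferentiableAt (by simp)
  unfold mulInvariantVectorField
  have : (h * g * ·) = (h * ·) ∘ (g * ·) := by ext x; simp [mul_assoc]
  exact (mfderiv_comp_apply_of_eq 1 (hd h g) (hd g 1) (mul_one g) v).symm.trans
    (DFunLike.congr_fun (mfderiv_congr (I := 𝓘(ℝ, E)) (I' := 𝓘(ℝ, E)) (x := (1 : G)) this) v).symm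

variable [FiniteDimensional ℝ E] [T2Space G]

/-- Left translation carries a solution at the identity, defined for time `ε`, to a solution through
any point with the same `ε`. A uniform time of existence makes the field complete. -/
theorem exists_isMIntegralCurve_mulInvariantVectorField (v : GroupLieAlgebra 𝓘(ℝ, E) G) :
    ∃ γ : ℝ → G, γ 0 = 1 ∧ IsMIntegralCurve (I := 𝓘(ℝ, E)) γ (mulInvariantVectorField v) := by
  have : IsManifold 𝓘(ℝ, E) 1 G := .of_le (n := ∞) (by simp)
  have hX := isSmoothVectorField_mulInvariantVectorField v
  obtain ⟨γ, h0, ε, hε, hγ⟩ := hX.exists_isMIntegralCurveOn_Ioo 1 0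
  refine exists_isMIntegralCurve_of_isMIntegralCurveOn (hX.of_le (by simp)) hε (fun g => ?_) 1
  refine ⟨(g * ·) ∘ γ, by simp [h0], ?_⟩
  rw [zero_sub, zero_add] at hγ
  exact isMIntegralCurveOn_comp_of_related (fun t _ =>
    (contMDiff_mul_left (I := 𝓘(ℝ, E)) (n := ∞)).mdifferentiableAt (by simp))
    (fun t _ => mfderiv_mul_left_mulInvariantVectorField v g (γ t)) hγ

variable (G) in
/-- The one-parameter subgroup with initial velocity `v`. -/
def oneParam (v : E) : ℝ → G :=
  (exists_isMIntegralCurve_mulInvariantVectorField (v : GroupLieAlgebra 𝓘(ℝ, E) G)).choose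

theorem oneParam_zero (v : E) : oneParam G v 0 = 1 :=
  (exists_isMIntegralCurve_mulInvariantVectorField (v : GroupLieAlgebra 𝓘(ℝ, E) G)).choose_spec.1

theorem isMIntegralCurve_oneParam (v : E) :
    IsMIntegralCurve (I := 𝓘(ℝ, E)) (oneParam G v)
      (mulInvariantVectorField (v : GroupLieAlgebra 𝓘(ℝ, E) G)) :=
  (exists_isMIntegralCurve_mulInvariantVectorField (v : GroupLieAlgebra 𝓘(ℝ, E) G)).choose_spec.2

theorem oneParam_unique {v : E} {γ : ℝ → G} (h0 : γ 0 = 1)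
    (hγ : IsMIntegralCurve (I := 𝓘(ℝ, E)) γ
      (mulInvariantVectorField (v : GroupLieAlgebra 𝓘(ℝ, E) G))) : γ = oneParam G v := by
  have : IsManifold 𝓘(ℝ, E) 1 G := .of_le (n := ∞) (by simp)
  exact isMIntegralCurve_Ioo_eq_of_contMDiff_boundaryless
    ((isSmoothVectorField_mulInvariantVectorField (v : GroupLieAlgebra 𝓘(ℝ, E) G)).of_le (by simp)) hγ
    (isMIntegralCurve_oneParam (G := G) v) (t₀ := 0) (h0.trans (oneParam_zero v).symm)

theorem contMDiff_oneParam (v : E) :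
    ContMDiff 𝓘(ℝ, ℝ) 𝓘(ℝ, E) ∞ (oneParam G v) := by
  rw [← contMDiffOn_univ]
  exact (isSmoothVectorField_mulInvariantVectorField (v : GroupLieAlgebra 𝓘(ℝ, E) G)).contMDiffOn_of_isOpen
    isOpen_univ
    ((isMIntegralCurve_oneParam (G := G) v).isMIntegralCurveOn _)

/-- The curve `t ↦ γ(s)⁻¹ γ(t + s)` solves the same left invariant equation and starts at the
identity, so it equals `γ`. -/
theorem oneParam_add (v : E) (s t : ℝ) :
    oneParam G v (s + t) = oneParam G v s * oneParam G v t := by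
  have h1 : IsMIntegralCurve (I := 𝓘(ℝ, E)) (fun t => (oneParam G v s)⁻¹ * oneParam G v (t + s))
      (mulInvariantVectorField (v : GroupLieAlgebra 𝓘(ℝ, E) G)) := by
    rw [isMIntegralCurve_iff_isMIntegralCurveOn]
    refine isMIntegralCurveOn_comp_of_related (f := ((oneParam G v s)⁻¹ * ·))
      (γ := oneParam G v ∘ (· + s)) (fun t _ =>
      (contMDiff_mul_left (I := 𝓘(ℝ, E)) (n := ∞)).mdifferentiableAt (by simp))
      (fun t _ => mfderiv_mul_left_mulInvariantVectorField (v : GroupLieAlgebra 𝓘(ℝ, E) G) _ _)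
      (((isMIntegralCurve_oneParam (G := G) v).comp_add s).isMIntegralCurveOn _)
  have h2 := congrFun (oneParam_unique (by simp) h1) t
  rw [← h2, mul_inv_cancel_left, add_comm]

theorem oneParam_smul (v : E) (c t : ℝ) :
    oneParam G (c • v) t = oneParam G v (t * c) := by
  have h := (isMIntegralCurve_oneParam (G := G) v).comp_mul c
  have e := mulInvariantVectorField_smul (I := 𝓘(ℝ, E)) (G := G) c v
  replace h : IsMIntegralCurve (I := 𝓘(ℝ, E)) (oneParam G v ∘ fun x => x * c)
    (mulInvariantVectorField (c • v : GroupLieAlgebra 𝓘(ℝ, E) G)) := e ▸ h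
  exact (congrFun (oneParam_unique (by simp [oneParam_zero]) h) t).symm

theorem hasMFDerivAt_oneParam_zero (v : E) :
    HasMFDerivAt 𝓘(ℝ, ℝ) 𝓘(ℝ, E) (oneParam G v) 0 ((1 : ℝ →L[ℝ] ℝ).smulRight (v : E)) := by
  refine (isMIntegralCurve_oneParam (G := G) v 0).congr_mfderiv ?_
  have : @Eq E (mulInvariantVectorField (I := 𝓘(ℝ, E)) (G := G) v (oneParam G v 0)) v := by
    rw [oneParam_zero]
    exact mulInvariantVectorField_one (E := E) (G := G) v
  exact congrArg (fun w : E => (1 : ℝ →L[ℝ] ℝ).smulRight w) this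

end OneParameter

/-! ### Parametrizations by products of one-parameter subgroups -/

section Parametrization

variable {E G : Type*} [NormedAddCommGroup E] [NormedSpace ℝ E]
  [Group G] [TopologicalSpace G] [ChartedSpace E G] [LieGroup 𝓘(ℝ, E) ∞ G]

/-- At the identity both partial derivatives of multiplication are the identity map. Derivatives of
all product parametrizations below are read off from this. -/
theorem hasMFDerivAt_mul_of_eq_one {V : Type*} [NormedAddCommGroup V] [NormedSpace ℝ V]
    {f g : V → G} {x : V} (hfx : f x = 1) (hgx : g x = 1) {f' g' : V →L[ℝ] E}
    (hf : HasMFDerivAt 𝓘(ℝ, V) 𝓘(ℝ, E) f x f') (hg : HasMFDerivAt 𝓘(ℝ, V) 𝓘(ℝ, E) g x g') :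
    HasMFDerivAt 𝓘(ℝ, V) 𝓘(ℝ, E) (fun y => f y * g y) x (f' + g') := by
  have hm : MDifferentiableAt (𝓘(ℝ, E).prod 𝓘(ℝ, E)) 𝓘(ℝ, E)
      (fun p : G × G => p.1 * p.2) (f x, g x) :=
    (contMDiff_mul 𝓘(ℝ, E) ∞).mdifferentiableAt (by simp)
  refine (hm.hasMFDerivAt.comp x (hf.prodMk hg)).congr_mfderiv
    (ContinuousLinearMap.ext fun w => ?_)
  refine (mfderiv_prod_eq_add_apply hm (v := (f' w, g' w))).trans ?_
  have h1 : (fun z : G => z * g x) = id := by ext; simp [hgx]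
  have h2 : (fun z : G => f x * z) = id := by ext; simp [hfx]
  have e1 : mfderiv 𝓘(ℝ, E) 𝓘(ℝ, E) (fun z : G => z * g x) (f x) = ContinuousLinearMap.id ℝ E :=
    (mfderiv_congr h1).trans mfderiv_id
  have e2 : mfderiv 𝓘(ℝ, E) 𝓘(ℝ, E) (fun z : G => f x * z) (g x) = ContinuousLinearMap.id ℝ E :=
    (mfderiv_congr h2).trans mfderiv_id
  have e1' := DFunLike.congr_fun e1 (f' w)
  have e2' := DFunLike.congr_fun e2 (g' w)
  exact congrArg₂ (fun a b : E => a + b) e1' e2'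

variable [FiniteDimensional ℝ E] [T2Space G]

/-- Coordinates of the second kind: `A` is an ordered product of the one-parameter subgroups of the
`w i`. Only smoothness in time of each of them is needed, not that of the exponential map, and the
values lie in any subgroup containing them. -/
theorem exists_param_fin (n : ℕ) (w : Fin n → E) :
    ∃ A : (Fin n → ℝ) → G, ContMDiff 𝓘(ℝ, Fin n → ℝ) 𝓘(ℝ, E) ∞ A ∧ A 0 = 1 ∧
      HasMFDerivAt 𝓘(ℝ, Fin n → ℝ) 𝓘(ℝ, E) A 0
        (∑ i, (ContinuousLinearMap.proj i : (Fin n → ℝ) →L[ℝ] ℝ).smulRight (w i)) ∧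
      ∀ C : Subgroup G, (∀ i t, oneParam G (w i) t ∈ C) →
        ∀ x, A x ∈ C := by
  induction n with
  | zero =>
    refine ⟨fun _ => 1, contMDiff_const, rfl, ?_, fun C _ _ => C.one_mem⟩
    refine (hasMFDerivAt_const (1 : G) (0 : Fin 0 → ℝ)).congr_mfderiv ?_
    simp
    rfl
  | succ n ih =>
    obtain ⟨A, hA, hA0, hA', hAC⟩ := ih (fun i => w i.castSucc)
    set L : (Fin (n + 1) → ℝ) →L[ℝ] (Fin n → ℝ) :=
      LinearMap.toContinuousLinearMap (LinearMap.funLeft ℝ ℝ Fin.castSucc) with hL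
    set p : (Fin (n + 1) → ℝ) →L[ℝ] ℝ := ContinuousLinearMap.proj (Fin.last n) with hp
    set γ : ℝ → G := oneParam G (w (Fin.last n)) with hγ
    have hγ0 : γ 0 = 1 := oneParam_zero _
    have hD : ContinuousLinearMap.comp
        (∑ i, (ContinuousLinearMap.proj i : (Fin n → ℝ) →L[ℝ] ℝ).smulRight (w i.castSucc)) L
        + ContinuousLinearMap.comp ((1 : ℝ →L[ℝ] ℝ).smulRight (w (Fin.last n))) p
        = ∑ i, (ContinuousLinearMap.proj i : (Fin (n + 1) → ℝ) →L[ℝ] ℝ).smulRight (w i) := by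
      refine ContinuousLinearMap.ext fun x => ?_
      simp [Fin.sum_univ_castSucc, hL, hp, LinearMap.funLeft]
    have h1 : HasMFDerivAt 𝓘(ℝ, Fin (n + 1) → ℝ) 𝓘(ℝ, E) (A ∘ L) 0 (ContinuousLinearMap.comp
        (∑ i, (ContinuousLinearMap.proj i : (Fin n → ℝ) →L[ℝ] ℝ).smulRight (w i.castSucc)) L) := by
      refine HasMFDerivAt.comp (0 : Fin (n + 1) → ℝ) (I' := 𝓘(ℝ, Fin n → ℝ)) ?_
        L.hasFDerivAt.hasMFDerivAt
      rwa [map_zero]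
    have h2 : HasMFDerivAt 𝓘(ℝ, Fin (n + 1) → ℝ) 𝓘(ℝ, E) (γ ∘ p) 0 (ContinuousLinearMap.comp
        ((1 : ℝ →L[ℝ] ℝ).smulRight (w (Fin.last n))) p) := by
      refine HasMFDerivAt.comp (0 : Fin (n + 1) → ℝ) (I' := 𝓘(ℝ, ℝ)) ?_
        p.hasFDerivAt.hasMFDerivAt
      rw [map_zero]
      exact hasMFDerivAt_oneParam_zero _
    refine ⟨fun x => A (L x) * γ (p x), ?_, ?_, ?_, ?_⟩
    · exact (hA.comp L.contMDiff).mul ((contMDiff_oneParam _).comp p.contMDiff)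
    · simp [hA0, hγ0]
    · exact (hasMFDerivAt_mul_of_eq_one (by simp [hA0]) (by simp [hγ0]) h1 h2).congr_mfderiv hD
    · intro C hC x
      exact C.mul_mem (hAC C (fun i t => hC i.castSucc t) _) (hC _ _)

/-- Every subspace of the Lie algebra is the tangent space of a smooth local parametrization by
products of its one-parameter subgroups. -/
theorem exists_param (V : Submodule ℝ E) :
    ∃ A : V → G, ContMDiff 𝓘(ℝ, V) 𝓘(ℝ, E) ∞ A ∧ A 0 = 1 ∧
      HasMFDerivAt 𝓘(ℝ, V) 𝓘(ℝ, E) A 0 V.subtypeL ∧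
      ∀ C : Subgroup G, (∀ v ∈ V, ∀ t, oneParam G (v) t ∈ C) →
        ∀ x, A x ∈ C := by
  set b := Module.finBasis ℝ V with hb
  obtain ⟨A, hA, hA0, hA', hAC⟩ := exists_param_fin (G := G) _ (fun i => (b i : E))
  set L : V →L[ℝ] (Fin (Module.finrank ℝ V) → ℝ) :=
    LinearMap.toContinuousLinearMap (b.equivFun : V →ₗ[ℝ] _) with hL
  refine ⟨A ∘ L, hA.comp L.contMDiff, by simp [hA0], ?_, fun C hC x =>
    hAC C (fun i t => hC _ (b i).2 t) _⟩
  have : HasMFDerivAt 𝓘(ℝ, V) 𝓘(ℝ, E) (A ∘ L) 0 (ContinuousLinearMap.comp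
        (∑ i, (ContinuousLinearMap.proj i : (Fin _ → ℝ) →L[ℝ] ℝ).smulRight (b i : E)) L) := by
      refine HasMFDerivAt.comp (0 : V) (I' := 𝓘(ℝ, Fin _ → ℝ)) ?_
        L.hasFDerivAt.hasMFDerivAt
      rwa [map_zero]
  have hD : ContinuousLinearMap.comp
        (∑ i, (ContinuousLinearMap.proj i : (Fin _ → ℝ) →L[ℝ] ℝ).smulRight (b i : E)) L
        = V.subtypeL := by
    refine ContinuousLinearMap.ext fun x => ?_
    have h : ∑ i, b.repr x i • (b i : E) = x := by
      conv_rhs => rw [← b.sum_repr x]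
      rw [Submodule.coe_sum]
      rfl
    simpa [hL] using h
  exact this.congr_mfderiv hD

end Parametrization

/-! ### Cartan's theorem: the Lie algebra of a closed subgroup -/

section Cartan

variable {E G : Type*} [NormedAddCommGroup E] [NormedSpace ℝ E]
  [Group G] [TopologicalSpace G] [ChartedSpace E G] [LieGroup 𝓘(ℝ, E) ∞ G]
  [FiniteDimensional ℝ E] [T2Space G]

theorem oneParam_zero_left (t : ℝ) : oneParam G (0 : E) t = 1 := by
  have := oneParam_smul (G := G) (0 : E) 0 t
  rwa [zero_smul, mul_zero, oneParam_zero] at this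

theorem oneParam_mul_nat (v : E) (t : ℝ) (n : ℕ) :
    oneParam G v (n * t) = oneParam G v t ^ n := by
  induction n with
  | zero => simp [oneParam_zero]
  | succ n ih => rw [Nat.cast_succ, add_mul, one_mul, oneParam_add, ih, pow_succ]

theorem oneParam_neg (v : E) (t : ℝ) :
    oneParam G v (-t) = (oneParam G v t)⁻¹ := by
  rw [eq_inv_iff_mul_eq_one, ← oneParam_add, neg_add_cancel, oneParam_zero]

/-- Write `t = n (t / n)` with `t / n ≤ r` and take the `n`-th power; negative times are inverses.
-/
theorem oneParam_mem_of_small {C : Subgroup G} {v : E} {r : ℝ} (hr : 0 < r)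
    (h : ∀ t, 0 ≤ t → t ≤ r → oneParam G v t ∈ C) (t : ℝ) : oneParam G v t ∈ C := by
  have key : ∀ t, 0 ≤ t → oneParam G v t ∈ C := by
    intro t ht
    obtain ⟨n, hn⟩ := exists_nat_gt (t / r)
    have hn0 : (0 : ℝ) < n := (div_nonneg ht hr.le).trans_lt hn
    have : t = n * (t / n) := by field_simp
    rw [this, oneParam_mul_nat]
    refine C.pow_mem (h _ (div_nonneg ht hn0.le) ?_) n
    rw [div_lt_iff₀ hr] at hn
    rw [div_le_iff₀ hn0]
    linarith
  rcases le_total 0 t with ht | ht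
  · exact key t ht
  · have := key (-t) (by linarith)
    rw [oneParam_neg] at this
    exact inv_mem_iff.1 this

/-- Flow box coordinates for the left invariant vector field of `v`, in which translation by the
one-parameter subgroup is a translation. -/
theorem exists_flowBox {v : E} (hv : v ≠ 0) :
    ∃ (V : Submodule ℝ E) (Φ : OpenPartialHomeomorph (V × ℝ) G) (Φ' : (V × ℝ) ≃L[ℝ] E),
      (0 : V × ℝ) ∈ Φ.source ∧ Φ 0 = 1 ∧ Φ' (0, 1) = v ∧
      ContMDiffOn 𝓘(ℝ, V × ℝ) 𝓘(ℝ, E) ∞ Φ Φ.source ∧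
      ContMDiffOn 𝓘(ℝ, E) 𝓘(ℝ, V × ℝ) ∞ Φ.symm Φ.target ∧
      HasMFDerivAt 𝓘(ℝ, E) 𝓘(ℝ, V × ℝ) Φ.symm (1 : G) (Φ'.symm : E →L[ℝ] V × ℝ) ∧
      ∀ x ∈ Φ.source, ∀ t : ℝ, x + (0, t) ∈ Φ.source →
        Φ (x + (0, t)) = Φ x * oneParam G (v) t := by
  obtain ⟨V, hV⟩ := Submodule.exists_isCompl (Submodule.span ℝ {v})
  obtain ⟨A, hA, hA0, hA', -⟩ := exists_param (G := G) V
  set γ : ℝ → G := oneParam G (v) with hγ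
  have hγ0 : γ 0 = 1 := oneParam_zero _
  set D : V × ℝ →L[ℝ] E := V.subtypeL.comp (ContinuousLinearMap.fst ℝ V ℝ) +
    ((1 : ℝ →L[ℝ] ℝ).smulRight v).comp (ContinuousLinearMap.snd ℝ V ℝ) with hD
  have hDa : ∀ x : V × ℝ, D x = (x.1 : E) + x.2 • v := fun x => by simp [hD]
  have hinj : Function.Injective D := by
    rw [injective_iff_map_eq_zero]
    rintro ⟨x, t⟩ h
    rw [hDa] at h
    have h1 : (x : E) = -(t • v) := eq_neg_of_add_eq_zero_left h
    have h2 : (x : E) ∈ Submodule.span ℝ {v} := by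
      rw [h1]
      exact Submodule.neg_mem _ (Submodule.smul_mem _ _ (Submodule.mem_span_singleton_self v))
    have h3 : (x : E) = 0 := by
      have := hV.disjoint.le_bot (show (x : E) ∈ _ ⊓ V from ⟨h2, x.2⟩)
      simpa using this
    rw [h3, zero_eq_neg, smul_eq_zero_iff_left hv] at h1
    exact Prod.ext (Subtype.ext h3) h1
  have hsurj : Function.Surjective D := by
    intro w
    have : w ∈ Submodule.span ℝ {v} ⊔ V := by rw [hV.sup_eq_top]; trivial
    obtain ⟨y, hy, z, hz, rfl⟩ := Submodule.mem_sup.1 this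
    obtain ⟨t, rfl⟩ := Submodule.mem_span_singleton.1 hy
    exact ⟨(⟨z, hz⟩, t), by rw [hDa, add_comm]⟩
  set Φ' : (V × ℝ) ≃L[ℝ] E :=
    (LinearEquiv.ofBijective (D : V × ℝ →ₗ[ℝ] E) ⟨hinj, hsurj⟩).toContinuousLinearEquiv with hΦ'
  have hΦD : (Φ' : V × ℝ →L[ℝ] E) = D := rfl
  -- With the one-parameter subgroup as the right factor, right multiplication by it only shifts the
  -- last coordinate; `A` parametrizes a transversal to it.
  set f : V × ℝ → G := fun x => A x.1 * γ x.2 with hf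
  have hfs : ContMDiff 𝓘(ℝ, V × ℝ) 𝓘(ℝ, E) ∞ f :=
    (hA.comp (ContinuousLinearMap.fst ℝ V ℝ).contMDiff).mul
      ((contMDiff_oneParam _).comp (ContinuousLinearMap.snd ℝ V ℝ).contMDiff)
  have h1 : HasMFDerivAt 𝓘(ℝ, V × ℝ) 𝓘(ℝ, E) (A ∘ ContinuousLinearMap.fst ℝ V ℝ) 0
      (V.subtypeL.comp (ContinuousLinearMap.fst ℝ V ℝ)) :=
    HasMFDerivAt.comp (0 : V × ℝ) (I' := 𝓘(ℝ, V)) hA'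
      (ContinuousLinearMap.fst ℝ V ℝ).hasFDerivAt.hasMFDerivAt
  have h2 : HasMFDerivAt 𝓘(ℝ, V × ℝ) 𝓘(ℝ, E) (γ ∘ ContinuousLinearMap.snd ℝ V ℝ) 0
      (((1 : ℝ →L[ℝ] ℝ).smulRight v).comp (ContinuousLinearMap.snd ℝ V ℝ)) :=
    HasMFDerivAt.comp (0 : V × ℝ) (I' := 𝓘(ℝ, ℝ)) (hasMFDerivAt_oneParam_zero _)
      (ContinuousLinearMap.snd ℝ V ℝ).hasFDerivAt.hasMFDerivAt
  have h3 : HasMFDerivAt 𝓘(ℝ, V × ℝ) 𝓘(ℝ, E) f 0 (Φ' : V × ℝ →L[ℝ] E) :=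
    hasMFDerivAt_mul_of_eq_one (by simp [hA0]) (by simp [hγ0]) h1 h2
  obtain ⟨Φ, hΦ0, -, hΦf, hΦs, hΦ1⟩ := exists_openPartialHomeomorph_of_hasMFDerivAt isOpen_univ
    hfs.contMDiffOn (mem_univ 0) Φ' h3
  have hf0 : f 0 = 1 := by simp [hf, hA0, hγ0]
  refine ⟨V, Φ, Φ', hΦ0, (hΦf hΦ0).trans hf0, ?_, hfs.contMDiffOn.congr hΦf, hΦs, hf0 ▸ hΦ1, ?_⟩
  · change D (0, 1) = v
    simp [hDa]
  · intro x hx t hxt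
    have hadd : γ (x.2 + t) = γ x.2 * γ t := oneParam_add _ _ _
    rw [hΦf hx, hΦf hxt]
    simp only [hf, Prod.fst_add, Prod.snd_add, add_zero, hadd, mul_assoc]

/-- In flow box coordinates, powers of a group element close to `oneParam G v ε` are close to
`oneParam G v (n * ε)`. -/
theorem exists_pow_estimate {V : Submodule ℝ E} {Φ : OpenPartialHomeomorph (V × ℝ) G} {v : E}
    (h0 : (0 : V × ℝ) ∈ Φ.source) (h1 : Φ 0 = 1)
    (hs : ContMDiffOn 𝓘(ℝ, V × ℝ) 𝓘(ℝ, E) ∞ Φ Φ.source)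
    (hs' : ContMDiffOn 𝓘(ℝ, E) 𝓘(ℝ, V × ℝ) ∞ Φ.symm Φ.target)
    (hflow : ∀ x ∈ Φ.source, ∀ t : ℝ, x + (0, t) ∈ Φ.source →
        Φ (x + (0, t)) = Φ x * oneParam G (v) t) :
    ∃ r > 0, ∃ L ≥ 0, Metric.ball 0 r ⊆ Φ.source ∧ ∀ (ε : ℝ) (w : V × ℝ) (k : ℕ), 0 ≤ ε → ε < r →
      w ∈ Metric.ball 0 r →
      k * ε < r / 4 → k * (L * ‖w - (0, ε)‖) < r / 4 →
      ∃ x ∈ Φ.source, ‖x - (0, k * ε)‖ ≤ k * (L * ‖w - (0, ε)‖) ∧ Φ x = Φ w ^ k := by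
  -- `F` is multiplication in coordinates. Multiplying by `(0, ε)` is exactly a translation, so
  -- replacing `(0, ε)` by `w` costs at most `K ‖w - (0, ε)‖` per step. The errors add up linearly,
  -- without exponential growth.
  set F : (V × ℝ) × (V × ℝ) → V × ℝ := fun p => Φ.symm (Φ p.1 * Φ p.2) with hF
  have hcont : ContinuousAt (fun p : (V × ℝ) × (V × ℝ) => Φ p.1 * Φ p.2) 0 := by
    have : IsTopologicalGroup G := topologicalGroup_of_lieGroup 𝓘(ℝ, E) ∞
    exact ((Φ.continuousAt h0).comp_of_eq continuousAt_fst rfl).mul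
      ((Φ.continuousAt h0).comp_of_eq continuousAt_snd rfl)
  have hFs : ContDiffAt ℝ 1 F 0 := by
    rw [← contMDiffAt_iff_contDiffAt]
    have hΦ : ContMDiffAt 𝓘(ℝ, V × ℝ) 𝓘(ℝ, E) 1 Φ 0 :=
      (hs.contMDiffAt (Φ.open_source.mem_nhds h0)).of_le (by simp)
    have h1t : (1 : G) ∈ Φ.target := h1 ▸ Φ.map_source h0
    have hΦ' : ContMDiffAt 𝓘(ℝ, E) 𝓘(ℝ, V × ℝ) 1 Φ.symm (1 : G) :=
      (hs'.contMDiffAt (Φ.open_target.mem_nhds h1t)).of_le (by simp)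
    have hm : ContMDiffAt 𝓘(ℝ, (V × ℝ) × (V × ℝ)) 𝓘(ℝ, E) 1
        (fun p : (V × ℝ) × (V × ℝ) => Φ p.1 * Φ p.2) 0 := by
      have : ContMDiffMul 𝓘(ℝ, E) 1 G := ContMDiffMul.of_le (n := ∞) (by simp)
      exact (ContMDiffAt.comp (0 : (V × ℝ) × (V × ℝ)) (I' := 𝓘(ℝ, V × ℝ)) hΦ
          (ContinuousLinearMap.fst ℝ (V × ℝ) (V × ℝ)).contMDiffAt).mul
        (ContMDiffAt.comp (0 : (V × ℝ) × (V × ℝ)) (I' := 𝓘(ℝ, V × ℝ)) hΦ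
          (ContinuousLinearMap.snd ℝ (V × ℝ) (V × ℝ)).contMDiffAt)
    exact ContMDiffAt.comp_of_eq (x := (0 : (V × ℝ) × (V × ℝ))) hΦ' hm (by simp [h1])
  obtain ⟨K, t, ht, hlip⟩ := hFs.exists_lipschitzOnWith
  have htgt : (fun p : (V × ℝ) × (V × ℝ) => Φ p.1 * Φ p.2) ⁻¹' Φ.target ∈
      𝓝 (0 : (V × ℝ) × (V × ℝ)) := by
    refine hcont.preimage_mem_nhds (Φ.open_target.mem_nhds ?_)
    simpa [h1] using Φ.map_source h0
  obtain ⟨r₁, hr₁, hb₁⟩ := Metric.mem_nhds_iff.1 (inter_mem ht htgt)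
  obtain ⟨r₂, hr₂, hb₂⟩ := Metric.mem_nhds_iff.1 (Φ.open_source.mem_nhds h0)
  -- Halving `r₂` keeps a point of the ball inside the chart after a shift shorter than `r`. The two
  -- bounds `r / 4` in the statement keep the iterates inside the ball.
  set r := min r₁ (r₂ / 2) with hr
  have hrpos : 0 < r := lt_min hr₁ (by linarith)
  have hb₁' : ∀ x ∈ Metric.ball (0 : V × ℝ) r, ∀ y ∈ Metric.ball (0 : V × ℝ) r,
      (x, y) ∈ t ∧ Φ x * Φ y ∈ Φ.target := by
    intro x hx y hy
    refine hb₁ ?_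
    rw [mem_ball_zero_iff] at *
    exact (Prod.norm_def (x, y)).trans_lt
      (max_lt (hx.trans_le (min_le_left _ _)) (hy.trans_le (min_le_left _ _)))
  have hnorm : ∀ s : ℝ, ‖((0, s) : V × ℝ)‖ = |s| := fun s => by simp [Prod.norm_def]
  have hb₂' : ∀ x ∈ Metric.ball (0 : V × ℝ) r, ∀ s : ℝ, |s| < r → x + (0, s) ∈ Φ.source := by
    intro x hx s hs
    refine hb₂ ?_
    rw [mem_ball_zero_iff] at *
    refine (norm_add_le _ _).trans_lt ?_
    rw [hnorm]
    have : r ≤ r₂ / 2 := min_le_right _ _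
    linarith
  have hbs : Metric.ball (0 : V × ℝ) r ⊆ Φ.source := fun x hx => by
    have := hb₂' x hx 0 (by simpa using hrpos)
    rwa [Prod.mk_zero_zero, add_zero] at this
  refine ⟨r, hrpos, K, K.2, hbs, ?_⟩
  intro ε w k hε hεr hw
  induction k with
  | zero =>
    intro _ _
    exact ⟨0, h0, by simp, by simp [h1]⟩
  | succ k ih =>
    intro hk1 hk2
    push_cast at hk1 hk2
    have hnn : 0 ≤ (K : ℝ) * ‖w - (0, ε)‖ := mul_nonneg K.2 (norm_nonneg _)
    obtain ⟨x, hx, hxn, hxp⟩ := ih (by nlinarith) (by nlinarith)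
    have hkε : 0 ≤ k * ε := mul_nonneg (Nat.cast_nonneg k) hε
    have hxr : x ∈ Metric.ball (0 : V × ℝ) r := by
      rw [mem_ball_zero_iff]
      have : x = (x - (0, k * ε)) + (0, k * ε) := by abel
      rw [this]
      refine (norm_add_le _ _).trans_lt ?_
      rw [hnorm, abs_of_nonneg hkε]
      nlinarith
    have hεb : ((0, ε) : V × ℝ) ∈ Metric.ball (0 : V × ℝ) r := by
      rw [mem_ball_zero_iff, hnorm, abs_of_nonneg hε]
      exact hεr
    have hFε : F (x, (0, ε)) = x + (0, ε) := by
      have hxs := hb₂' x hxr ε (by rwa [abs_of_nonneg hε])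
      have e1 := hflow 0 h0 ε (by rw [zero_add]; exact hbs hεb)
      rw [zero_add, h1, one_mul] at e1
      simp only [hF]
      rw [e1, ← hflow x hx ε hxs, Φ.left_inv hxs]
    obtain ⟨hxw1, hxw2⟩ := hb₁' x hxr w hw
    refine ⟨F (x, w), Φ.map_target hxw2, ?_, ?_⟩
    · have h3 : ‖F (x, w) - F (x, (0, ε))‖ ≤ K * ‖w - (0, ε)‖ := by
        have := hlip.norm_sub_le hxw1 (hb₁' x hxr _ hεb).1
        refine this.trans (mul_le_mul_of_nonneg_left ?_ K.2)
        simp [Prod.norm_def]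
      have : F (x, w) - (0, ((k + 1 : ℕ) : ℝ) * ε) =
          (F (x, w) - F (x, (0, ε))) + (x - (0, k * ε)) := by
        have e : ((0, ((k + 1 : ℕ) : ℝ) * ε) : V × ℝ) = (0, k * ε) + (0, ε) := by
          ext <;> simp; ring
        rw [hFε, e]
        abel
      rw [this]
      refine (norm_add_le _ _).trans ?_
      push_cast
      linarith
    · simp only [hF]
      rw [Φ.right_inv hxw2, hxp, pow_succ]

/-- A limit of rescaled elements of a closed subgroup generates a one-parameter subgroup of it. -/
theorem oneParam_mem_of_tendsto {C : Subgroup G} (hC : IsClosed (C : Set G))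
    {V' : Type*} [NormedAddCommGroup V'] [NormedSpace ℝ V'] {A : V' → G} (hA0 : A 0 = 1)
    {D : V' →L[ℝ] E} (hA : HasMFDerivAt 𝓘(ℝ, V') 𝓘(ℝ, E) A 0 D) {z : ℕ → V'} {ε : ℕ → ℝ} {ζ : V'}
    (hε : ∀ n, 0 < ε n) (hε0 : Tendsto ε atTop (𝓝 0))
    (hz : Tendsto (fun n => (ε n)⁻¹ • z n) atTop (𝓝 ζ)) (hmem : ∀ n, A (z n) ∈ C) (t : ℝ) :
    oneParam G (D ζ) t ∈ C := by
  by_cases hv : D ζ = 0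
  · have : oneParam G (D ζ) t = 1 := by
      rw [hv]
      exact oneParam_zero_left t
    rw [this]
    exact C.one_mem
  obtain ⟨V, Φ, Φ', h0, h1, hΦ', hs, hs', hder, hflow⟩ := exists_flowBox (G := G) hv
  obtain ⟨r, hr, L, hL, hrs, hest⟩ := exists_pow_estimate h0 h1 hs hs' hflow
  have h1t : (1 : G) ∈ Φ.target := h1 ▸ Φ.map_source h0
  have hΦ1 : Φ.symm (1 : G) = 0 := by rw [← h1, Φ.left_inv h0]
  -- the coordinates of the sequence
  set w : ℕ → V × ℝ := fun n => Φ.symm (A (z n)) with hw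
  have hz0 : Tendsto z atTop (𝓝 0) := by
    have := hε0.smul hz
    rw [zero_smul] at this
    refine this.congr fun n => ?_
    rw [smul_smul, mul_inv_cancel₀ (hε n).ne', one_smul]
  have hAz : Tendsto (fun n => A (z n)) atTop (𝓝 1) := by
    have := hA.continuousAt.tendsto.comp hz0
    rwa [hA0] at this
  have hw0 : Tendsto w atTop (𝓝 0) := by
    have := (Φ.continuousAt_symm h1t).tendsto.comp hAz
    rwa [hΦ1] at this
  -- Differentiability of `Φ.symm ∘ A` at `0` turns the rescaled limit `ζ` into the flow direction
  -- `(0, 1)`.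
  have hlim : Tendsto (fun n => (ε n)⁻¹ • w n) atTop (𝓝 ((0, 1) : V × ℝ)) := by
    have hd : HasMFDerivAt 𝓘(ℝ, V') 𝓘(ℝ, V × ℝ) (Φ.symm ∘ A) 0
        ((Φ'.symm : E →L[ℝ] V × ℝ).comp D) := by
      refine HasMFDerivAt.comp (0 : V') (I' := 𝓘(ℝ, E)) ?_ hA
      rw [hA0]
      exact hder
    have hd' : HasFDerivWithinAt (Φ.symm ∘ A) ((Φ'.symm : E →L[ℝ] V × ℝ).comp D) univ (0 : V') :=
      (hasMFDerivAt_iff_hasFDerivAt.1 hd).hasFDerivWithinAt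
    have := hd'.lim (c := fun n => (ε n)⁻¹) (d := z) (l := atTop) hz0 (by simp) hz
    have e : ((Φ'.symm : E →L[ℝ] V × ℝ).comp D) ζ = (0, 1) := by
      rw [ContinuousLinearMap.comp_apply, ← hΦ']
      exact Φ'.symm_apply_apply _
    rw [e] at this
    refine this.congr fun n => ?_
    simp only [zero_add, Function.comp_apply, hA0, hΦ1, sub_zero, hw]
  have hδ : Tendsto (fun n => (ε n)⁻¹ * ‖w n - (0, ε n)‖) atTop (𝓝 0) := by
    have h2 : Tendsto (fun n => ‖(ε n)⁻¹ • w n - ((0, 1) : V × ℝ)‖) atTop (𝓝 0) := by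
      have := (hlim.sub_const ((0, 1) : V × ℝ)).norm
      rwa [sub_self, norm_zero] at this
    refine h2.congr fun n => ?_
    have e : (ε n)⁻¹ • w n - ((0, 1) : V × ℝ) = (ε n)⁻¹ • (w n - (0, ε n)) := by
      have e' : (ε n)⁻¹ • ((0, ε n) : V × ℝ) = (0, 1) := by
        rw [Prod.smul_mk, smul_zero, smul_eq_mul, inv_mul_cancel₀ (hε n).ne']
      rw [smul_sub, e']
    rw [e, norm_smul, Real.norm_of_nonneg (inv_nonneg.2 (hε n).le)]
  -- Times up to `r / 8` stay below the bound `r / 4` of the power estimate.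
  refine oneParam_mem_of_small (r := r / 8) (by linarith) (fun t ht0 htr => ?_) t
  -- With `k n = ⌊t / ε n⌋`, the power `A (z n) ^ k n` lies in `C`. Its accumulated error is at most
  -- `t L` times `‖w n - (0, ε n)‖ / ε n`, which tends to `0`, while `k n * ε n` tends to `t`.
  set k : ℕ → ℕ := fun n => ⌊t / ε n⌋₊ with hk
  have hk1 : ∀ n, k n * ε n ≤ t := fun n => by
    have := Nat.floor_le (div_nonneg ht0 (hε n).le)
    rwa [le_div_iff₀ (hε n)] at this
  have hk2 : ∀ n, t - ε n ≤ k n * ε n := fun n => by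
    have := (Nat.lt_floor_add_one (t / ε n)).le
    rw [div_le_iff₀ (hε n)] at this
    linarith
  have hkt : Tendsto (fun n => (k n : ℝ) * ε n) atTop (𝓝 t) := by
    refine tendsto_of_tendsto_of_tendsto_of_le_of_le ?_ tendsto_const_nhds hk2 hk1
    simpa using hε0.const_sub t
  have herr : ∀ n, k n * (L * ‖w n - (0, ε n)‖) ≤ t * L * ((ε n)⁻¹ * ‖w n - (0, ε n)‖) := by
    intro n
    have e : (k n : ℝ) * (L * ‖w n - (0, ε n)‖)
        = (k n * ε n) * (L * ((ε n)⁻¹ * ‖w n - (0, ε n)‖)) := by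
      have := (hε n).ne'
      field_simp
    rw [e, mul_assoc t]
    refine mul_le_mul_of_nonneg_right (hk1 n) (mul_nonneg hL (mul_nonneg ?_ (norm_nonneg _)))
    exact inv_nonneg.2 (hε n).le
  have herr0 : Tendsto (fun n => t * L * ((ε n)⁻¹ * ‖w n - (0, ε n)‖)) atTop (𝓝 0) := by
    simpa using hδ.const_mul (t * L)
  have hev : ∀ᶠ n in atTop, ∃ x ∈ Φ.source, ‖x - (0, k n * ε n)‖ ≤
      k n * (L * ‖w n - (0, ε n)‖) ∧ Φ x = A (z n) ^ k n := by
    filter_upwards [hε0.eventually (Iio_mem_nhds hr), hw0 (Metric.ball_mem_nhds 0 hr),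
      herr0.eventually (Iio_mem_nhds (show 0 < r / 4 by linarith)),
      hAz (Φ.open_target.mem_nhds h1t)] with n hn1 hn2 hn3 hn4
    obtain ⟨x, hx, hx1, hx2⟩ := hest (ε n) (w n) (k n) (hε n).le hn1 hn2
      ((hk1 n).trans_lt (by linarith)) ((herr n).trans_lt hn3)
    exact ⟨x, hx, hx1, by rw [hx2, hw, Φ.right_inv hn4]⟩
  have hts : ((0, t) : V × ℝ) ∈ Φ.source := by
    refine hrs ?_
    rw [mem_ball_zero_iff, Prod.norm_def]
    simp only [norm_zero, Real.norm_eq_abs, abs_of_nonneg ht0]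
    exact max_lt hr (by linarith)
  have hΦt : Φ (0, t) = oneParam G (D ζ) t := by
    have := hflow 0 h0 t (by rwa [zero_add])
    rwa [zero_add, h1, one_mul] at this
  rw [← hΦt]
  obtain ⟨N, hN⟩ := eventually_atTop.1 hev
  have hN' : ∀ n : ℕ, ∃ x ∈ Φ.source, ‖x - (0, k (n + N) * ε (n + N))‖ ≤
      k (n + N) * (L * ‖w (n + N) - (0, ε (n + N))‖) ∧ Φ x = A (z (n + N)) ^ k (n + N) :=
    fun n => hN (n + N) (Nat.le_add_left _ _)
  choose x hxs hxn hxp using hN'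
  have hxt : Tendsto x atTop (𝓝 (0, t)) := by
    have hs1 : Tendsto (fun n => x n - (0, k (n + N) * ε (n + N))) atTop (𝓝 0) := by
      refine squeeze_zero_norm (fun n => (hxn n).trans (herr (n + N))) ?_
      exact herr0.comp (tendsto_add_atTop_nat N)
    have hs2 : Tendsto (fun n => ((0, k (n + N) * ε (n + N)) : V × ℝ)) atTop (𝓝 (0, t)) :=
      tendsto_const_nhds.prodMk_nhds (hkt.comp (tendsto_add_atTop_nat N))
    have := hs1.add hs2
    simpa using this
  refine hC.mem_of_tendsto ((Φ.continuousAt hts).tendsto.comp hxt) (Eventually.of_forall fun n => ?_)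
  rw [Function.comp_apply, hxp]
  exact C.pow_mem (hmem _) _

/-- The Lie algebra of a closed subgroup. -/
def closedSubgroupLie (C : Subgroup G) (hC : IsClosed (C : Set G)) : Submodule ℝ E where
  carrier := {v | ∀ t, oneParam G (v) t ∈ C}
  zero_mem' t := by
    have : oneParam G (0 : E) t = 1 := oneParam_zero_left t
    rw [this]
    exact C.one_mem
  smul_mem' c v hv t := by
    have : oneParam G (c • v) t = _ := oneParam_smul _ c t
    exact this ▸ hv _
  add_mem' {v w} hv hw t := by
    -- The curve `s ↦ γ_v(s) γ_w(s)` in `C` has velocity `v + w` at `0`. The limit lemma along `s =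
    -- 1 / (n + 1)` gives the one-parameter subgroup of `v + w`.
    have h := hasMFDerivAt_mul_of_eq_one (oneParam_zero (G := G) (v))
      (oneParam_zero (G := G) (w))
      (hasMFDerivAt_oneParam_zero (G := G) (v))
      (hasMFDerivAt_oneParam_zero (G := G) (w))
    have e : ((1 : ℝ →L[ℝ] ℝ).smulRight v + (1 : ℝ →L[ℝ] ℝ).smulRight w) 1 = v + w := by simp
    have h2 := oneParam_mem_of_tendsto hC (z := fun n => 1 / ((n : ℝ) + 1))
      (ε := fun n => 1 / ((n : ℝ) + 1)) (ζ := 1) (by simp [oneParam_zero]) h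
      (fun n => Nat.one_div_pos_of_nat) tendsto_one_div_add_atTop_nhds_zero_nat
      (by
        refine tendsto_const_nhds.congr fun n => ?_
        have : (1 / ((n : ℝ) + 1)) ≠ 0 := Nat.one_div_pos_of_nat.ne'
        rw [smul_eq_mul, inv_mul_cancel₀ this])
      (fun n => C.mul_mem (hv _) (hw _)) t
    exact e ▸ h2

/-- A submanifold transverse to the Lie algebra of a closed subgroup meets it discretely at the
identity. -/
theorem eventually_eq_zero_of_mem {C : Subgroup G} (hC : IsClosed (C : Set G)) {V : Submodule ℝ E}
    (hV : V ⊓ closedSubgroupLie (G := G) C hC = ⊥) {A : V → G} (hA0 : A 0 = 1)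
    (hA : HasMFDerivAt 𝓘(ℝ, V) 𝓘(ℝ, E) A 0 V.subtypeL) :
    ∀ᶠ z in 𝓝 (0 : V), A z ∈ C → z = 0 := by
  by_contra hcon
  rw [not_eventually] at hcon
  obtain ⟨z, hz0, hz⟩ := exists_seq_forall_of_frequently hcon
  have hne : ∀ n, z n ≠ 0 := fun n h => hz n fun _ => h
  have hmem : ∀ n, A (z n) ∈ C := fun n => by
    by_contra h
    exact hz n fun h' => absurd h' h
  -- Nonzero parameters of elements of `C` tending to `0` are normalized. A limit point on the
  -- compact unit sphere would be a unit vector of `V` in the Lie algebra of `C`, contradicting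
  -- transversality.
  have hsph : ∀ n, ‖z n‖⁻¹ • z n ∈ Metric.sphere (0 : V) 1 := fun n => by
    rw [mem_sphere_zero_iff_norm, norm_smul, norm_inv, norm_norm,
      inv_mul_cancel₀ (norm_ne_zero_iff.2 (hne n))]
  obtain ⟨ζ, hζ, φ, hφ, hlim⟩ := (isCompact_sphere (0 : V) 1).tendsto_subseq hsph
  have h1 : (ζ : E) ∈ closedSubgroupLie (G := G) C hC := fun t =>
    oneParam_mem_of_tendsto hC hA0 hA (z := z ∘ φ) (ε := fun n => ‖z (φ n)‖)
      (fun n => norm_pos_iff.2 (hne _))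
      (by simpa using (hz0.comp hφ.tendsto_atTop).norm) hlim (fun n => hmem _) t
  have h2 : (ζ : E) ∈ (⊥ : Submodule ℝ E) := hV ▸ ⟨ζ.2, h1⟩
  have h3 : ζ = 0 := by simpa using h2
  rw [mem_sphere_zero_iff_norm, h3, norm_zero] at hζ
  exact zero_ne_one hζ

end Cartan

/-- Charts of coset spaces and of orbit spaces arise in this way, with `f` the projection composed
with a local cross-section. -/
theorem exists_openPartialHomeomorph_of_injOn {F Q : Type*} [TopologicalSpace F]
    [TopologicalSpace Q] [Nonempty F] {f : F → Q} {V : Set F} (hV : IsOpen V)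
    (hc : ContinuousOn f V) (hi : InjOn f V) (ho : ∀ U ⊆ V, IsOpen U → IsOpen (f '' U)) :
    ∃ χ : OpenPartialHomeomorph Q F, χ.target = V ∧ χ.source = f '' V ∧
      (∀ x ∈ V, χ.symm x = f x) ∧ ∀ x ∈ V, χ (f x) = x := by
  set e : PartialEquiv F Q := hi.toPartialEquiv f V with he
  have ho' : IsOpenMap (e.source.domRestrict e) := by
    intro U hU
    have hU' : IsOpen ((↑) '' U : Set F) := hV.isOpenMap_subtype_val _ hU
    have := ho _ (by rintro _ ⟨x, -, rfl⟩; exact x.2) hU'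
    rw [image_image] at this
    exact this
  set φ := OpenPartialHomeomorph.ofContinuousOpenRestrict e hc ho' hV with hφ
  exact ⟨φ.symm, rfl, rfl, fun x _ => rfl, fun x hx => φ.left_inv hx⟩

/-! ### Smooth subquotients and their charts -/

section Span

variable {E F M S Q : Type*} [NormedAddCommGroup E] [NormedSpace ℝ E]
  [TopologicalSpace M] [ChartedSpace E M] [NormedAddCommGroup F] [NormedSpace ℝ F]
  [TopologicalSpace Q]

/-- A chart of `Q` at `q`, where `M ← S → Q` is a subquotient of the manifold `M`: it has a smooth
section, and its pull-back to `S` locally extends to a smooth map on `M`. -/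
structure SpanChart (E F : Type*) [NormedAddCommGroup E] [NormedSpace ℝ E]
    {M S Q : Type*} [TopologicalSpace M] [ChartedSpace E M] [NormedAddCommGroup F]
    [NormedSpace ℝ F] [TopologicalSpace Q] (ι : S → M) (π : S → Q) (q : Q) where
  chart : OpenPartialHomeomorph Q F
  mem : q ∈ chart.source
  sec : F → S
  contMDiffOn_sec : ContMDiffOn 𝓘(ℝ, F) 𝓘(ℝ, E) ∞ (ι ∘ sec) chart.target
  proj_sec : ∀ x ∈ chart.target, π (sec x) = chart.symm x
  exists_ext : ∀ s, π s ∈ chart.source → ∃ (U : Set M) (r : M → F), IsOpen U ∧ ι s ∈ U ∧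
    ContMDiffOn 𝓘(ℝ, E) 𝓘(ℝ, F) ∞ r U ∧
    ∀ s', ι s' ∈ U → π s' ∈ chart.source ∧ r (ι s') = chart (π s')

variable {ι : S → M} {π : S → Q}

/-- The manifold structure of a subquotient given by its charts. -/
abbrev SpanChart.chartedSpace (h : ∀ q, SpanChart E F ι π q) : ChartedSpace F Q where
  atlas := range fun q => (h q).chart
  chartAt q := (h q).chart
  mem_chart_source q := (h q).mem
  chart_mem_atlas q := mem_range_self q

/-- A change of charts is the section of the first chart followed by the local extension of the
second, hence a composition of smooth maps through `M`. -/
theorem SpanChart.contDiffOn_transition {q q' : Q} (h : SpanChart E F ι π q)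
    (h' : SpanChart E F ι π q') :
    ContDiffOn ℝ ∞ (h'.chart ∘ h.chart.symm) (h.chart.symm ≫ₕ h'.chart).source := by
  intro x hx
  rw [OpenPartialHomeomorph.trans_source] at hx
  have hxt : x ∈ h.chart.target := hx.1
  have hx' : π (h.sec x) ∈ h'.chart.source := by
    rw [h.proj_sec x hxt]
    exact hx.2
  obtain ⟨U, r, hU, hxU, hr, hext⟩ := h'.exists_ext _ hx'
  have hs := h.contMDiffOn_sec.contMDiffAt (h.chart.open_target.mem_nhds hxt)
  have h1 : ContDiffAt ℝ ∞ (r ∘ (ι ∘ h.sec)) x :=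
    contMDiffAt_iff_contDiffAt.1 ((hr.contMDiffAt (hU.mem_nhds hxU)).comp x hs)
  refine (h1.congr_of_eventuallyEq ?_).contDiffWithinAt
  filter_upwards [h.chart.open_target.mem_nhds hxt, hs.continuousAt.preimage_mem_nhds
    (hU.mem_nhds hxU)] with y hy hyU
  rw [Function.comp_apply, Function.comp_apply, ← h.proj_sec y hy, ← (hext _ hyU).2]
  rfl

theorem SpanChart.isManifold (h : ∀ q, SpanChart E F ι π q) :
    letI := SpanChart.chartedSpace h
    IsManifold 𝓘(ℝ, F) ∞ Q := by
  let _ := SpanChart.chartedSpace h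
  refine isManifold_of_contDiffOn 𝓘(ℝ, F) ∞ Q ?_
  rintro _ _ ⟨q, rfl⟩ ⟨q', rfl⟩
  simpa using (h q).contDiffOn_transition (h q')

/-- `M ← S → Q` exhibits the manifold `Q` as a smooth subquotient of the manifold `M`. -/
structure IsSmoothSpan (E F : Type*) [NormedAddCommGroup E] [NormedSpace ℝ E]
    {M S Q : Type*} [TopologicalSpace M] [ChartedSpace E M] [NormedAddCommGroup F]
    [NormedSpace ℝ F] [TopologicalSpace Q] [ChartedSpace F Q] (ι : S → M) (π : S → Q) : Prop where
  exists_sec : ∀ q, ∃ (V : Set Q) (σ : Q → S), IsOpen V ∧ q ∈ V ∧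
    ContMDiffOn 𝓘(ℝ, F) 𝓘(ℝ, E) ∞ (ι ∘ σ) V ∧ ∀ q' ∈ V, π (σ q') = q'
  exists_ext : ∀ s, ∃ (U : Set M) (R : M → Q), IsOpen U ∧ ι s ∈ U ∧
    ContMDiffOn 𝓘(ℝ, E) 𝓘(ℝ, F) ∞ R U ∧ ∀ s', ι s' ∈ U → R (ι s') = π s'

/-- Transports the sections and extensions from chart coordinates to `Q` itself, so that later
arguments need no charts. -/
theorem SpanChart.isSmoothSpan (h : ∀ q, SpanChart E F ι π q) :
    letI := SpanChart.chartedSpace h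
    IsSmoothSpan E F ι π := by
  let _ := SpanChart.chartedSpace h
  have := SpanChart.isManifold h
  refine ⟨fun q => ?_, fun s => ?_⟩
  · refine ⟨(h q).chart.source, (h q).sec ∘ (h q).chart, (h q).chart.open_source, (h q).mem,
      ?_, fun q' hq' => ?_⟩
    · exact (h q).contMDiffOn_sec.comp (contMDiffOn_chart (I := 𝓘(ℝ, F)) (x := q))
        (fun y hy => (h q).chart.map_source hy)
    · rw [Function.comp_apply, (h q).proj_sec _ ((h q).chart.map_source hq'),
        (h q).chart.left_inv hq']
  · set q := π s
    obtain ⟨U, r, hU, hsU, hr, hext⟩ := (h q).exists_ext s (h q).mem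
    refine ⟨U ∩ r ⁻¹' (h q).chart.target, (h q).chart.symm ∘ r,
      hr.continuousOn.isOpen_inter_preimage hU (h q).chart.open_target, ⟨hsU, ?_⟩, ?_, ?_⟩
    · rw [mem_preimage, (hext s hsU).2]
      exact (h q).chart.map_source (h q).mem
    · exact (contMDiffOn_chart_symm (I := 𝓘(ℝ, F)) (x := q)).comp (hr.mono inter_subset_left)
        (fun y hy => hy.2)
    · intro s' hs'
      rw [Function.comp_apply, (hext s' hs'.1).2, (h q).chart.left_inv (hext s' hs'.1).1]

variable [ChartedSpace F Q]

/-- A map into a smooth subquotient is smooth if it has a smooth lift. -/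
theorem IsSmoothSpan.contMDiffWithinAt (h : IsSmoothSpan E F ι π) {E' H' W : Type*}
    [NormedAddCommGroup E'] [NormedSpace ℝ E'] [TopologicalSpace H'] {I : ModelWithCorners ℝ E' H'}
    [TopologicalSpace W] [ChartedSpace H' W] {g : W → S} {s : Set W} {w : W}
    (hg : ContMDiffWithinAt I 𝓘(ℝ, E) ∞ (ι ∘ g) s w) :
    ContMDiffWithinAt I 𝓘(ℝ, F) ∞ (π ∘ g) s w := by
  obtain ⟨U, R, hU, hw, hR, hext⟩ := h.exists_ext (g w)
  have h1 := (hR.contMDiffAt (hU.mem_nhds hw)).comp_contMDiffWithinAt w hg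
  refine h1.congr_of_eventuallyEq ?_ (hext _ hw).symm
  filter_upwards [hg.continuousWithinAt.preimage_mem_nhdsWithin (hU.mem_nhds hw)] with y hy
  exact (hext _ hy).symm

theorem IsSmoothSpan.contMDiff (h : IsSmoothSpan E F ι π) {E' H' W : Type*}
    [NormedAddCommGroup E'] [NormedSpace ℝ E'] [TopologicalSpace H'] {I : ModelWithCorners ℝ E' H'}
    [TopologicalSpace W] [ChartedSpace H' W] {g : W → S}
    (hg : ContMDiff I 𝓘(ℝ, E) ∞ (ι ∘ g)) :
    ContMDiff I 𝓘(ℝ, F) ∞ (π ∘ g) := fun w => h.contMDiffWithinAt (hg w)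

/-- A map from a smooth subquotient is smooth if it locally extends to a smooth map. -/
theorem IsSmoothSpan.contMDiff_of_ext (h : IsSmoothSpan E F ι π) {E' H' W : Type*}
    [NormedAddCommGroup E'] [NormedSpace ℝ E'] [TopologicalSpace H'] {I : ModelWithCorners ℝ E' H'}
    [TopologicalSpace W] [ChartedSpace H' W] {f : Q → W}
    (hf : ∀ s, ∃ (U : Set M) (f' : M → W), IsOpen U ∧ ι s ∈ U ∧ ContMDiffOn 𝓘(ℝ, E) I ∞ f' U ∧
      ∀ s', ι s' ∈ U → f (π s') = f' (ι s')) : ContMDiff 𝓘(ℝ, F) I ∞ f := by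
  intro q
  obtain ⟨V, σ, hV, hqV, hσ, hπσ⟩ := h.exists_sec q
  obtain ⟨U, f', hU, hqU, hf', hff'⟩ := hf (σ q)
  have hσq := hσ.contMDiffAt (hV.mem_nhds hqV)
  refine ((hf'.contMDiffAt (hU.mem_nhds hqU)).comp q hσq).congr_of_eventuallyEq ?_
  filter_upwards [hV.mem_nhds hqV, hσq.continuousAt.preimage_mem_nhds (hU.mem_nhds hqU)]
    with y hy hyU
  rw [Function.comp_apply, Function.comp_apply, ← hff' _ hyU, hπσ y hy]

end Span

/-- Normalizing is an intersection of closed conditions on conjugates. Both `g h g⁻¹` and `g⁻¹ h g`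
occur because `g H g⁻¹ ⊆ H` alone need not give equality. -/
theorem isClosed_normalizer {G : Type*} [Group G] [TopologicalSpace G] [IsTopologicalGroup G]
    {H : Subgroup G} (hH : IsClosed (H : Set G)) :
    IsClosed (Subgroup.normalizer (H : Set G) : Set G) := by
  have : (Subgroup.normalizer (H : Set G) : Set G) =
      ⋂ h ∈ H, ({g : G | g * h * g⁻¹ ∈ H} ∩ {g : G | g⁻¹ * h * g ∈ H}) := by
    ext g
    simp only [SetLike.mem_coe, mem_iInter, mem_inter_iff, mem_ofPred_eq]
    constructor
    · intro hg h hh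
      refine ⟨(Subgroup.mem_normalizer_iff.1 hg h).1 hh, ?_⟩
      have := (Subgroup.mem_normalizer_iff.1 (Subgroup.inv_mem _ hg) h).1 hh
      rwa [inv_inv] at this
    · intro hg
      refine Subgroup.mem_normalizer_iff.2 fun h => ⟨fun hh => (hg h hh).1, fun hh => ?_⟩
      have := (hg _ hh).2
      simpa [mul_assoc] using this
  rw [this]
  refine isClosed_biInter fun h _ => IsClosed.inter ?_ ?_
  · exact hH.preimage (by fun_prop)
  · exact hH.preimage (by fun_prop)

/-! ### Cross-sections and charts for quotients of closed subgroups -/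

section ClosedSubgroups

variable {E G : Type*} [NormedAddCommGroup E] [NormedSpace ℝ E]
  [Group G] [TopologicalSpace G] [ChartedSpace E G] [LieGroup 𝓘(ℝ, E) ∞ G]
  [FiniteDimensional ℝ E]

/-- The derivative of the triple product at `0` is the sum map `K × H × C → E`, which is invertible
by `hbij`; the inverse function theorem applies. -/
theorem exists_local_product (K H C : Submodule ℝ E) (hbij : Function.Bijective
      (fun p : K × H × C => (p.1 : E) + ((p.2.1 : E) + (p.2.2 : E)))) {A : K → G} {B : H → G}
    {D : C → G} (hA : ContMDiff 𝓘(ℝ, K) 𝓘(ℝ, E) ∞ A) (hA0 : A 0 = 1)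
    (hA' : HasMFDerivAt 𝓘(ℝ, K) 𝓘(ℝ, E) A 0 K.subtypeL)
    (hB : ContMDiff 𝓘(ℝ, H) 𝓘(ℝ, E) ∞ B) (hB0 : B 0 = 1)
    (hB' : HasMFDerivAt 𝓘(ℝ, H) 𝓘(ℝ, E) B 0 H.subtypeL)
    (hD : ContMDiff 𝓘(ℝ, C) 𝓘(ℝ, E) ∞ D) (hD0 : D 0 = 1)
    (hD' : HasMFDerivAt 𝓘(ℝ, C) 𝓘(ℝ, E) D 0 C.subtypeL) :
    ∃ Φ : OpenPartialHomeomorph (K × H × C) G, 0 ∈ Φ.source ∧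
      (∀ p ∈ Φ.source, Φ p = A p.1 * (B p.2.1 * D p.2.2)) ∧
      ContMDiffOn 𝓘(ℝ, E) 𝓘(ℝ, K × H × C) ∞ Φ.symm Φ.target := by
  set p₁ : K × H × C →L[ℝ] K := ContinuousLinearMap.fst ℝ K (H × C) with hp₁
  set p₂ : K × H × C →L[ℝ] H :=
    (ContinuousLinearMap.fst ℝ H C).comp (ContinuousLinearMap.snd ℝ K (H × C)) with hp₂
  set p₃ : K × H × C →L[ℝ] C :=
    (ContinuousLinearMap.snd ℝ H C).comp (ContinuousLinearMap.snd ℝ K (H × C)) with hp₃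
  set L : K × H × C →L[ℝ] E :=
    K.subtypeL.comp p₁ + (H.subtypeL.comp p₂ + C.subtypeL.comp p₃) with hL
  set Φ' : (K × H × C) ≃L[ℝ] E :=
    (LinearEquiv.ofBijective (L : K × H × C →ₗ[ℝ] E) hbij).toContinuousLinearEquiv with hΦ'
  set f : K × H × C → G := fun p => A (p₁ p) * (B (p₂ p) * D (p₃ p)) with hf
  have hfs : ContMDiff 𝓘(ℝ, K × H × C) 𝓘(ℝ, E) ∞ f :=
    (hA.comp p₁.contMDiff).mul ((hB.comp p₂.contMDiff).mul (hD.comp p₃.contMDiff))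
  have h1 : HasMFDerivAt 𝓘(ℝ, K × H × C) 𝓘(ℝ, E) (A ∘ p₁) 0 (K.subtypeL.comp p₁) :=
    HasMFDerivAt.comp (0 : K × H × C) (I' := 𝓘(ℝ, K)) hA' p₁.hasFDerivAt.hasMFDerivAt
  have h2 : HasMFDerivAt 𝓘(ℝ, K × H × C) 𝓘(ℝ, E) (B ∘ p₂) 0 (H.subtypeL.comp p₂) :=
    HasMFDerivAt.comp (0 : K × H × C) (I' := 𝓘(ℝ, H)) hB' p₂.hasFDerivAt.hasMFDerivAt
  have h3 : HasMFDerivAt 𝓘(ℝ, K × H × C) 𝓘(ℝ, E) (D ∘ p₃) 0 (C.subtypeL.comp p₃) :=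
    HasMFDerivAt.comp (0 : K × H × C) (I' := 𝓘(ℝ, C)) hD' p₃.hasFDerivAt.hasMFDerivAt
  have h4 : HasMFDerivAt 𝓘(ℝ, K × H × C) 𝓘(ℝ, E) f 0 (Φ' : K × H × C →L[ℝ] E) :=
    hasMFDerivAt_mul_of_eq_one (by simp [hA0]) (by simp [hB0, hD0]) h1
      (hasMFDerivAt_mul_of_eq_one (by simp [hB0]) (by simp [hD0]) h2 h3)
  obtain ⟨Φ, hΦ0, -, hΦf, hΦs, -⟩ := exists_openPartialHomeomorph_of_hasMFDerivAt isOpen_univ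
    hfs.contMDiffOn (mem_univ 0) Φ' h4
  exact ⟨Φ, hΦ0, hΦf, hΦs⟩

variable [T2Space G]

/-- Near the identity, a closed subgroup `N` containing a closed subgroup `H` has a smooth
cross-section for its right `H`-cosets, and the projection to it extends smoothly to the group. -/
theorem exists_local_cross_section {H N : Subgroup G} (hHN : H ≤ N) (hH : IsClosed (H : Set G))
    (hN : IsClosed (N : Set G)) :
    ∃ (k : ℕ) (V : Set (EuclideanSpace ℝ (Fin k))) (σ : EuclideanSpace ℝ (Fin k) → G) (B : Set G)
      (r : G → EuclideanSpace ℝ (Fin k)), IsOpen V ∧ 0 ∈ V ∧ ContMDiff (𝓡 k) 𝓘(ℝ, E) ∞ σ ∧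
      σ 0 = 1 ∧ (∀ x, σ x ∈ N) ∧ (∀ x ∈ V, ∀ y ∈ V, (σ x)⁻¹ * σ y ∈ H → x = y) ∧
      IsOpen B ∧ ContMDiffOn 𝓘(ℝ, E) (𝓡 k) ∞ r B ∧
      (∀ g ∈ B, g ∈ N → r g ∈ V ∧ (σ (r g))⁻¹ * g ∈ H) ∧
      ∀ x ∈ V, σ x ∈ B ∧ r (σ x) = x := by
  set 𝔥 := closedSubgroupLie (E := E) H hH with h𝔥
  set 𝔫 := closedSubgroupLie (E := E) N hN with h𝔫
  have h𝔥𝔫 : 𝔥 ≤ 𝔫 := fun v hv t => hHN (hv t)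
  obtain ⟨C, hC⟩ := Submodule.exists_isCompl 𝔫
  obtain ⟨K', hK'⟩ := Submodule.exists_isCompl 𝔥
  -- By the modular law `K` is a complement of `𝔥` in `𝔫`, so `E` is the direct sum of `K`, `𝔥` and
  -- `C`. The cosets near the identity are parametrized by `K`.
  set K := K' ⊓ 𝔫 with hK
  have hKH : K ⊓ 𝔥 = ⊥ := by
    rw [eq_bot_iff]
    intro v hv
    exact hK'.disjoint.le_bot ⟨hv.2, hv.1.1⟩
  have hKH' : 𝔫 ≤ K ⊔ 𝔥 := by
    intro v hv
    have hv' : v ∈ 𝔥 ⊔ K' := by rw [hK'.sup_eq_top]; trivial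
    obtain ⟨y, hy, z, hz, rfl⟩ := Submodule.mem_sup.1 hv'
    refine Submodule.mem_sup.2 ⟨z, ⟨hz, ?_⟩, y, hy, add_comm _ _⟩
    have := 𝔫.sub_mem hv (h𝔥𝔫 hy)
    rwa [add_sub_cancel_left] at this
  obtain ⟨A, hA, hA0, hA', hAN⟩ := exists_param (G := G) K
  obtain ⟨B, hB, hB0, hB', hBH⟩ := exists_param (G := G) 𝔥
  obtain ⟨D, hD, hD0, hD', -⟩ := exists_param (G := G) C
  replace hAN : ∀ x, A x ∈ N := hAN N fun v hv => hv.2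
  replace hBH : ∀ x, B x ∈ H := hBH H fun v hv => hv
  have hbij : Function.Bijective
      (fun p : K × 𝔥 × C => (p.1 : E) + ((p.2.1 : E) + (p.2.2 : E))) := by
    constructor
    · rintro ⟨x, y, z⟩ ⟨x', y', z'⟩ h
      simp only at h
      have e1 : (z : E) - z' = (x' - x) + (y' - y) := by
        rw [sub_eq_iff_eq_add]
        have : (z : E) = (x + (y + z)) - x - y := by abel
        rw [this, h]
        abel
      have e2 : (z : E) - z' ∈ 𝔫 := by
        rw [e1]
        exact 𝔫.add_mem (𝔫.sub_mem x'.2.2 x.2.2) (h𝔥𝔫 (𝔥.sub_mem y'.2 y.2))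
      have e3 : (z : E) - z' = 0 := by
        simpa using hC.disjoint.le_bot ⟨e2, C.sub_mem z.2 z'.2⟩
      rw [e3] at e1
      have e4 : (x : E) - x' = y' - y := by
        rw [sub_eq_iff_eq_add]
        have : (y' : E) - y = 0 - (x' - x) := by rw [e1]; abel
        rw [this]
        abel
      have e5 : (x : E) - x' = 0 := by
        have : (x : E) - x' ∈ K ⊓ 𝔥 := ⟨K.sub_mem x.2 x'.2, e4 ▸ 𝔥.sub_mem y'.2 y.2⟩
        rw [hKH] at this
        simpa using this
      rw [e5] at e4
      have a1 : x = x' := Subtype.ext (sub_eq_zero.1 e5)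
      have a2 : y = y' := Subtype.ext (sub_eq_zero.1 e4.symm).symm
      have a3 : z = z' := Subtype.ext (sub_eq_zero.1 e3)
      rw [a1, a2, a3]
    · intro v
      have hv : v ∈ 𝔫 ⊔ C := by rw [hC.sup_eq_top]; trivial
      obtain ⟨w, hw, z, hz, rfl⟩ := Submodule.mem_sup.1 hv
      obtain ⟨x, hx, y, hy, rfl⟩ := Submodule.mem_sup.1 (hKH' hw)
      exact ⟨(⟨x, hx⟩, ⟨y, hy⟩, ⟨z, hz⟩), by simp [add_assoc]⟩
  obtain ⟨Φ, hΦ0, hΦ, hΦs⟩ := exists_local_product (G := G) K 𝔥 C hbij hA hA0 hA' hB hB0 hB' hD hD0 hD'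
  have hev₁ := eventually_eq_zero_of_mem hN (V := C) hC.symm.inf_eq_bot hD0 hD'
  have hev₂ := eventually_eq_zero_of_mem hH (V := K) hKH hA0 hA'
  obtain ⟨r₁, hr₁, hb₁⟩ := Metric.mem_nhds_iff.1 hev₁
  obtain ⟨r₂, hr₂, hb₂⟩ := Metric.mem_nhds_iff.1 hev₂
  obtain ⟨r₃, hr₃, hb₃⟩ := Metric.mem_nhds_iff.1 (Φ.open_source.mem_nhds hΦ0)
  set ρ := min r₁ (min r₂ r₃) with hρ
  have hρ0 : 0 < ρ := lt_min hr₁ (lt_min hr₂ hr₃)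
  have hball : ∀ p : K × 𝔥 × C, p ∈ Metric.ball 0 ρ ↔ ‖p.1‖ < ρ ∧ ‖p.2.1‖ < ρ ∧ ‖p.2.2‖ < ρ := by
    intro p
    rw [mem_ball_zero_iff, Prod.norm_def, Prod.norm_def, max_lt_iff, max_lt_iff]
  have hsrc : Metric.ball (0 : K × 𝔥 × C) ρ ⊆ Φ.source := fun p hp =>
    hb₃ (Metric.ball_subset_ball ((min_le_right _ _).trans (min_le_right _ _)) hp)
  -- In a product in `N` the first two factors already lie in `N`, so the transversal factor does
  -- too and must be trivial near the identity.
  have hz : ∀ p ∈ Metric.ball (0 : K × 𝔥 × C) ρ, Φ p ∈ N → p.2.2 = 0 ∧ Φ p = A p.1 * B p.2.1 := by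
    intro p hp hpN
    rw [hΦ p (hsrc hp)] at hpN ⊢
    have h1 : D p.2.2 ∈ N := by
      rw [N.mul_mem_cancel_left (hAN _), N.mul_mem_cancel_left (hHN (hBH _))] at hpN
      exact hpN
    have h2 : p.2.2 = 0 := hb₁ (by
      rw [mem_ball_zero_iff]
      exact ((hball p).1 hp).2.2.trans_le (min_le_left _ _)) h1
    exact ⟨h2, by rw [h2, hD0, mul_one]⟩
  -- coordinates on `K`
  obtain ⟨L⟩ : Nonempty (EuclideanSpace ℝ (Fin (Module.finrank ℝ K)) ≃L[ℝ] K) :=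
    FiniteDimensional.nonempty_continuousLinearEquiv_of_finrank_eq (by simp)
  set σ : EuclideanSpace ℝ (Fin (Module.finrank ℝ K)) → G := A ∘ L with hσ
  have hσs : ContMDiff (𝓡 (Module.finrank ℝ K)) 𝓘(ℝ, E) ∞ σ := 
    hA.comp (L : EuclideanSpace ℝ (Fin (Module.finrank ℝ K)) →L[ℝ] K).contMDiff
  have hσ0 : σ 0 = 1 := by simp [hσ, hA0]
  have : IsTopologicalGroup G := topologicalGroup_of_lieGroup 𝓘(ℝ, E) ∞
  have hO : IsOpen (Φ '' Metric.ball 0 ρ) :=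
    Φ.isOpen_image_of_subset_source Metric.isOpen_ball hsrc
  have h1O : (1 : G) ∈ Φ '' Metric.ball 0 ρ :=
    ⟨0, Metric.mem_ball_self hρ0, by rw [hΦ 0 hΦ0]; simp [hA0, hB0, hD0]⟩
  have hq : Continuous fun q : EuclideanSpace ℝ (Fin (Module.finrank ℝ K)) ×
      EuclideanSpace ℝ (Fin (Module.finrank ℝ K)) => (σ q.1)⁻¹ * σ q.2 :=
    (hσs.continuous.comp continuous_fst).inv.mul (hσs.continuous.comp continuous_snd)
  -- Continuity makes `V₀` small enough that every quotient `σ(x)⁻¹ σ(y)` lies in the product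
  -- neighbourhood.
  have hnear : (fun q : EuclideanSpace ℝ (Fin (Module.finrank ℝ K)) ×
      EuclideanSpace ℝ (Fin (Module.finrank ℝ K)) => (σ q.1)⁻¹ * σ q.2) ⁻¹' (Φ '' Metric.ball 0 ρ) ∈
        𝓝 (0, 0) := by
    refine hq.continuousAt.preimage_mem_nhds (hO.mem_nhds ?_)
    simpa [hσ0] using h1O
  rw [nhds_prod_eq, mem_prod_same_iff] at hnear
  obtain ⟨V₀, hV₀, hVV⟩ := hnear
  obtain ⟨V₁, hV₁, hV₁o, h0V₁⟩ := mem_nhds_iff.1 hV₀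
  set V := V₁ ∩ L ⁻¹' Metric.ball 0 ρ with hV
  have hVo : IsOpen V := hV₁o.inter (Metric.isOpen_ball.preimage L.continuous)
  have hin : ∀ x ∈ V, ‖L x‖ < ρ := fun x hx => mem_ball_zero_iff.1 hx.2
  have hxb : ∀ x ∈ V, ((L x, 0, 0) : K × 𝔥 × C) ∈ Metric.ball 0 ρ := fun x hx =>
    (hball _).2 ⟨hin x hx, by simpa using hρ0, by simpa using hρ0⟩
  have hΦx : ∀ x ∈ V, Φ (L x, 0, 0) = σ x := fun x hx => by
    rw [hΦ _ (hsrc (hxb x hx))]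
    simp [hB0, hD0, hσ]
  -- The projection `r` reads the `K`-coordinate; `W` restricts it to values in `V`.
  set W : Set (K × 𝔥 × C) := Metric.ball 0 ρ ∩ (fun p => L.symm p.1) ⁻¹' V with hW
  have hWo : IsOpen W :=
    Metric.isOpen_ball.inter (hVo.preimage (L.symm.continuous.comp continuous_fst))
  have hWs : W ⊆ Φ.source := inter_subset_left.trans hsrc
  refine ⟨Module.finrank ℝ K, V, σ, Φ '' W, fun g => L.symm (Φ.symm g).1, hVo,
    ⟨h0V₁, by simpa using hρ0⟩, hσs, hσ0, fun x => hAN _, ?_,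
    Φ.isOpen_image_of_subset_source hWo hWs, ?_, ?_, ?_⟩
  -- A quotient in `H` has trivial transversal factor and hence `A`-factor in `H`, so that factor is
  -- trivial as well. Then `σ y = σ x` times a small element `B p.2.1`, and comparing product
  -- coordinates gives `x = y`.
  · intro x hx y hy hxy
    obtain ⟨p, hp, hpe⟩ := hVV (show (x, y) ∈ V₀ ×ˢ V₀ from ⟨hV₁ hx.1, hV₁ hy.1⟩)
    simp only at hpe
    have hpH : Φ p ∈ H := hpe ▸ hxy
    obtain ⟨-, hp2⟩ := hz p hp (hHN hpH)
    have hA1 : A p.1 ∈ H := by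
      rw [hp2, H.mul_mem_cancel_right (hBH _)] at hpH
      exact hpH
    have hp1 : p.1 = 0 := hb₂ (by
      rw [mem_ball_zero_iff]
      exact ((hball p).1 hp).1.trans_le ((min_le_right _ _).trans (min_le_left _ _))) hA1
    rw [hp1, hA0, one_mul] at hp2
    have hyx : σ y = σ x * B p.2.1 := by rw [← hp2, hpe, mul_inv_cancel_left]
    have hb : ((L x, p.2.1, 0) : K × 𝔥 × C) ∈ Metric.ball 0 ρ :=
      (hball _).2 ⟨hin x hx, ((hball p).1 hp).2.1, by simpa using hρ0⟩
    have he : Φ (L x, p.2.1, 0) = Φ (L y, 0, 0) := by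
      rw [hΦx y hy, hyx, hΦ _ (hsrc hb)]
      simp [hD0, hσ]
    have := Φ.injOn (hsrc hb) (hsrc (hxb y hy)) he
    exact L.injective (congrArg Prod.fst this)
  · have h1 : ContMDiffOn 𝓘(ℝ, E) 𝓘(ℝ, K × 𝔥 × C) ∞ Φ.symm (Φ '' W) := by
      refine hΦs.mono ?_
      rintro _ ⟨p, hp, rfl⟩
      exact Φ.map_source (hWs hp)
    exact (((L.symm : K →L[ℝ] EuclideanSpace ℝ (Fin (Module.finrank ℝ K))).comp
      (ContinuousLinearMap.fst ℝ K (𝔥 × C))).contMDiff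
      (n := ∞)).comp_contMDiffOn h1
  · rintro _ ⟨p, hp, rfl⟩ hpN
    simp only
    rw [Φ.left_inv (hWs hp)]
    refine ⟨hp.2, ?_⟩
    rw [(hz p hp.1 hpN).2]
    simp only [hσ, Function.comp_apply, L.apply_symm_apply, inv_mul_cancel_left]
    exact hBH _
  · intro x hx
    have hxW : ((L x, 0, 0) : K × 𝔥 × C) ∈ W := ⟨hxb x hx, by
      change L.symm (L x) ∈ V
      rwa [L.symm_apply_apply]⟩
    refine ⟨⟨_, hxW, hΦx x hx⟩, ?_⟩
    simp only
    rw [← hΦx x hx, Φ.left_inv (hWs hxW), L.symm_apply_apply]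

/-- The quotient of a closed subgroup by a smaller closed subgroup is a smooth subquotient. -/
theorem exists_spanChart_quotient {H N : Subgroup G} (hHN : H ≤ N) (hH : IsClosed (H : Set G))
    (hN : IsClosed (N : Set G)) :
    ∃ k : ℕ, Nonempty (∀ q : ↥N ⧸ H.subgroupOf N,
      SpanChart E (EuclideanSpace ℝ (Fin k)) (Subtype.val : ↥N → G)
        (QuotientGroup.mk : ↥N → ↥N ⧸ H.subgroupOf N) q) := by
  obtain ⟨k, V, σ, B, r, hV, h0V, hσ, hσ0, hσN, hinj, hB, hr, hBN, hVB⟩ :=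
    exists_local_cross_section (E := E) hHN hH hN
  have : IsTopologicalGroup G := topologicalGroup_of_lieGroup 𝓘(ℝ, E) ∞
  refine ⟨k, ⟨fun q => Classical.choice ?_⟩⟩
  obtain ⟨n, rfl⟩ := QuotientGroup.mk_surjective q
  -- The section near the coset of `n` is the left translate by `n` of the section at the identity.
  set s : EuclideanSpace ℝ (Fin k) → ↥N := fun x => n * ⟨σ x, hσN x⟩ with hs
  set π : ↥N → ↥N ⧸ H.subgroupOf N := QuotientGroup.mk with hπ
  have hπeq : ∀ a b : ↥N, π a = π b ↔ (a : G)⁻¹ * b ∈ H := fun a b => by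
    rw [hπ, QuotientGroup.eq, Subgroup.mem_subgroupOf]
    rfl
  have hsc : Continuous s := continuous_const.mul (hσ.continuous.subtype_mk hσN)
  have hπo : IsOpenMap π := QuotientGroup.isOpenMap_coe
  have hcont : ContinuousOn (π ∘ s) V := (continuous_quotient_mk'.comp hsc).continuousOn
  have hinj' : InjOn (π ∘ s) V := by
    intro x hx y hy hxy
    refine hinj x hx y hy ?_
    have := (hπeq _ _).1 hxy
    simpa [hs, mul_assoc] using this
  have key : ∀ m : ↥N, ∀ h ∈ H, (n : G)⁻¹ * m * h⁻¹ ∈ B →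
      r ((n : G)⁻¹ * m * h⁻¹) ∈ V ∧ π m = π (s (r ((n : G)⁻¹ * m * h⁻¹))) := by
    intro m h hh hm
    obtain ⟨h1, h2⟩ := hBN _ hm
      (N.mul_mem (N.mul_mem (N.inv_mem n.2) m.2) (N.inv_mem (hHN hh)))
    refine ⟨h1, Eq.symm ((hπeq _ _).2 ?_)⟩
    have h3 := H.mul_mem h2 hh
    simpa [hs, mul_assoc] using h3
  have hopen : ∀ U ⊆ V, IsOpen U → IsOpen ((π ∘ s) '' U) := by
    intro U hUV hU
    have h1 : IsOpen (B ∩ r ⁻¹' U) := hr.continuousOn.isOpen_inter_preimage hB hU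
    have h2 : IsOpen ((fun m : ↥N => (n : G)⁻¹ * m) ⁻¹' (B ∩ r ⁻¹' U)) :=
      h1.preimage (continuous_const.mul continuous_subtype_val)
    convert hπo _ h2 using 1
    ext q
    constructor
    · rintro ⟨x, hx, rfl⟩
      obtain ⟨h3, h4⟩ := hVB x (hUV hx)
      refine ⟨s x, ?_, rfl⟩
      change (n : G)⁻¹ * (n * σ x) ∈ B ∩ r ⁻¹' U
      rw [inv_mul_cancel_left]
      exact ⟨h3, by rwa [mem_preimage, h4]⟩
    · rintro ⟨m, hm, rfl⟩
      have h4 : (n : G)⁻¹ * m ∈ B ∩ r ⁻¹' U := hm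
      have h5 := key m 1 H.one_mem (by rw [inv_one, mul_one]; exact h4.1)
      rw [inv_one, mul_one] at h5
      exact ⟨_, h4.2, h5.2.symm⟩
  obtain ⟨χ, hχt, hχs, hχ1, hχ2⟩ := exists_openPartialHomeomorph_of_injOn hV hcont hinj' hopen
  refine ⟨⟨χ, ?_, s, ?_, ?_, ?_⟩⟩
  · rw [hχs]
    have hs0 : s 0 = n := Subtype.ext (by simp [hs, hσ0])
    exact ⟨0, h0V, congrArg π hs0⟩
  · exact ((contMDiff_mul_left (I := 𝓘(ℝ, E)) (a := (n : G))).comp hσ).contMDiffOn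
  · intro x hx
    rw [hχt] at hx
    exact (hχ1 x hx).symm
  · intro m hm
    rw [hχs] at hm
    obtain ⟨x, hx, hxm⟩ := hm
    have hh : (s x : G)⁻¹ * m ∈ H := (hπeq _ _).1 hxm
    set h : G := (s x : G)⁻¹ * m with hhdef
    -- A representative `m` of a coset in the chart need not be near the section. Write `m = s(x) h`
    -- with `h` in `H`; right translation by `h⁻¹` brings it there without changing its coset.
    set τ : G → G := fun g => (n : G)⁻¹ * g * h⁻¹ with hτ
    have hτs : ContMDiff 𝓘(ℝ, E) 𝓘(ℝ, E) ∞ τ :=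
      (contMDiff_const.mul contMDiff_id).mul contMDiff_const
    refine ⟨τ ⁻¹' B, r ∘ τ, hB.preimage hτs.continuous, ?_,
      hr.comp hτs.contMDiffOn (fun g hg => hg), ?_⟩
    · have : τ m = σ x := by
        simp [hτ, hhdef, hs, mul_assoc]
      rw [mem_preimage, this]
      exact (hVB x hx).1
    · intro m' hm'
      obtain ⟨h1, h2⟩ := key m' h hh hm'
      refine ⟨?_, ?_⟩
      · rw [hχs, h2]
        exact ⟨_, h1, rfl⟩
      · rw [h2]
        exact (hχ2 _ h1).symm

end ClosedSubgroups

/-! ### The quotient group is a Lie group -/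

section QuotientLieGroup

variable {E F G : Type*} [NormedAddCommGroup E] [NormedSpace ℝ E]
  [NormedAddCommGroup F] [NormedSpace ℝ F] [Group G] [TopologicalSpace G] [ChartedSpace E G]
  [LieGroup 𝓘(ℝ, E) ∞ G] {H N : Subgroup G}

/-- The quotient of a subgroup of a Lie group by a normal subgroup is a Lie group if it is a
smooth subquotient. -/
theorem IsSmoothSpan.lieGroup [(H.subgroupOf N).Normal] [ChartedSpace F (↥N ⧸ H.subgroupOf N)]
    [IsManifold 𝓘(ℝ, F) ∞ (↥N ⧸ H.subgroupOf N)]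
    (h : IsSmoothSpan E F (Subtype.val : ↥N → G)
      (QuotientGroup.mk : ↥N → ↥N ⧸ H.subgroupOf N)) :
    LieGroup 𝓘(ℝ, F) ∞ (↥N ⧸ H.subgroupOf N) where
  contMDiff_mul := by
    rintro ⟨q₁, q₂⟩
    -- Lift both factors by local sections, multiply in `G`, and project: a smooth lift shows that
    -- the product is smooth.
    obtain ⟨V₁, σ₁, hV₁, hq₁, hσ₁, hπ₁⟩ := h.exists_sec q₁
    obtain ⟨V₂, σ₂, hV₂, hq₂, hσ₂, hπ₂⟩ := h.exists_sec q₂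
    have h1 : ContMDiffAt (𝓘(ℝ, F).prod 𝓘(ℝ, F)) 𝓘(ℝ, E) ∞
        (fun q : (↥N ⧸ H.subgroupOf N) × (↥N ⧸ H.subgroupOf N) => ((σ₁ q.1 : G) * (σ₂ q.2 : G)))
        (q₁, q₂) :=
      (ContMDiffAt.comp (g := fun q => (σ₁ q : G)) (q₁, q₂)
        (hσ₁.contMDiffAt (hV₁.mem_nhds hq₁)) contMDiffAt_fst).mul
        (ContMDiffAt.comp (g := fun q => (σ₂ q : G)) (q₁, q₂)
          (hσ₂.contMDiffAt (hV₂.mem_nhds hq₂)) contMDiffAt_snd)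
    have h2 := h.contMDiffWithinAt (s := univ)
      (g := fun q : (↥N ⧸ H.subgroupOf N) × (↥N ⧸ H.subgroupOf N) => σ₁ q.1 * σ₂ q.2) h1
    refine ContMDiffAt.congr_of_eventuallyEq h2 ?_
    filter_upwards [(hV₁.prod hV₂).mem_nhds (mk_mem_prod hq₁ hq₂)] with q hq
    rw [Function.comp_apply, QuotientGroup.mk_mul, hπ₁ _ hq.1, hπ₂ _ hq.2]
  contMDiff_inv := by
    intro q
    obtain ⟨V, σ, hV, hq, hσ, hπ⟩ := h.exists_sec q
    have h2 := h.contMDiffWithinAt (s := univ) (g := fun q => (σ q)⁻¹)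
      (ContMDiffAt.inv (hσ.contMDiffAt (hV.mem_nhds hq)))
    refine ContMDiffAt.congr_of_eventuallyEq h2 ?_
    filter_upwards [hV.mem_nhds hq] with q hq
    rw [Function.comp_apply, QuotientGroup.mk_inv, hπ _ hq]

end QuotientLieGroup

/-! ### Smooth functions on a subquotient -/

section Functions

variable {E F M S Q : Type*} [NormedAddCommGroup E] [NormedSpace ℝ E] [FiniteDimensional ℝ E]
  [TopologicalSpace M] [ChartedSpace E M] [NormedAddCommGroup F] [NormedSpace ℝ F]
  [TopologicalSpace Q] [ChartedSpace F Q] [TopologicalSpace S]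

/-- The smooth functions of a smooth subquotient are those that are locally restrictions of
globally defined smooth functions. -/
theorem IsSmoothSpan.contMDiff_iff_exists_ext [T2Space M] [IsManifold 𝓘(ℝ, E) ∞ M]
    {ι : S → M} {π : S → Q} (hι : IsInducing ι)
    (h : IsSmoothSpan E F ι π) (f : Q → ℝ) : ContMDiff 𝓘(ℝ, F) 𝓘(ℝ, ℝ) ∞ f ↔
      ∀ s : S, ∃ f' : M → ℝ, ContMDiff 𝓘(ℝ, E) 𝓘(ℝ, ℝ) ∞ f' ∧
        ∀ᶠ s' in 𝓝 s, f (π s') = f' (ι s') := by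
  constructor
  · intro hf s
    obtain ⟨U, R, hU, hsU, hR, hext⟩ := h.exists_ext s
    -- A bump function cuts the local extension off to a global one, leaving it unchanged near `s`.
    obtain ⟨φ, hφ, -⟩ := (SmoothBumpFunction.nhds_basis_support (I := 𝓘(ℝ, E))
      (hU.mem_nhds hsU)).mem_iff.1 (hU.mem_nhds hsU)
    refine ⟨fun x => φ x • f (R x), contMDiff_of_tsupport fun x hx => ?_, ?_⟩
    · have hxU : x ∈ U := hφ (tsupport_smul_subset_left _ _ hx)
      exact φ.contMDiffAt.smul (hf.contMDiffAt.comp x (hR.contMDiffAt (hU.mem_nhds hxU)))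
    · filter_upwards [hι.continuous.continuousAt.eventually φ.eventuallyEq_one,
        hι.continuous.continuousAt.preimage_mem_nhds (hU.mem_nhds hsU)] with s' h1 h2
      rw [h1, hext s' h2, Pi.one_apply, one_smul]
  · intro hf
    refine h.contMDiff_of_ext fun s => ?_
    obtain ⟨f', hf', he⟩ := hf s
    rw [hι.nhds_eq_comap, eventually_comap] at he
    obtain ⟨U, hUe, hU, hsU⟩ := eventually_nhds_iff.1 he
    exact ⟨U, f', hU, hsU, hf'.contMDiffOn, fun s' hs' => hUe _ hs' s' rfl⟩

end Functions

/-! ### Embedded submanifolds and their dimension -/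

section SliceCharts

variable {E P : Type*} [NormedAddCommGroup E] [NormedSpace ℝ E]
  [TopologicalSpace P] [ChartedSpace E P] {S : Set P} {p q : P} {d d' : ℕ}

/-- A slice chart at `p` is a slice chart at the points of `S` in its domain. -/
theorem HasSliceChart.eventually (h : HasSliceChart E S p d) :
    ∀ᶠ q in 𝓝 p, q ∈ S → HasSliceChart E S q d := by
  obtain ⟨φ, hpφ, h1, h2, F, hF, h3⟩ := h
  filter_upwards [φ.open_source.mem_nhds hpφ] with q hq hqS
  refine ⟨φ, hq, h1, h2, F, hF, fun q' hq' => ?_⟩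
  have h4 := (h3 q hq).1 hqS
  rw [h3 q' hq', ← F.sub_mem_iff_left h4]
  abel_nf

variable [FiniteDimensional ℝ E]

/-- The derivative of the change of coordinates is invertible and maps the direction `F` of `S` in
one chart into its direction `F'` in the other. -/
theorem HasSliceChart.le (h : HasSliceChart E S p d) (h' : HasSliceChart E S p d') :
    d ≤ d' := by
  obtain ⟨φ, hpφ, h1, h2, F, hF, h3⟩ := h
  obtain ⟨ψ, hpψ, k1, k2, F', hF', k3⟩ := h'
  have hφp := φ.map_source hpφ
  have hψp := ψ.map_source hpψ
  have hc1 : ContDiffAt ℝ ∞ (ψ ∘ φ.symm) (φ p) := by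
    refine contMDiffAt_iff_contDiffAt.1 (ContMDiffAt.comp (I' := 𝓘(ℝ, E)) (φ p) ?_
      (h2.contMDiffAt (φ.open_target.mem_nhds hφp)))
    rw [φ.left_inv hpφ]
    exact k1.contMDiffAt (ψ.open_source.mem_nhds hpψ)
  have hc2 : ContDiffAt ℝ ∞ (φ ∘ ψ.symm) (ψ p) := by
    refine contMDiffAt_iff_contDiffAt.1 (ContMDiffAt.comp (I' := 𝓘(ℝ, E)) (ψ p) ?_
      (k2.contMDiffAt (ψ.open_target.mem_nhds hψp)))
    rw [ψ.left_inv hpψ]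
    exact h1.contMDiffAt (φ.open_source.mem_nhds hpφ)
  have hd1 := (hc1.differentiableAt (by simp)).hasFDerivAt
  have hd2 := (hc2.differentiableAt (by simp)).hasFDerivAt
  set D := fderiv ℝ (ψ ∘ φ.symm) (φ p) with hD
  set D' := fderiv ℝ (φ ∘ ψ.symm) (ψ p) with hD'
  have hnear : ∀ᶠ x in 𝓝 (φ p), x ∈ φ.target ∧ φ.symm x ∈ ψ.source := by
    refine Filter.Eventually.and (φ.open_target.mem_nhds hφp) ?_
    refine (φ.continuousAt_symm hφp).preimage_mem_nhds ?_
    rw [φ.left_inv hpφ]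
    exact ψ.open_source.mem_nhds hpψ
  have hinv : D'.comp D = ContinuousLinearMap.id ℝ E := by
    have hpsi : (ψ ∘ φ.symm) (φ p) = ψ p := by simp [φ.left_inv hpφ]
    have h4 : HasFDerivAt ((φ ∘ ψ.symm) ∘ (ψ ∘ φ.symm)) (D'.comp D) (φ p) :=
      HasFDerivAt.comp (φ p) (by rw [hpsi]; exact hd2) hd1
    refine h4.unique ((hasFDerivAt_id (φ p)).congr_of_eventuallyEq ?_)
    filter_upwards [hnear] with x hx
    simp [ψ.left_inv hx.2, φ.right_inv hx.1]
  have hDF : ∀ v ∈ F, D v ∈ F' := by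
    intro v hv
    have hl : HasDerivAt (fun t : ℝ => φ p + t • v) v 0 := by
      simpa using ((hasDerivAt_id (0 : ℝ)).smul_const v).const_add (φ p)
    have hl0 : φ p + (0 : ℝ) • v = φ p := by simp
    have h5 : HasDerivAt (fun t : ℝ => (ψ ∘ φ.symm) (φ p + t • v)) (D v) 0 :=
      HasFDerivAt.comp_hasDerivAt (0 : ℝ) (by rw [hl0]; exact hd1) hl
    have h6 := hasDerivAt_iff_tendsto_slope.1 h5
    -- The points `φ p + t v` represent points of `S`, so the difference quotients lie in `F'`,
    -- which is closed.
    refine (Submodule.closed_of_finiteDimensional F').mem_of_tendsto h6 ?_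
    have h7 : Tendsto (fun t : ℝ => φ p + t • v) (𝓝[≠] 0) (𝓝 (φ p)) := by
      rw [← hl0]
      exact hl.continuousAt.tendsto.mono_left nhdsWithin_le_nhds |>.congr (by simp)
    filter_upwards [h7.eventually hnear] with t ht
    have h8 : φ.symm (φ p + t • v) ∈ S := by
      rw [h3 _ (φ.map_target ht.1), φ.right_inv ht.1, add_sub_cancel_left]
      exact F.smul_mem _ hv
    have h9 := (k3 _ ht.2).1 h8
    rw [slope_def_module]
    refine F'.smul_mem _ ?_
    simpa [φ.left_inv hpφ] using h9
  have hinj : Function.Injective D :=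
    Function.LeftInverse.injective (g := D') fun v => DFunLike.congr_fun hinv v
  rw [← hF, ← hF']
  refine LinearMap.finrank_le_finrank_of_injective (f := (D : E →ₗ[ℝ] E).restrict hDF) ?_
  intro v w hvw
  exact Subtype.ext (hinj (congrArg Subtype.val hvw))

theorem HasSliceChart.unique (h : HasSliceChart E S p d) (h' : HasSliceChart E S p d') :
    d = d' :=
  le_antisymm (h.le h') (h'.le h)

/-- Coordinates centred at `p` in which `S` is the coordinate plane of the first factor. -/
theorem HasSliceChart.exists_adapted (h : HasSliceChart E S p d) :
    ∃ (ψ : OpenPartialHomeomorph P E) (L : (EuclideanSpace ℝ (Fin d) ×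
      EuclideanSpace ℝ (Fin (Module.finrank ℝ E - d))) ≃L[ℝ] E), p ∈ ψ.source ∧
      ContMDiffOn 𝓘(ℝ, E) 𝓘(ℝ, E) ∞ ψ ψ.source ∧
      ContMDiffOn 𝓘(ℝ, E) 𝓘(ℝ, E) ∞ ψ.symm ψ.target ∧ ψ p = 0 ∧
      ∀ q ∈ ψ.source, (q ∈ S ∧ HasSliceChart E S q d) ↔ (L.symm (ψ q)).2 = 0 := by
  obtain ⟨φ, hpφ, h1, h2, F, hF, h3⟩ := h
  obtain ⟨F', hF'⟩ := Submodule.exists_isCompl F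
  have hdim := Submodule.finrank_add_eq_of_isCompl hF'
  obtain ⟨e₁⟩ : Nonempty (EuclideanSpace ℝ (Fin d) ≃L[ℝ] F) :=
    FiniteDimensional.nonempty_continuousLinearEquiv_of_finrank_eq (by simp [hF])
  obtain ⟨e₂⟩ : Nonempty (EuclideanSpace ℝ (Fin (Module.finrank ℝ E - d)) ≃L[ℝ] F') :=
    FiniteDimensional.nonempty_continuousLinearEquiv_of_finrank_eq (by simp; omega)
  set L := (e₁.prodCongr e₂).trans
    (F.prodEquivOfIsCompl F' hF').toContinuousLinearEquiv with hL
  refine ⟨φ.transHomeomorph (Homeomorph.addRight (-φ p)), L, hpφ, ?_, ?_, by simp, ?_⟩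
  · exact ContMDiff.comp_contMDiffOn (I' := 𝓘(ℝ, E)) (g := fun x : E => x + -φ p)
      (contDiff_id.add contDiff_const).contMDiff h1
  · exact ContMDiffOn.comp (I' := 𝓘(ℝ, E)) (f := fun x : E => x + - -φ p) h2
      (contDiff_id.add contDiff_const).contMDiff.contMDiffOn
      (fun x hx => hx)
  · intro q hq
    -- The same chart re-centred at `q` is a slice chart there, so within one chart the dimension
    -- condition is automatic.
    have h4 : q ∈ S ∧ HasSliceChart E S q d ↔ q ∈ S := by
      refine ⟨fun h => h.1, fun hqS => ⟨hqS, φ, hq, h1, h2, F, hF, fun q' hq' => ?_⟩⟩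
      rw [h3 q' hq', ← F.sub_mem_iff_left ((h3 q hq).1 hqS)]
      abel_nf
    rw [h4, h3 q hq]
    have : L.symm = ((F.prodEquivOfIsCompl F' hF').toContinuousLinearEquiv).symm.trans (e₁.prodCongr e₂).symm := rfl
    rw [this]
    change _ ↔ e₂.symm ((F.prodEquivOfIsCompl F' hF').symm (φ q + -φ p)).2 = 0
    rw [map_eq_zero_iff _ e₂.symm.injective, ← sub_eq_add_neg]
    exact Submodule.prodEquivOfIsCompl_symm_apply_snd_eq_zero .. |>.symm


variable {W : Type*} [TopologicalSpace W] {ι : W → P}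

/-- The part of `S` of dimension `d` has charts given by adapted coordinates. -/
theorem exists_spanChart_slice (hι : IsEmbedding ι)
    (hr : ∀ p, p ∈ range ι ↔ p ∈ S ∧ HasSliceChart E S p d) (w : W) :
    ∃ (c : SpanChart E (EuclideanSpace ℝ (Fin d)) ι id w) (ψ : OpenPartialHomeomorph P E)
      (L : (EuclideanSpace ℝ (Fin d) ×
        EuclideanSpace ℝ (Fin (Module.finrank ℝ E - d))) ≃L[ℝ] E), ι w ∈ ψ.source ∧
      ContMDiffOn 𝓘(ℝ, E) 𝓘(ℝ, E) ∞ ψ ψ.source ∧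
      ContMDiffOn 𝓘(ℝ, E) 𝓘(ℝ, E) ∞ ψ.symm ψ.target ∧ 
      ∀ x ∈ c.chart.target, ι (c.chart.symm x) ∈ ψ.source ∧ ψ (ι (c.chart.symm x)) = L (x, 0) := by
  obtain ⟨hS, hw⟩ := (hr _).1 ⟨w, rfl⟩
  obtain ⟨ψ, L, hpψ, hs₁, hs₂, -, hψS⟩ := hw.exists_adapted
  have hran : ∀ q ∈ ψ.source, q ∈ range ι ↔ (L.symm (ψ q)).2 = 0 := fun q hq => by
    rw [hr, hψS q hq]
  have : Nonempty W := ⟨w⟩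
  set s : EuclideanSpace ℝ (Fin d) → P := fun x => ψ.symm (L (x, 0)) with hs
  set V : Set (EuclideanSpace ℝ (Fin d)) := (fun x => L (x, 0)) ⁻¹' ψ.target with hV
  have hLc : Continuous fun x : EuclideanSpace ℝ (Fin d) =>
      L (x, (0 : EuclideanSpace ℝ (Fin (Module.finrank ℝ E - d)))) :=
    L.continuous.comp (continuous_id.prodMk continuous_const)
  have hVo : IsOpen V := ψ.open_target.preimage hLc
  have hsr : ∀ x ∈ V, ι (Function.invFun ι (s x)) = s x := by
    intro x hx
    refine Function.invFun_eq ((hran _ (ψ.map_target hx)).2 ?_)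
    simp [ψ.right_inv hx]
  have hLr : ∀ w', ι w' ∈ ψ.source → L ((L.symm (ψ (ι w'))).1, 0) = ψ (ι w') := by
    intro w' hw'
    rw [← (hran _ hw').1 ⟨w', rfl⟩]
    simp
  have hsc : ContinuousOn s V := ψ.symm.continuousOn.comp hLc.continuousOn fun x hx => hx
  let χ : OpenPartialHomeomorph W (EuclideanSpace ℝ (Fin d)) :=
    { toFun := fun w' => (L.symm (ψ (ι w'))).1
      invFun := fun x => Function.invFun ι (s x)
      source := ι ⁻¹' ψ.source
      target := V
      map_source' := fun w' hw' => by
        change L _ ∈ ψ.target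
        rw [hLr w' hw']
        exact ψ.map_source hw'
      map_target' := fun x hx => by
        change ι _ ∈ ψ.source
        rw [hsr x hx]
        exact ψ.map_target hx
      left_inv' := fun w' hw' => by
        refine hι.injective ?_
        rw [hsr _ (show L _ ∈ ψ.target by rw [hLr w' hw']; exact ψ.map_source hw')]
        simp only [hs]
        rw [hLr w' hw', ψ.left_inv hw']
      right_inv' := fun x hx => by
        rw [hsr x hx, hs, ψ.right_inv hx, L.symm_apply_apply]
      open_source := ψ.open_source.preimage hι.continuous
      open_target := hVo
      continuousOn_toFun := continuous_fst.comp_continuousOn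
        (L.symm.continuous.comp_continuousOn
          (ψ.continuousOn.comp hι.continuous.continuousOn fun w' hw' => hw'))
      continuousOn_invFun := by
        rw [hι.continuousOn_iff]
        exact hsc.congr hsr }
  refine ⟨⟨χ, hpψ, fun x => Function.invFun ι (s x), ?_, fun x _ => rfl, ?_⟩, ψ, L, hpψ, hs₁, hs₂,
    fun x hx => ?_⟩
  · refine ContMDiffOn.congr ?_ hsr
    refine ContMDiffOn.comp (I' := 𝓘(ℝ, E)) (f := fun x : EuclideanSpace ℝ (Fin d) =>
      L (x, (0 : EuclideanSpace ℝ (Fin (Module.finrank ℝ E - d))))) hs₂ ?_ (fun x hx => hx)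
    exact ((L.contDiff.comp (contDiff_id.prodMk contDiff_const)).contMDiff).contMDiffOn
  · intro w' hw'
    refine ⟨ψ.source, fun q => (L.symm (ψ q)).1, ψ.open_source, hw', ?_, fun w'' h => ⟨h, rfl⟩⟩
    exact ContMDiff.comp_contMDiffOn (I' := 𝓘(ℝ, E)) (g := fun x : E => (L.symm x).1)
      (contDiff_fst.comp L.symm.contDiff).contMDiff hs₁
  · change ι (Function.invFun ι (s x)) ∈ ψ.source ∧ ψ (ι (Function.invFun ι (s x))) = L (x, 0)
    rw [hsr x hx]
    exact ⟨ψ.map_target hx, ψ.right_inv hx⟩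

/-- The part of an embedded submanifold of dimension `d` is a smoothly embedded manifold. -/
theorem exists_spanChart_isSmoothEmbedding [IsManifold 𝓘(ℝ, E) ∞ P] (hι : IsEmbedding ι)
    (hr : ∀ p, p ∈ range ι ↔ p ∈ S ∧ HasSliceChart E S p d) :
    ∃ h : ∀ w : W, SpanChart E (EuclideanSpace ℝ (Fin d)) ι id w,
      letI := SpanChart.chartedSpace h
      Manifold.IsSmoothEmbedding (𝓡 d) 𝓘(ℝ, E) ∞ ι := by
  choose h ψ L hw h₁ h₂ h₃ using exists_spanChart_slice hι hr
  refine ⟨h, ?_⟩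
  let _ := SpanChart.chartedSpace h
  have := SpanChart.isManifold h
  refine ⟨Manifold.IsImmersionOfComplement.isImmersion
    (F := EuclideanSpace ℝ (Fin (Module.finrank ℝ E - d))) fun w => ?_, hι⟩
  refine Manifold.IsImmersionAtOfComplement.mk_of_continuousAt hι.continuous.continuousAt (L w)
    (chartAt _ w) (ψ w) (mem_chart_source _ w) (hw w) (IsManifold.chart_mem_maximalAtlas w)
    ((ψ w).mem_maximalAtlas_of_contMDiffOn (h₁ w) (h₂ w)) ?_
  intro x hx
  rw [OpenPartialHomeomorph.extend_target] at hx
  exact (h₃ w x hx.1).2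

end SliceCharts

/-! ### Centred parametrizations -/

section CenteredParam

variable {E M : Type*} [NormedAddCommGroup E] [NormedSpace ℝ E]
  [TopologicalSpace M] [ChartedSpace E M] [IsManifold 𝓘(ℝ, E) ∞ M]

/-- The inverse of the preferred chart at `w`, centred. -/
theorem exists_centered_param (w : M) :
    ∃ s : OpenPartialHomeomorph E M, 0 ∈ s.source ∧ s 0 = w ∧
      ContMDiffOn 𝓘(ℝ, E) 𝓘(ℝ, E) ∞ s s.source ∧
      HasMFDerivAt 𝓘(ℝ, E) 𝓘(ℝ, E) s 0 (ContinuousLinearMap.id ℝ E) := by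
  set c := chartAt E w with hc
  have hw : w ∈ c.source := mem_chart_source E w
  set s := (Homeomorph.addLeft (c w)).transOpenPartialHomeomorph c.symm with hs
  have h0 : (0 : E) ∈ s.source := by
    change c w + 0 ∈ c.target
    rw [add_zero]
    exact c.map_source hw
  have hs0 : s 0 = w := by
    change c.symm (c w + 0) = w
    rw [add_zero, c.left_inv hw]
  have hsm : ContMDiffOn 𝓘(ℝ, E) 𝓘(ℝ, E) ∞ s s.source :=
    ContMDiffOn.comp (I' := 𝓘(ℝ, E)) (f := fun x : E => c w + x)
      (contMDiffOn_chart_symm (I := 𝓘(ℝ, E)) (x := w))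
      (contDiff_const.add contDiff_id).contMDiff.contMDiffOn (fun x hx => hx)
  refine ⟨s, h0, hs0, hsm, (hsm.contMDiffAt (s.open_source.mem_nhds h0)).continuousAt, ?_⟩
  have h1 : HasFDerivAt (fun x : E => c w + x) (ContinuousLinearMap.id ℝ E) 0 :=
    (hasFDerivAt_id (0 : E)).const_add (c w)
  -- The derivative at `0` reads the target in the preferred chart `c` at `w`, in which `s` is the
  -- translation by `c w`.
  have h2 : HasFDerivAt (c ∘ s) (ContinuousLinearMap.id ℝ E) 0 := by
    refine h1.congr_of_eventuallyEq ?_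
    filter_upwards [s.open_source.mem_nhds h0] with x hx
    exact c.right_inv hx
  have h3 : HasFDerivWithinAt (c ∘ s) (ContinuousLinearMap.id ℝ E) (range 𝓘(ℝ, E)) 0 :=
    h2.hasFDerivWithinAt
  have h4 : writtenInExtChartAt 𝓘(ℝ, E) 𝓘(ℝ, E) (0 : E) s = c ∘ s := by
    simp [writtenInExtChartAt, mfld_simps, chartAt_self_eq, hs0, ← hc]
  have h5 : extChartAt 𝓘(ℝ, E) (0 : E) 0 = 0 := by simp [chartAt_self_eq]
  rw [h4, h5]
  exact h3

end CenteredParam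

/-- For a free and proper action, an element that moves a point near `w` to a point near `w` is
near the identity. -/
theorem exists_isOpen_of_smul_mem {K W : Type*} [Group K] [TopologicalSpace K] [TopologicalSpace W]
    [MulAction K W] [ProperSMul K W] (hfree : ∀ (a : K) (w : W), a • w = w → a = 1)
    (w : W) {A : Set K} (hA : A ∈ 𝓝 1) :
    ∃ Z : Set W, IsOpen Z ∧ w ∈ Z ∧ ∀ z ∈ Z, ∀ a : K, a • z ∈ Z → a ∈ A := by
  have hp := ProperSMul.isProperMap_smul_pair (G := K) (X := W)
  have hinj : Function.Injective (fun p : K × W => (p.1 • p.2, p.2)) := by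
    rintro ⟨a, x⟩ ⟨b, y⟩ h
    obtain ⟨h1, rfl⟩ := Prod.mk.inj h
    have : (b⁻¹ * a) • x = x := by rw [mul_smul, inv_smul_eq_iff]; exact h1
    rw [inv_mul_eq_one.1 (hfree _ _ this)]
  -- Freeness makes `(a, x) ↦ (a • x, x)` injective and properness makes it closed. It is therefore
  -- an embedding, and closeness of `a` to `1` is visible in `W × W`.
  have hemb := IsClosedEmbedding.of_continuous_injective_isClosedMap hp.continuous hinj
    hp.isClosedMap
  have hn : (Prod.fst ⁻¹' A : Set (K × W)) ∈ 𝓝 ((1 : K), w) :=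
    continuousAt_fst.preimage_mem_nhds hA
  rw [hemb.isInducing.nhds_eq_comap, one_smul, mem_comap] at hn
  obtain ⟨T, hT, hTA⟩ := hn
  rw [nhds_prod_eq, mem_prod_same_iff] at hT
  obtain ⟨Z₀, hZ₀, hZT⟩ := hT
  obtain ⟨Z, hZ, hZo, hwZ⟩ := mem_nhds_iff.1 hZ₀
  exact ⟨Z, hZo, hwZ, fun z hz a ha => hTA (show (a, z) ∈ _ from hZT ⟨hZ ha, hZ hz⟩)⟩

/-! ### Slices for free proper actions -/

section FreeAction

variable {EK EW K W : Type*} [NormedAddCommGroup EK] [NormedSpace ℝ EK]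
  [NormedAddCommGroup EW] [NormedSpace ℝ EW]
  [Group K] [TopologicalSpace K] [ChartedSpace EK K]
  [TopologicalSpace W] [ChartedSpace EW W] [MulAction K W]

theorem contMDiff_const_smul' [ContMDiffSMul 𝓘(ℝ, EK) 𝓘(ℝ, EW) ∞ K W] (a : K) :
    ContMDiff 𝓘(ℝ, EW) 𝓘(ℝ, EW) ∞ (fun w : W => a • w) :=
  (ContMDiffSMul.contMDiff_smul (I := 𝓘(ℝ, EK)) (I' := 𝓘(ℝ, EW)) (n := ∞) (G := K)
    (M := W)).comp (contMDiff_const.prodMk contMDiff_id)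

theorem contMDiff_smul_const' [ContMDiffSMul 𝓘(ℝ, EK) 𝓘(ℝ, EW) ∞ K W] (w : W) :
    ContMDiff 𝓘(ℝ, EK) 𝓘(ℝ, EW) ∞ (fun a : K => a • w) :=
  (ContMDiffSMul.contMDiff_smul (I := 𝓘(ℝ, EK)) (I' := 𝓘(ℝ, EW)) (n := ∞) (G := K)
    (M := W)).comp (contMDiff_id.prodMk contMDiff_const)

variable [ContMDiffSMul 𝓘(ℝ, EK) 𝓘(ℝ, EW) ∞ K W]

/-- The derivative of the action at a point in terms of the orbit map and the translation. -/
theorem hasMFDerivWithinAt_smul {V HV Y : Type*} [NormedAddCommGroup V] [NormedSpace ℝ V]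
    [TopologicalSpace HV] {I : ModelWithCorners ℝ V HV} [TopologicalSpace Y] [ChartedSpace HV Y]
    {f : Y → K} {g : Y → W} {s : Set Y} {x : Y} {f' : V →L[ℝ] EK} {g' : V →L[ℝ] EW}
    (hf : HasMFDerivWithinAt I 𝓘(ℝ, EK) f s x f') (hg : HasMFDerivWithinAt I 𝓘(ℝ, EW) g s x g') :
    HasMFDerivWithinAt I 𝓘(ℝ, EW) (fun y => f y • g y) s x
      ((mfderiv 𝓘(ℝ, EK) 𝓘(ℝ, EW) (fun a : K => a • g x) (f x) : EK →L[ℝ] EW).comp f' +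
        (mfderiv 𝓘(ℝ, EW) 𝓘(ℝ, EW) (fun w : W => f x • w) (g x) : EW →L[ℝ] EW).comp g') := by
  have hm : MDifferentiableAt (𝓘(ℝ, EK).prod 𝓘(ℝ, EW)) 𝓘(ℝ, EW)
      (fun p : K × W => p.1 • p.2) (f x, g x) :=
    (ContMDiffSMul.contMDiff_smul (I := 𝓘(ℝ, EK)) (I' := 𝓘(ℝ, EW)) (n := ∞)).mdifferentiableAt
      (by simp)
  refine (hm.hasMFDerivAt.comp_hasMFDerivWithinAt x (hf.prodMk hg)).congr_mfderiv
    (ContinuousLinearMap.ext fun w => ?_)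
  exact mfderiv_prod_eq_add_apply hm (v := (f' w, g' w))

variable [LieGroup 𝓘(ℝ, EK) ∞ K] [IsManifold 𝓘(ℝ, EW) ∞ W]
  [FiniteDimensional ℝ EK] [T2Space K] [T2Space W] [FiniteDimensional ℝ EW]

/-- The orbit map of a point with trivial isotropy group is an immersion at the identity. -/
theorem injective_mfderiv_smul_const {w : W} (hfree : ∀ a : K, a • w = w → a = 1)
    {D : EK →L[ℝ] EW} (hD : HasMFDerivAt 𝓘(ℝ, EK) 𝓘(ℝ, EW) (fun a : K => a • w) 1 D) :
    Function.Injective D := by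
  rw [injective_iff_map_eq_zero]
  intro v hv
  -- By equivariance, a vector `v` killed at the identity gives an orbit curve with zero velocity at
  -- all times. This is an integral curve of the zero field, hence constant, and freeness makes the
  -- one-parameter subgroup of `v` trivial.
  set Z : (x : W) → TangentSpace 𝓘(ℝ, EW) x := fun _ => 0 with hZ
  have hZs : IsSmoothVectorField Z := Bundle.contMDiff_zeroSection ℝ (TangentSpace 𝓘(ℝ, EW) (M := W))
  have hdo : ∀ a : K, MDifferentiableAt 𝓘(ℝ, EK) 𝓘(ℝ, EW) (fun a : K => a • w) a := fun a =>
    (contMDiff_smul_const' w).mdifferentiableAt (by simp)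
  have h1 : IsMIntegralCurveOn (I := 𝓘(ℝ, EW)) ((fun a : K => a • w) ∘ oneParam K v) Z univ := by
    refine isMIntegralCurveOn_comp_of_related (fun t _ => hdo _) (fun t _ => ?_)
      ((isMIntegralCurve_oneParam (G := K) v).isMIntegralCurveOn univ)
    set a := oneParam K v t
    have e1 : (fun b : K => b • w) ∘ (a * ·) = (fun x : W => a • x) ∘ (fun b : K => b • w) := by
      ext b
      simp [mul_smul]
    have hl : MDifferentiableAt 𝓘(ℝ, EK) 𝓘(ℝ, EK) (a * ·) (1 : K) :=
      (contMDiff_mul_left (I := 𝓘(ℝ, EK)) (n := ∞)).mdifferentiableAt (by simp)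
    have e2 := mfderiv_comp_apply_of_eq (1 : K) (hdo a) hl (mul_one a) v
    have e3 := mfderiv_comp_apply_of_eq (1 : K)
      ((contMDiff_const_smul' (EK := EK) (EW := EW) a).mdifferentiableAt (by simp))
      (hdo 1) (one_smul K w) v
    have e4 := DFunLike.congr_fun (mfderiv_congr (I := 𝓘(ℝ, EK)) (I' := 𝓘(ℝ, EW)) (x := (1 : K)) e1) v
    refine e2.symm.trans (e4.trans (e3.trans ?_))
    have hv' : @Eq EW (mfderiv 𝓘(ℝ, EK) 𝓘(ℝ, EW) (fun a : K => a • w) 1 v) 0 :=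
      (DFunLike.congr_fun hD.mfderiv v).trans hv
    exact (congrArg (mfderiv 𝓘(ℝ, EW) 𝓘(ℝ, EW) (fun x : W => a • x) w : EW → EW) hv').trans
      (map_zero _)
  have h2 : IsMIntegralCurveOn (I := 𝓘(ℝ, EW)) (fun _ : ℝ => w) Z univ := by
    intro t _
    refine (hasMFDerivWithinAt_const w univ t).congr_mfderiv ?_
    exact (ContinuousLinearMap.smulRight_zero (M₁ := ℝ) (M₂ := EW) (1 : ℝ →L[ℝ] ℝ)).symm
  have h3 := hZs.eqOn_of_isMIntegralCurveOn ordConnected_univ h1 h2 (mem_univ 0)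
    (by simp [oneParam_zero])
  have h4 : oneParam K v = fun _ => 1 := funext fun t => hfree _ (h3 (mem_univ t))
  have h5 := hasMFDerivAt_oneParam_zero (G := K) v
  rw [h4] at h5
  have h6 := hasMFDerivAt_unique h5 (hasMFDerivAt_const (1 : K) (0 : ℝ))
  have h7 := DFunLike.congr_fun h6 (1 : ℝ)
  have h8 : (1 : ℝ) • v = 0 := h7
  simpa using h8


/-- A slice through `w` for a free and proper action: near `w` the manifold is a product of the
slice, parametrized by `σ` on `V`, and of a neighbourhood of the identity in the group. -/
structure LocalSlice (EK EW : Type*) (K : Type*) {W : Type*} [NormedAddCommGroup EK]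
    [NormedSpace ℝ EK] [NormedAddCommGroup EW] [NormedSpace ℝ EW] [Group K] [TopologicalSpace K]
    [ChartedSpace EK K] [TopologicalSpace W] [ChartedSpace EW W] [MulAction K W] (m : ℕ) (w : W) where
  V : Set (EuclideanSpace ℝ (Fin m))
  Z : Set W
  σ : EuclideanSpace ℝ (Fin m) → W
  τ : W → K
  r : W → EuclideanSpace ℝ (Fin m)
  isOpen_V : IsOpen V
  isOpen_Z : IsOpen Z
  zero_mem : 0 ∈ V
  mem_Z : w ∈ Z
  σ_zero : σ 0 = w
  contMDiffOn_σ : ContMDiffOn (𝓡 m) 𝓘(ℝ, EW) ∞ σ V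
  contMDiffOn_τ : ContMDiffOn 𝓘(ℝ, EW) 𝓘(ℝ, EK) ∞ τ Z
  contMDiffOn_r : ContMDiffOn 𝓘(ℝ, EW) (𝓡 m) ∞ r Z
  σ_mem : ∀ x ∈ V, σ x ∈ Z
  r_σ : ∀ x ∈ V, r (σ x) = x
  r_mem : ∀ z ∈ Z, r z ∈ V
  eq_smul : ∀ z ∈ Z, z = τ z • σ (r z)
  eq_of_smul_eq : ∀ x ∈ V, ∀ y ∈ V, ∀ a : K, a • σ x = σ y → x = y

/-- The slice is a complement `C` of the orbit direction in a chart. The derivative of `(u, x) ↦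
κ(u) • σ(x)` is then invertible, and properness removes distant group elements that would return the
slice to itself. -/
theorem nonempty_localSlice [ProperSMul K W] (hfree : ∀ (a : K) (w : W), a • w = w → a = 1)
    (w : W) : Nonempty (LocalSlice EK EW K (Module.finrank ℝ EW - Module.finrank ℝ EK) w) := by
  obtain ⟨κ, hκ0, hκ1, hκs, hκ'⟩ := exists_centered_param (E := EK) (1 : K)
  obtain ⟨ζ, hζ0, hζ1, hζs, hζ'⟩ := exists_centered_param (E := EW) w
  obtain ⟨D, hD⟩ : ∃ D : EK →L[ℝ] EW,
      HasMFDerivAt 𝓘(ℝ, EK) 𝓘(ℝ, EW) (fun a : K => a • w) 1 D :=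
    ⟨_, ((contMDiff_smul_const' w).mdifferentiableAt (by simp)).hasMFDerivAt⟩
  have hDi := injective_mfderiv_smul_const (fun a => hfree a w) hD
  set R : Submodule ℝ EW := LinearMap.range (D : EK →ₗ[ℝ] EW) with hR
  obtain ⟨C, hC⟩ := Submodule.exists_isCompl R
  -- The subtraction does not truncate, since `D` is injective.
  set m := Module.finrank ℝ EW - Module.finrank ℝ EK with hm
  have hdim := Submodule.finrank_add_eq_of_isCompl hC
  rw [hR, LinearMap.finrank_range_of_inj hDi] at hdim
  obtain ⟨L⟩ : Nonempty (EuclideanSpace ℝ (Fin m) ≃L[ℝ] C) :=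
    FiniteDimensional.nonempty_continuousLinearEquiv_of_finrank_eq (by simp; omega)
  obtain ⟨L', hL'⟩ : ∃ L' : EuclideanSpace ℝ (Fin m) →L[ℝ] EW, ∀ x, L' x = L x :=
    ⟨C.subtypeL.comp (L : EuclideanSpace ℝ (Fin m) →L[ℝ] C), fun _ => rfl⟩
  set T : EK × EuclideanSpace ℝ (Fin m) →L[ℝ] EW := D.comp (ContinuousLinearMap.fst ..) +
    L'.comp (ContinuousLinearMap.snd ..) with hT
  have hbij : Function.Bijective T := by
    constructor
    · rw [injective_iff_map_eq_zero]
      rintro ⟨u, x⟩ h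
      have h1 : D u + (L x : EW) = 0 := hL' x ▸ h
      have h2 : (L x : EW) ∈ R ⊓ C := by
        refine ⟨?_, (L x).2⟩
        rw [← neg_eq_iff_add_eq_zero.2 h1]
        exact R.neg_mem ⟨u, rfl⟩
      rw [hC.inf_eq_bot, Submodule.mem_bot] at h2
      rw [h2, add_zero] at h1
      have h3 : u = 0 := hDi (h1.trans (map_zero D).symm)
      have h4 : x = 0 := L.injective ((Subtype.ext h2 : L x = 0).trans (map_zero L).symm)
      rw [h3, h4]
      rfl
    · intro v
      have hv : v ∈ R ⊔ C := by rw [hC.sup_eq_top]; trivial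
      obtain ⟨_, ⟨u, rfl⟩, z, hz, rfl⟩ := Submodule.mem_sup.1 hv
      exact ⟨(u, L.symm ⟨z, hz⟩), by simp [hT, hL']⟩
  set T' : (EK × EuclideanSpace ℝ (Fin m)) ≃L[ℝ] EW :=
    (LinearEquiv.ofBijective (T : EK × EuclideanSpace ℝ (Fin m) →ₗ[ℝ] EW)
      hbij).toContinuousLinearEquiv with hT'
  set σ : EuclideanSpace ℝ (Fin m) → W := fun x => ζ (L' x) with hσ
  have hσ0 : σ 0 = w := by simp [hσ, hζ1]
  set O : Set (EuclideanSpace ℝ (Fin m)) := L' ⁻¹' ζ.source with hO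
  have hOo : IsOpen O := ζ.open_source.preimage L'.continuous
  have h0O : 0 ∈ O := by simpa [hO] using hζ0
  have hσs : ContMDiffOn (𝓡 m) 𝓘(ℝ, EW) ∞ σ O :=
    hζs.comp L'.contMDiff.contMDiffOn (fun x hx => hx)
  have hσ' : HasMFDerivAt (𝓡 m) 𝓘(ℝ, EW) σ 0 L' := by
    have h1 : HasMFDerivAt 𝓘(ℝ, EW) 𝓘(ℝ, EW) ζ (L' 0) (ContinuousLinearMap.id ℝ EW) := by
      rw [map_zero]
      exact hζ'
    have h2 : HasMFDerivAt (𝓡 m) 𝓘(ℝ, EW) L' 0 L' := L'.hasFDerivAt.hasMFDerivAt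
    exact HasMFDerivAt.comp (g := ζ) (0 : EuclideanSpace ℝ (Fin m)) h1 h2
  set f : EK × EuclideanSpace ℝ (Fin m) → W := fun p => κ p.1 • σ p.2 with hf
  have hfs : ContMDiffOn 𝓘(ℝ, EK × EuclideanSpace ℝ (Fin m)) 𝓘(ℝ, EW) ∞ f (κ.source ×ˢ O) := by
    have h1 : ContMDiffOn 𝓘(ℝ, EK × EuclideanSpace ℝ (Fin m)) 𝓘(ℝ, EK) ∞
        (fun p : EK × EuclideanSpace ℝ (Fin m) => κ p.1) (κ.source ×ˢ O) :=
      hκs.comp (contDiff_fst.contMDiff.contMDiffOn) (fun p hp => hp.1)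
    have h2 : ContMDiffOn 𝓘(ℝ, EK × EuclideanSpace ℝ (Fin m)) 𝓘(ℝ, EW) ∞
        (fun p : EK × EuclideanSpace ℝ (Fin m) => σ p.2) (κ.source ×ˢ O) :=
      hσs.comp (contDiff_snd.contMDiff.contMDiffOn) (fun p hp => hp.2)
    exact (ContMDiffSMul.contMDiff_smul (I := 𝓘(ℝ, EK)) (I' := 𝓘(ℝ, EW)) (n := ∞) (G := K)
      (M := W)).comp_contMDiffOn (h1.prodMk h2)
  have hf' : HasMFDerivAt 𝓘(ℝ, EK × EuclideanSpace ℝ (Fin m)) 𝓘(ℝ, EW) f (0, 0)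
      (T' : EK × EuclideanSpace ℝ (Fin m) →L[ℝ] EW) := by
    have h1 : HasMFDerivAt 𝓘(ℝ, EK × EuclideanSpace ℝ (Fin m)) 𝓘(ℝ, EK)
        (fun p : EK × EuclideanSpace ℝ (Fin m) => κ p.1) (0, 0)
        (ContinuousLinearMap.fst ℝ EK (EuclideanSpace ℝ (Fin m))) :=
      HasMFDerivAt.comp ((0, 0) : EK × EuclideanSpace ℝ (Fin m)) hκ'
        (ContinuousLinearMap.fst ℝ EK (EuclideanSpace ℝ (Fin m))).hasFDerivAt.hasMFDerivAt
    have h2 : HasMFDerivAt 𝓘(ℝ, EK × EuclideanSpace ℝ (Fin m)) 𝓘(ℝ, EW)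
        (fun p : EK × EuclideanSpace ℝ (Fin m) => σ p.2) (0, 0)
        (L'.comp (ContinuousLinearMap.snd ℝ EK (EuclideanSpace ℝ (Fin m)))) :=
      HasMFDerivAt.comp (g := σ) (f := Prod.snd) ((0, 0) : EK × EuclideanSpace ℝ (Fin m)) hσ'
        (ContinuousLinearMap.snd ℝ EK (EuclideanSpace ℝ (Fin m))).hasFDerivAt.hasMFDerivAt
    have h3 := hasMFDerivWithinAt_univ.1 (hasMFDerivWithinAt_smul (s := univ)
      h1.hasMFDerivWithinAt h2.hasMFDerivWithinAt)
    refine h3.congr_mfderiv (ContinuousLinearMap.ext fun v => ?_)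
    have e1 : mfderiv 𝓘(ℝ, EK) 𝓘(ℝ, EW) (fun a : K => a • σ 0) (κ 0) = D := by
      rw [hσ0, hκ1]
      exact hD.mfderiv
    have e2 : mfderiv 𝓘(ℝ, EW) 𝓘(ℝ, EW) (fun z : W => κ 0 • z) (σ 0) =
        ContinuousLinearMap.id ℝ EW := by
      have : (fun z : W => κ 0 • z) = id := by ext z; simp [hκ1]
      exact (mfderiv_congr this).trans mfderiv_id
    exact congrArg₂ (fun a b : EW => a + b) (DFunLike.congr_fun e1 v.1)
      (DFunLike.congr_fun e2 (L' v.2))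
  obtain ⟨Φ, hΦ0, hΦs, hΦf, hΦi, -⟩ := exists_openPartialHomeomorph_of_hasMFDerivAt
    (κ.open_source.prod hOo) hfs (mk_mem_prod hκ0 h0O) T' hf'
  obtain ⟨A₀, hA₀, B₀, hB₀, hAB⟩ := mem_nhds_prod_iff.1 (Φ.open_source.mem_nhds hΦ0)
  obtain ⟨A, hAA, hA, h0A⟩ := mem_nhds_iff.1 hA₀
  obtain ⟨B, hBB, hB, h0B⟩ := mem_nhds_iff.1 hB₀
  have hABs : A ×ˢ B ⊆ Φ.source := (prod_mono hAA hBB).trans hAB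
  have hAκ : A ⊆ κ.source := fun u hu => (hΦs (hABs (mk_mem_prod hu h0B))).1
  have hBO : B ⊆ O := fun u hu => (hΦs (hABs (mk_mem_prod h0A hu))).2
  have hA1 : κ '' A ∈ 𝓝 (1 : K) :=
    (κ.isOpen_image_of_subset_source hA hAκ).mem_nhds ⟨0, h0A, hκ1⟩
  obtain ⟨Z, hZ, hwZ, hZA⟩ := exists_isOpen_of_smul_mem hfree w hA1
  -- For slice points in `Z`, any group element relating them lies in `κ '' A`. The relation is then
  -- an equality in the product coordinates, where injectivity of `Φ` applies.
  set V := B ∩ (O ∩ σ ⁻¹' Z) with hV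
  have hVo : IsOpen V := hB.inter (hσs.continuousOn.isOpen_inter_preimage hOo hZ)
  have h0V : 0 ∈ V := ⟨h0B, h0O, by rwa [mem_preimage, hσ0]⟩
  have hAVs : A ×ˢ V ⊆ Φ.source := (prod_mono_right inter_subset_left).trans hABs
  have hVΦ : ∀ x ∈ V, Φ (0, x) = σ x := fun x hx => by
    rw [hΦf (hAVs (mk_mem_prod h0A hx))]
    simp [hf, hκ1]
  have hinv : ContMDiffOn 𝓘(ℝ, EW) 𝓘(ℝ, EK × EuclideanSpace ℝ (Fin m)) ∞ Φ.symm
      (Φ '' A ×ˢ V) := hΦi.mono (by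
    rintro _ ⟨p, hp, rfl⟩
    exact Φ.map_source (hAVs hp))
  have hAV : ∀ z ∈ Φ '' A ×ˢ V, Φ.symm z ∈ A ×ˢ V := by
    rintro _ ⟨p, hp, rfl⟩
    rwa [Φ.left_inv (hAVs hp)]
  refine ⟨⟨V, Φ '' A ×ˢ V, σ, fun z => κ (Φ.symm z).1, fun z => (Φ.symm z).2, hVo,
    Φ.isOpen_image_of_subset_source (hA.prod hVo) hAVs, h0V,
    ⟨(0, 0), mk_mem_prod h0A h0V, by rw [hVΦ 0 h0V, hσ0]⟩, hσ0,
    hσs.mono fun x hx => hx.2.1, ?_, ?_, ?_, ?_, ?_, ?_, ?_⟩⟩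
  · exact hκs.comp (ContMDiff.comp_contMDiffOn (contDiff_fst.contMDiff) hinv)
      (fun z hz => hAκ (hAV z hz).1)
  · exact ContMDiff.comp_contMDiffOn (contDiff_snd.contMDiff) hinv
  · exact fun x hx => ⟨(0, x), mk_mem_prod h0A hx, hVΦ x hx⟩
  · intro x hx
    rw [← hVΦ x hx, Φ.left_inv (hAVs (mk_mem_prod h0A hx))]
  · exact fun z hz => (hAV z hz).2
  · rintro _ ⟨p, hp, rfl⟩
    rw [Φ.left_inv (hAVs hp), hΦf (hAVs hp)]
  · intro x hx y hy a ha
    obtain ⟨u, hu, rfl⟩ := hZA (σ x) hx.2.2 a (by rw [ha]; exact hy.2.2)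
    have h1 : Φ (u, x) = Φ (0, y) := by
      rw [hVΦ y hy, hΦf (hAVs (mk_mem_prod hu hx)), ← ha]
    exact congrArg Prod.snd (Φ.injOn (hAVs (mk_mem_prod hu hx)) (hAVs (mk_mem_prod h0A hy)) h1)

end FreeAction

theorem orbitMk_eq_iff {K W : Type*} [Group K] [MulAction K W] {w w' : W} :
    (Quotient.mk (MulAction.orbitRel K W) w) = Quotient.mk (MulAction.orbitRel K W) w' ↔
      ∃ a : K, a • w' = w := by
  rw [Quotient.eq]
  exact MulAction.orbitRel_apply

/-! ### Orbit spaces and principal bundles -/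

section FreeProperAction

variable {EK EW K W : Type*} [NormedAddCommGroup EK] [NormedSpace ℝ EK]
  [NormedAddCommGroup EW] [NormedSpace ℝ EW]
  [Group K] [TopologicalSpace K] [ChartedSpace EK K]
  [TopologicalSpace W] [ChartedSpace EW W] [MulAction K W]
  [ContMDiffSMul 𝓘(ℝ, EK) 𝓘(ℝ, EW) ∞ K W] {m : ℕ}

/-- The group element relating two points of the same orbit depends smoothly on them. -/
theorem LocalSlice.contMDiffWithinAt_of_eq_smul [LieGroup 𝓘(ℝ, EK) ∞ K]
    (hfree : ∀ (a : K) (w : W), a • w = w → a = 1) (hs : ∀ w : W, LocalSlice EK EW K m w)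
    {V HV Y : Type*} [NormedAddCommGroup V] [NormedSpace ℝ V]
    [TopologicalSpace HV] {I : ModelWithCorners ℝ V HV} [TopologicalSpace Y] [ChartedSpace HV Y]
    {s : Set Y} {y : Y} (hy : y ∈ s) {f g : Y → W} {h : Y → K} (hfg : ∀ x ∈ s, f x = h x • g x)
    (hf : ContMDiffWithinAt I 𝓘(ℝ, EW) ∞ f s y) (hg : ContMDiffWithinAt I 𝓘(ℝ, EW) ∞ g s y) :
    ContMDiffWithinAt I 𝓘(ℝ, EK) ∞ h s y := by
  -- Translating `f` by `a⁻¹` brings it near `g y`, into one slice neighbourhood. There the group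
  -- coordinate `τ` determines the relating element as `a τ(f₁) τ(g)⁻¹`.
  set a := h y with ha
  set l := hs (g y) with hl
  set f₁ : Y → W := fun x => a⁻¹ • f x with hf₁
  have hf₁s : ContMDiffWithinAt I 𝓘(ℝ, EW) ∞ f₁ s y :=
    ((contMDiff_const_smul' (EK := EK) a⁻¹).contMDiffAt).comp_contMDiffWithinAt y hf
  have hf₁y : f₁ y = g y := by rw [hf₁]; simp only; rw [hfg y hy, ← ha, inv_smul_smul]
  have hτf : ContMDiffWithinAt I 𝓘(ℝ, EK) ∞ (l.τ ∘ f₁) s y := by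
    refine ContMDiffAt.comp_contMDiffWithinAt y (l.contMDiffOn_τ.contMDiffAt ?_) hf₁s
    rw [hf₁y]
    exact l.isOpen_Z.mem_nhds l.mem_Z
  have hτg : ContMDiffWithinAt I 𝓘(ℝ, EK) ∞ (l.τ ∘ g) s y :=
    ContMDiffAt.comp_contMDiffWithinAt y
      (l.contMDiffOn_τ.contMDiffAt (l.isOpen_Z.mem_nhds l.mem_Z)) hg
  have key : ∀ x ∈ s, f₁ x ∈ l.Z → g x ∈ l.Z → h x = a * (l.τ (f₁ x) * (l.τ (g x))⁻¹) := by
    intro x hx h1 h2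
    have h3 : f₁ x = (a⁻¹ * h x) • g x := by rw [hf₁]; simp only; rw [hfg x hx, mul_smul]
    have h4 := l.eq_smul _ h1
    have h5 := l.eq_smul _ h2
    have h6 : ((l.τ (f₁ x))⁻¹ * (a⁻¹ * h x * l.τ (g x))) • l.σ (l.r (g x)) =
        l.σ (l.r (f₁ x)) := by
      rw [mul_smul, inv_smul_eq_iff, ← h4, mul_smul, ← h5, ← h3]
    have h7 := l.eq_of_smul_eq _ (l.r_mem _ h2) _ (l.r_mem _ h1) _ h6
    rw [← h7] at h6
    have h8 := hfree _ _ h6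
    rw [inv_mul_eq_one] at h8
    rw [h8]
    group
  have hZf : ∀ᶠ x in 𝓝[s] y, f₁ x ∈ l.Z := hf₁s.continuousWithinAt.preimage_mem_nhdsWithin
    (l.isOpen_Z.mem_nhds (by rw [hf₁y]; exact l.mem_Z))
  have hZg : ∀ᶠ x in 𝓝[s] y, g x ∈ l.Z := hg.continuousWithinAt.preimage_mem_nhdsWithin
    (l.isOpen_Z.mem_nhds l.mem_Z)
  refine (contMDiffWithinAt_const.mul (hτf.mul hτg.inv)).congr_of_eventuallyEq
    (f := fun x => a * ((l.τ ∘ f₁) x * ((l.τ ∘ g) x)⁻¹)) ?_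
    (key y hy (by rw [hf₁y]; exact l.mem_Z) l.mem_Z)
  filter_upwards [hZf, hZg, self_mem_nhdsWithin] with x h1 h2 hx
  exact key x hx h1 h2

/-- The orbit space has a chart for every slice. -/
theorem LocalSlice.nonempty_spanChart (w : W) (l : LocalSlice EK EW K m w) :
    Nonempty (SpanChart EW (EuclideanSpace ℝ (Fin m)) (id : W → W)
      (Quotient.mk (MulAction.orbitRel K W)) (Quotient.mk (MulAction.orbitRel K W) w)) := by
  have : ContinuousConstSMul K W := ⟨fun a => (contMDiff_const_smul' (EK := EK) (EW := EW) a).continuous⟩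
  set π : W → MulAction.orbitRel.Quotient K W := Quotient.mk (MulAction.orbitRel K W) with hπ
  have hπo : IsOpenMap π := isOpenMap_quotient_mk'_mul
  have hπc : Continuous π := continuous_quotient_mk'
  have hπr : ∀ z ∈ l.Z, π z = π (l.σ (l.r z)) := fun z hz =>
    orbitMk_eq_iff.2 ⟨l.τ z, (l.eq_smul z hz).symm⟩
  obtain ⟨χ, hχt, hχs, hχ1, hχ2⟩ := exists_openPartialHomeomorph_of_injOn (f := π ∘ l.σ) l.isOpen_V
    (hπc.comp_continuousOn l.contMDiffOn_σ.continuousOn)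
    (by
      intro x hx y hy hxy
      obtain ⟨a, ha⟩ := orbitMk_eq_iff.1 hxy
      exact (l.eq_of_smul_eq y hy x hx a ha).symm)
    (by
      intro U hUV hU
      convert hπo _ (l.contMDiffOn_r.continuousOn.isOpen_inter_preimage l.isOpen_Z hU) using 1
      ext q
      constructor
      · rintro ⟨x, hx, rfl⟩
        refine ⟨l.σ x, ⟨l.σ_mem x (hUV hx), ?_⟩, rfl⟩
        rwa [mem_preimage, l.r_σ x (hUV hx)]
      · rintro ⟨z, hz, rfl⟩
        exact ⟨l.r z, hz.2, (hπr z hz.1).symm⟩)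
  refine ⟨⟨χ, ?_, l.σ, ?_, ?_, ?_⟩⟩
  · rw [hχs]
    exact ⟨0, l.zero_mem, congrArg π l.σ_zero⟩
  · rw [hχt]
    exact l.contMDiffOn_σ
  · intro x hx
    rw [hχt] at hx
    exact (hχ1 x hx).symm
  · intro s hs
    rw [hχs] at hs
    obtain ⟨x, hx, hxs⟩ := hs
    obtain ⟨a, ha⟩ := orbitMk_eq_iff.1 hxs
    -- The element `a` moves `s` onto the slice within its orbit, so `l.r ∘ (a • ·)` extends the
    -- chart near `s`.
    have hsm := contMDiff_const_smul' (EK := EK) (EW := EW) (W := W) a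
    refine ⟨(a • ·) ⁻¹' l.Z, l.r ∘ (a • ·), l.isOpen_Z.preimage hsm.continuous, ?_,
      l.contMDiffOn_r.comp hsm.contMDiffOn (fun z hz => hz), ?_⟩
    · change a • s ∈ l.Z
      rw [ha]
      exact l.σ_mem x hx
    · intro z hz
      replace hz : a • z ∈ l.Z := hz
      have h1 : π z = π (l.σ (l.r (a • z))) := by
        rw [← hπr _ hz]
        exact (orbitMk_eq_iff.2 ⟨a, rfl⟩).symm
      refine ⟨?_, ?_⟩
      · rw [hχs, h1]
        exact ⟨_, l.r_mem _ hz, rfl⟩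
      · rw [h1]
        exact (hχ2 _ (l.r_mem _ hz)).symm

theorem LocalSlice.nonempty_spanChart_all (hs : ∀ w : W, LocalSlice EK EW K m w) :
    Nonempty (∀ q : MulAction.orbitRel.Quotient K W,
      SpanChart EW (EuclideanSpace ℝ (Fin m)) (id : W → W)
        (Quotient.mk (MulAction.orbitRel K W)) q) := by
  refine ⟨fun q => Classical.choice ?_⟩
  obtain ⟨w, rfl⟩ := Quotient.exists_rep q
  exact (hs w).nonempty_spanChart

/-- Smooth local sections of the orbit map give smooth equivariant trivializations. -/
theorem IsSmoothSpan.exists_trivialization [LieGroup 𝓘(ℝ, EK) ∞ K]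
    (hfree : ∀ (a : K) (w : W), a • w = w → a = 1) (hs : ∀ w : W, LocalSlice EK EW K m w)
    [ChartedSpace (EuclideanSpace ℝ (Fin m)) (MulAction.orbitRel.Quotient K W)]
    (h : IsSmoothSpan EW (EuclideanSpace ℝ (Fin m)) (id : W → W)
      (Quotient.mk (MulAction.orbitRel K W) : W → MulAction.orbitRel.Quotient K W))
    (q : MulAction.orbitRel.Quotient K W) :
    ∃ e : Bundle.Trivialization K
        (Quotient.mk (MulAction.orbitRel K W) : W → MulAction.orbitRel.Quotient K W),
      q ∈ e.baseSet ∧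
      ContMDiffOn 𝓘(ℝ, EW) ((𝓡 m).prod 𝓘(ℝ, EK)) ∞ e e.source ∧
      ContMDiffOn ((𝓡 m).prod 𝓘(ℝ, EK)) 𝓘(ℝ, EW) ∞ e.toOpenPartialHomeomorph.symm e.target ∧
      ∀ (a : K), ∀ x ∈ e.source, e (a • x) = ((e x).1, a * (e x).2) := by
  classical
  set π : W → MulAction.orbitRel.Quotient K W := Quotient.mk (MulAction.orbitRel K W) with hπ
  obtain ⟨V, σ, hV, hqV, hσ, hπσ⟩ := h.exists_sec q
  have hσ' : ContMDiffOn (𝓡 m) 𝓘(ℝ, EW) ∞ σ V := hσ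
  have hπs : ContMDiff 𝓘(ℝ, EW) (𝓡 m) ∞ π := h.contMDiff (g := id) contMDiff_id
  have hex : ∀ w, ∃ a : K, π w ∈ V → w = a • σ (π w) := by
    intro w
    by_cases hw : π w ∈ V
    · obtain ⟨a, ha⟩ := orbitMk_eq_iff.1 (hπσ _ hw).symm
      exact ⟨a, fun _ => ha.symm⟩
    · exact ⟨1, fun h => absurd h hw⟩
  -- `τ w` is the fibre coordinate relative to the section `σ`. Freeness makes it unique over `V`,
  -- which yields both its smoothness and its equivariance.
  choose τ hτ using hex
  have hfree' : ∀ (a b : K) (w : W), a • w = b • w → a = b := fun a b w hab => by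
    have : (b⁻¹ * a) • w = w := by rw [mul_smul, inv_smul_eq_iff, hab]
    exact (inv_mul_eq_one.1 (hfree _ _ this)).symm
  have hπsm : ∀ (a : K) (w : W), π (a • w) = π w := fun a w => orbitMk_eq_iff.2 ⟨a, rfl⟩
  have hτs : ContMDiffOn 𝓘(ℝ, EW) 𝓘(ℝ, EK) ∞ τ (π ⁻¹' V) := fun w hw =>
    LocalSlice.contMDiffWithinAt_of_eq_smul hfree hs hw (f := id) (g := σ ∘ π) hτ
      contMDiffWithinAt_id ((hσ'.comp hπs.contMDiffOn fun x hx => hx) w hw)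
  have hes : ContMDiffOn 𝓘(ℝ, EW) ((𝓡 m).prod 𝓘(ℝ, EK)) ∞ (fun w => (π w, τ w)) (π ⁻¹' V) :=
    hπs.contMDiffOn.prodMk hτs
  have hei : ContMDiffOn ((𝓡 m).prod 𝓘(ℝ, EK)) 𝓘(ℝ, EW) ∞
      (fun p : MulAction.orbitRel.Quotient K W × K => p.2 • σ p.1) (V ×ˢ univ) :=
    (ContMDiffSMul.contMDiff_smul (I := 𝓘(ℝ, EK)) (I' := 𝓘(ℝ, EW)) (n := ∞) (G := K)
      (M := W)).comp_contMDiffOn (contMDiffOn_snd.prodMk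
        (hσ'.comp contMDiffOn_fst (fun p hp => hp.1)))
  let e : Bundle.Trivialization K π :=
    { toFun := fun w => (π w, τ w)
      invFun := fun p => p.2 • σ p.1
      source := π ⁻¹' V
      target := V ×ˢ univ
      map_source' := fun w hw => ⟨hw, mem_univ _⟩
      map_target' := fun p hp => by
        rw [mem_preimage, hπsm, hπσ _ hp.1]
        exact hp.1
      left_inv' := fun w hw => (hτ w hw).symm
      right_inv' := fun p hp => by
        have h1 : π (p.2 • σ p.1) = p.1 := by rw [hπsm, hπσ _ hp.1]
        refine Prod.ext h1 ?_
        have h2 := hτ (p.2 • σ p.1) (by rw [h1]; exact hp.1)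
        rw [h1] at h2
        exact (hfree' _ _ _ h2).symm
      open_source := hV.preimage hπs.continuous
      open_target := hV.prod isOpen_univ
      continuousOn_toFun := hes.continuousOn
      continuousOn_invFun := hei.continuousOn
      baseSet := V
      open_baseSet := hV
      source_eq := rfl
      target_eq := rfl
      proj_toFun := fun _ _ => rfl }
  refine ⟨e, hqV, hes, hei, fun a w hw => ?_⟩
  have hw' : π w ∈ V := hw
  refine Prod.ext (hπsm a w) ?_
  change τ (a • w) = a * τ w
  have h2 := hτ (a • w) (by rwa [hπsm])
  rw [hπsm] at h2
  refine hfree' _ _ (σ (π w)) ?_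
  rw [← h2, mul_smul, ← hτ w hw']

end FreeProperAction

theorem comp_one_smulRight_eq {F F' : Type*} [NormedAddCommGroup F] [NormedSpace ℝ F]
    [NormedAddCommGroup F'] [NormedSpace ℝ F'] {L : F →L[ℝ] F'} {v : F} {w : F'} (h : L v = w) :
    L.comp ((1 : ℝ →L[ℝ] ℝ).smulRight v) = (1 : ℝ →L[ℝ] ℝ).smulRight w := by
  subst h
  ext
  simp

/-! ### Restricting vector fields to submanifolds -/

section RestrictedVectorField

variable {E EW P W : Type*} [NormedAddCommGroup E] [NormedSpace ℝ E]
  [NormedAddCommGroup EW] [NormedSpace ℝ EW]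
  [TopologicalSpace P] [ChartedSpace E P] [TopologicalSpace W] [ChartedSpace EW W] {ι : W → P}

theorem tangentBundle_mk_eq {x y : W} (h : x = y) {u v : EW} (huv : u = v) :
    (⟨x, u⟩ : TangentBundle 𝓘(ℝ, EW) W) = ⟨y, v⟩ := by
  subst h huv
  rfl

/-- Local retractions onto an embedded submanifold are left inverses of its inclusion to first
order. -/
theorem mfderiv_retraction_comp (hι : ContMDiff 𝓘(ℝ, EW) 𝓘(ℝ, E) ∞ ι) {U : Set P} {R : P → W}
    (hU : IsOpen U) (hR : ContMDiffOn 𝓘(ℝ, E) 𝓘(ℝ, EW) ∞ R U) (hRι : ∀ w, ι w ∈ U → R (ι w) = w)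
    {w : W} (hw : ι w ∈ U) (v : EW) :
    @Eq EW (mfderiv 𝓘(ℝ, E) 𝓘(ℝ, EW) R (ι w) (mfderiv 𝓘(ℝ, EW) 𝓘(ℝ, E) ι w v)) v := by
  have h1 := ((hR.contMDiffAt (hU.mem_nhds hw)).mdifferentiableAt (by simp)).hasMFDerivAt
  have h2 := (hι.mdifferentiableAt (x := w) (by simp)).hasMFDerivAt
  have h3 : HasMFDerivAt 𝓘(ℝ, EW) 𝓘(ℝ, EW) (R ∘ ι) w (ContinuousLinearMap.id ℝ EW) := by
    refine (hasMFDerivAt_id w).congr_of_eventuallyEq ?_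
    filter_upwards [hι.continuous.continuousAt.preimage_mem_nhds (hU.mem_nhds hw)] with x hx
    exact hRι x hx
  exact DFunLike.congr_fun (hasMFDerivAt_unique (h1.comp w h2) h3) v

theorem IsSmoothSpan.contMDiff_incl {E EW P W : Type*} [NormedAddCommGroup E] [NormedSpace ℝ E]
    [NormedAddCommGroup EW] [NormedSpace ℝ EW] [TopologicalSpace P] [ChartedSpace E P]
    [TopologicalSpace W] [ChartedSpace EW W] {ι : W → P} (h : IsSmoothSpan E EW ι (id : W → W)) :
    ContMDiff 𝓘(ℝ, EW) 𝓘(ℝ, E) ∞ ι := by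
  intro w
  obtain ⟨V, σ, hV, hw, hσ, hid⟩ := h.exists_sec w
  refine (hσ.contMDiffAt (hV.mem_nhds hw)).congr_of_eventuallyEq ?_
  filter_upwards [hV.mem_nhds hw] with x hx
  exact congrArg ι (hid x hx).symm

/-- The derivative of a local retraction is a left inverse. -/
theorem IsSmoothSpan.mfderiv_incl_injective (h : IsSmoothSpan E EW ι (id : W → W)) {w : W}
    {v v' : EW} (hv : @Eq E (mfderiv 𝓘(ℝ, EW) 𝓘(ℝ, E) ι w v) (mfderiv 𝓘(ℝ, EW) 𝓘(ℝ, E) ι w v')) :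
    v = v' := by
  obtain ⟨U, R, hU, hwU, hR, hRι⟩ := h.exists_ext w
  have h1 := mfderiv_retraction_comp h.contMDiff_incl hU hR hRι hwU v
  have h2 := mfderiv_retraction_comp h.contMDiff_incl hU hR hRι hwU v'
  exact h1.symm.trans ((congrArg (mfderiv 𝓘(ℝ, E) 𝓘(ℝ, EW) R (ι w) : E → EW) hv).trans h2)

/-- The integral curves of a restricted vector field are those of the vector field in the
submanifold. -/
theorem IsSmoothSpan.isMIntegralCurveOn_restrict_iff (h : IsSmoothSpan E EW ι (id : W → W))
    {X : (p : P) → TangentSpace 𝓘(ℝ, E) p} {XH : (w : W) → TangentSpace 𝓘(ℝ, EW) w}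
    (hXH : ∀ w, mfderiv 𝓘(ℝ, EW) 𝓘(ℝ, E) ι w (XH w) = X (ι w)) {γ : ℝ → W} {J : Set ℝ} :
    IsMIntegralCurveOn (I := 𝓘(ℝ, E)) (ι ∘ γ) X J ↔ IsMIntegralCurveOn (I := 𝓘(ℝ, EW)) γ XH J := by
  have hι := h.contMDiff_incl
  constructor
  · intro hγ t ht
    obtain ⟨U, R, hU, hwU, hR, hRι⟩ := h.exists_ext (γ t)
    have hRd := ((hR.contMDiffAt (hU.mem_nhds hwU)).mdifferentiableAt (by simp)).hasMFDerivAt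
    have h1 := hRd.comp_hasMFDerivWithinAt t (hγ t ht)
    have h2 : HasMFDerivWithinAt 𝓘(ℝ, ℝ) 𝓘(ℝ, EW) γ J t _ := h1.congr_of_eventuallyEq (by
      filter_upwards [(hγ t ht).continuousWithinAt.preimage_mem_nhdsWithin (hU.mem_nhds hwU)]
        with x hx
      exact (hRι _ hx).symm) (hRι _ hwU).symm
    have h3 : @Eq EW (mfderiv 𝓘(ℝ, E) 𝓘(ℝ, EW) R (ι (γ t)) (X (ι (γ t)))) (XH (γ t)) :=
      (congrArg (mfderiv 𝓘(ℝ, E) 𝓘(ℝ, EW) R (ι (γ t)) : E → EW) (hXH (γ t)).symm).trans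
      (mfderiv_retraction_comp hι hU hR hRι hwU (XH (γ t)))
    exact h2.congr_mfderiv (comp_one_smulRight_eq (F := E) (F' := EW) h3)
  · exact isMIntegralCurveOn_comp_of_related
      (fun t _ => hι.mdifferentiableAt (by simp)) (fun t _ => hXH _)

variable [IsManifold 𝓘(ℝ, E) ∞ P] [IsManifold 𝓘(ℝ, EW) ∞ W]

/-- Pushing a smooth vector field along a map by a smooth map gives a smooth vector field along
the composition. -/
theorem contMDiffAt_mfderiv_comp {EY Y : Type*} [NormedAddCommGroup EY] [NormedSpace ℝ EY]
    [TopologicalSpace Y] [ChartedSpace EY Y] {X : (p : P) → TangentSpace 𝓘(ℝ, E) p}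
    (hX : IsSmoothVectorField X) {U : Set P} (hU : IsOpen U) {R : P → W}
    (hR : ContMDiffOn 𝓘(ℝ, E) 𝓘(ℝ, EW) ∞ R U) {f : Y → P} {y : Y}
    (hf : ContMDiffAt 𝓘(ℝ, EY) 𝓘(ℝ, E) ∞ f y) (hy : f y ∈ U) :
    ContMDiffAt 𝓘(ℝ, EY) 𝓘(ℝ, EW).tangent ∞ (fun z => (⟨R (f z),
      mfderiv 𝓘(ℝ, E) 𝓘(ℝ, EW) R (f z) (X (f z))⟩ : TangentBundle 𝓘(ℝ, EW) W)) y := by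
  have h1 := hR.contMDiffOn_tangentMapWithin (m := ∞) (by simp) hU.uniqueMDiffOn
  have hopen : IsOpen (Bundle.TotalSpace.proj ⁻¹' U : Set (TangentBundle 𝓘(ℝ, E) P)) :=
    hU.preimage (FiberBundle.continuous_proj E (TangentSpace 𝓘(ℝ, E)))
  have h2 := (h1.contMDiffAt (hopen.mem_nhds (x := ⟨f y, X (f y)⟩) hy)).comp y
    ((ContMDiff.contMDiffAt hX).comp y hf)
  refine h2.congr_of_eventuallyEq ?_
  filter_upwards [hf.continuousAt.preimage_mem_nhds (hU.mem_nhds hy)] with z hz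
  refine tangentBundle_mk_eq rfl ?_
  exact DFunLike.congr_fun (mfderivWithin_of_isOpen hU hz).symm (X (f z))

/-- A vector field whose flow preserves a submanifold restricts to it. -/
theorem IsSmoothSpan.exists_restrict [CompleteSpace E] (h : IsSmoothSpan E EW ι (id : W → W))
    {X : (p : P) → TangentSpace 𝓘(ℝ, E) p} (hX : IsSmoothVectorField X)
    (hflow : ∀ J : Set ℝ, J.OrdConnected → ∀ γ : ℝ → P, IsMIntegralCurveOn (I := 𝓘(ℝ, E)) γ X J →
      ∀ t₀ ∈ J, γ t₀ ∈ range ι → ∀ t ∈ J, γ t ∈ range ι) :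
    ∃ XH : (w : W) → TangentSpace 𝓘(ℝ, EW) w, IsSmoothVectorField XH ∧
      ∀ w, mfderiv 𝓘(ℝ, EW) 𝓘(ℝ, E) ι w (XH w) = X (ι w) := by
  have hι := h.contMDiff_incl
  have key : ∀ w, ∃ v : TangentSpace 𝓘(ℝ, EW) w,
      mfderiv 𝓘(ℝ, EW) 𝓘(ℝ, E) ι w v = X (ι w) := by
    intro w
    obtain ⟨U, R, hU, hwU, hR, hRι⟩ := h.exists_ext w
    obtain ⟨γ, hγ0, ε, hε, hγ⟩ := hX.exists_isMIntegralCurveOn_Ioo (ι w) 0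
    have h0 : (0 : ℝ) ∈ Ioo (0 - ε) (0 + ε) := by simpa using hε
    have hγd : HasMFDerivAt 𝓘(ℝ, ℝ) 𝓘(ℝ, E) γ 0 ((1 : ℝ →L[ℝ] ℝ).smulRight (X (γ 0))) :=
      (hγ 0 h0).hasMFDerivAt (isOpen_Ioo.mem_nhds h0)
    have hRγ : R (γ 0) = w := by rw [hγ0]; exact hRι w hwU
    have hγU : γ 0 ∈ U := by rwa [hγ0]
    have hRd := ((hR.contMDiffAt (hU.mem_nhds hγU)).mdifferentiableAt (by simp)).hasMFDerivAt
    have hιd := (hι.mdifferentiableAt (x := R (γ 0)) (by simp)).hasMFDerivAt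
    have h1 : HasMFDerivAt 𝓘(ℝ, ℝ) 𝓘(ℝ, E) (ι ∘ R ∘ γ) 0 _ := hιd.comp 0 (hRd.comp 0 hγd)
    -- The flow stays in the submanifold, so `ι ∘ R ∘ γ = γ` near `0`. Differentiating exhibits the
    -- field as the image under `Tι` of its retraction.
    have h2 : HasMFDerivAt 𝓘(ℝ, ℝ) 𝓘(ℝ, E) (ι ∘ R ∘ γ) 0
        ((1 : ℝ →L[ℝ] ℝ).smulRight (X (γ 0))) := by
      refine hγd.congr_of_eventuallyEq ?_
      filter_upwards [isOpen_Ioo.mem_nhds h0, hγd.continuousAt.preimage_mem_nhds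
        (hU.mem_nhds hγU)] with t ht htU
      obtain ⟨w', hw'⟩ := hflow _ ordConnected_Ioo γ hγ 0 h0 ⟨w, hγ0.symm⟩ t ht
      have : R (γ t) = w' := by rw [← hw']; exact hRι w' (by rw [hw']; exact htU)
      rw [Function.comp_apply, Function.comp_apply, this, hw']
    have h3 := DFunLike.congr_fun (hasMFDerivAt_unique h1 h2) (1 : ℝ)
    have h4 : @Eq E (mfderiv 𝓘(ℝ, EW) 𝓘(ℝ, E) ι (R (γ 0))
        (mfderiv 𝓘(ℝ, E) 𝓘(ℝ, EW) R (γ 0) ((1 : ℝ) • (X (γ 0) : E)))) ((1 : ℝ) • (X (γ 0) : E)) := h3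
    rw [one_smul] at h4
    subst hRγ
    exact ⟨_, h4.trans (congrArg (fun p => (X p : E)) hγ0)⟩
  choose XH hXH using key
  refine ⟨XH, fun w => ?_, hXH⟩
  obtain ⟨U, R, hU, hwU, hR, hRι⟩ := h.exists_ext w
  -- Locally `XH` is `TR` applied to `X` along `ι`, because `TR ∘ Tι` is the identity.
  refine (contMDiffAt_mfderiv_comp hX hU hR hι.contMDiffAt hwU).congr_of_eventuallyEq ?_
  filter_upwards [hι.continuous.continuousAt.preimage_mem_nhds (hU.mem_nhds hwU)] with x hx
  refine tangentBundle_mk_eq (hRι x hx).symm ?_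
  exact (mfderiv_retraction_comp hι hU hR hRι hx (XH x)).symm.trans
    (congrArg (mfderiv 𝓘(ℝ, E) 𝓘(ℝ, EW) R (ι x) : E → EW) (hXH x))

end RestrictedVectorField

/-! ### Projecting invariant vector fields -/

section ReducedVectorField

variable {EW F K W : Type*} [NormedAddCommGroup EW] [NormedSpace ℝ EW] [NormedAddCommGroup F]
  [NormedSpace ℝ F] [Group K]
  [TopologicalSpace W] [ChartedSpace EW W] [MulAction K W]
  [ChartedSpace F (MulAction.orbitRel.Quotient K W)]

/-- An invariant vector field projects to the orbit space. -/
theorem IsSmoothSpan.exists_project [IsManifold 𝓘(ℝ, EW) ∞ W]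
    [IsManifold 𝓘(ℝ, F) ∞ (MulAction.orbitRel.Quotient K W)]
    (h : IsSmoothSpan EW F (id : W → W)
      (Quotient.mk (MulAction.orbitRel K W) : W → MulAction.orbitRel.Quotient K W))
    {Y : (w : W) → TangentSpace 𝓘(ℝ, EW) w} (hY : IsSmoothVectorField Y)
    (hsm : ∀ a : K, ContMDiff 𝓘(ℝ, EW) 𝓘(ℝ, EW) ∞ (fun w : W => a • w))
    (hinv : PreservesVectorField EW K Y) :
    ∃ Z : (q : MulAction.orbitRel.Quotient K W) → TangentSpace 𝓘(ℝ, F) q,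
      IsSmoothVectorField Z ∧ ∀ w, mfderiv 𝓘(ℝ, EW) 𝓘(ℝ, F)
        (Quotient.mk (MulAction.orbitRel K W) : W → MulAction.orbitRel.Quotient K W) w (Y w) =
        Z (Quotient.mk (MulAction.orbitRel K W) w) := by
  set π : W → MulAction.orbitRel.Quotient K W := Quotient.mk (MulAction.orbitRel K W) with hπ
  have hπs : ContMDiff 𝓘(ℝ, EW) 𝓘(ℝ, F) ∞ π := h.contMDiff (g := id) contMDiff_id
  have hπd : ∀ w, MDifferentiableAt 𝓘(ℝ, EW) 𝓘(ℝ, F) π w := fun w =>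
    hπs.mdifferentiableAt (by simp)
  have hrel : ∀ w w', π w = π w' →
      @Eq F (mfderiv 𝓘(ℝ, EW) 𝓘(ℝ, F) π w (Y w)) (mfderiv 𝓘(ℝ, EW) 𝓘(ℝ, F) π w' (Y w')) := by
    intro w w' hww'
    obtain ⟨a, rfl⟩ := orbitMk_eq_iff.1 hww'
    have e1 : π ∘ (fun x : W => a • x) = π := funext fun x => orbitMk_eq_iff.2 ⟨a, rfl⟩
    have e2 := mfderiv_comp_apply (I := 𝓘(ℝ, EW)) (I' := 𝓘(ℝ, EW)) (I'' := 𝓘(ℝ, F)) w' (hπd (a • w'))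
      ((hsm a).mdifferentiableAt (by simp)) (Y w')
    have e3 := DFunLike.congr_fun (mfderiv_congr (I := 𝓘(ℝ, EW)) (I' := 𝓘(ℝ, F)) (x := w') e1)
      (Y w')
    refine (congrArg (mfderiv 𝓘(ℝ, EW) 𝓘(ℝ, F) π (a • w') : EW → F) (hinv a w').symm).trans ?_
    exact e2.symm.trans e3
  -- Arbitrary representatives suffice, since the projected vector depends only on the orbit;
  -- smoothness is recovered by evaluating along local sections.
  choose rep hrep using fun q : MulAction.orbitRel.Quotient K W => Quotient.exists_rep q
  let Z : (q : MulAction.orbitRel.Quotient K W) → TangentSpace 𝓘(ℝ, F) q := fun q =>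
    (show F from mfderiv 𝓘(ℝ, EW) 𝓘(ℝ, F) π (rep q) (Y (rep q)))
  have hZ : ∀ w, mfderiv 𝓘(ℝ, EW) 𝓘(ℝ, F) π w (Y w) = Z (π w) := fun w =>
    hrel w (rep (π w)) (hrep (π w)).symm
  refine ⟨Z, fun q => ?_, hZ⟩
  obtain ⟨V, σ, hV, hqV, hσ, hπσ⟩ := h.exists_sec q
  have hσ' : ContMDiffOn 𝓘(ℝ, F) 𝓘(ℝ, EW) ∞ σ V := hσ
  refine (contMDiffAt_mfderiv_comp hY isOpen_univ hπs.contMDiffOn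
    (hσ'.contMDiffAt (hV.mem_nhds hqV)) (mem_univ _)).congr_of_eventuallyEq ?_
  filter_upwards [hV.mem_nhds hqV] with x hx
  refine tangentBundle_mk_eq (hπσ x hx).symm ?_
  exact (congrArg (fun y => (Z y : F)) (hπσ x hx)).symm.trans (hZ (σ x)).symm

end ReducedVectorField


/-! ### Gluing local solutions along an interval -/

section Glue

variable {EW W : Type*} [NormedAddCommGroup EW] [NormedSpace ℝ EW]
  [TopologicalSpace W] [ChartedSpace EW W] {Y : (w : W) → TangentSpace 𝓘(ℝ, EW) w}

theorem isMIntegralCurveOn_smul {K : Type*} [Group K] [MulAction K W]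
    (hsm : ∀ a : K, ContMDiff 𝓘(ℝ, EW) 𝓘(ℝ, EW) ∞ (fun w : W => a • w))
    (hinv : PreservesVectorField EW K Y) {γ : ℝ → W} {J : Set ℝ}
    (hγ : IsMIntegralCurveOn (I := 𝓘(ℝ, EW)) γ Y J) (a : K) :
    IsMIntegralCurveOn (I := 𝓘(ℝ, EW)) (fun t => a • γ t) Y J :=
  isMIntegralCurveOn_comp_of_related (f := fun w : W => a • w)
    (fun _ _ => (hsm a).mdifferentiableAt (by simp)) (fun _ _ => hinv a _) hγ

/-- A curve that locally agrees with integral curves is an integral curve. -/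
theorem isMIntegralCurveOn_of_local {J : Set ℝ} {γ : ℝ → W}
    (h : ∀ t ∈ J, ∃ (O : Set ℝ) (δ : ℝ → W), IsOpen O ∧ t ∈ O ∧
      IsMIntegralCurveOn (I := 𝓘(ℝ, EW)) δ Y (J ∩ O) ∧ EqOn γ δ (J ∩ O)) :
    IsMIntegralCurveOn (I := 𝓘(ℝ, EW)) γ Y J := by
  intro t ht
  obtain ⟨O, δ, hO, htO, hδ, he⟩ := h t ht
  have h1 : IsMIntegralCurveOn (I := 𝓘(ℝ, EW)) γ Y (J ∩ O) := by
    intro s hs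
    refine ((hδ s hs).congr_mono he (he hs) subset_rfl).congr_mfderiv ?_
    exact congrArg (fun w : W => (1 : ℝ →L[ℝ] ℝ).smulRight (Y w : EW)) (he hs).symm
  exact (h1 t ⟨ht, htO⟩).mono_of_mem_nhdsWithin (inter_mem_nhdsWithin J (hO.mem_nhds htO))

/-- Integral curves subject to a constraint exist on an interval if they exist locally, on
intervals independent of the initial point. -/
theorem IsSmoothVectorField.exists_isMIntegralCurveOn_of_local [CompleteSpace EW] [T2Space W]
    [IsManifold 𝓘(ℝ, EW) ∞ W] (hY : IsSmoothVectorField Y) {J : Set ℝ} (hJ : J.OrdConnected)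
    (C : ℝ → W → Prop)
    (hloc : ∀ s ∈ J, ∃ O : Set ℝ, IsOpen O ∧ (J ∩ O).OrdConnected ∧ s ∈ O ∧
      ∀ t ∈ J ∩ O, ∀ p, C t p → ∃ γ : ℝ → W, IsMIntegralCurveOn (I := 𝓘(ℝ, EW)) γ Y (J ∩ O) ∧
        γ t = p ∧ ∀ t' ∈ J ∩ O, C t' (γ t'))
    {t₀ : ℝ} (ht₀ : t₀ ∈ J) {p₀ : W} (hp₀ : C t₀ p₀) :
    ∃ γ : ℝ → W, IsMIntegralCurveOn (I := 𝓘(ℝ, EW)) γ Y J ∧ γ t₀ = p₀ ∧ ∀ t ∈ J, C t (γ t) := by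
  classical
  have key : ∀ t ∈ J, ∀ p, C t₀ p → ∃ (O : Set ℝ) (γ : ℝ → W), IsOpen O ∧ (J ∩ O).OrdConnected ∧
      t₀ ∈ O ∧ t ∈ O ∧ IsMIntegralCurveOn (I := 𝓘(ℝ, EW)) γ Y (J ∩ O) ∧ γ t₀ = p ∧
      ∀ t' ∈ J ∩ O, C t' (γ t') := by
    intro t ht
    -- The relation says that from every admissible start at time `x` there is a solution reaching
    -- time `y`. It holds locally in both directions and is transitive, so connectedness of `J`
    -- extends it to all pairs.
    refine hJ.isPreconnected.induction₂' (fun x y => ∀ p, C x p → ∃ (O : Set ℝ) (γ : ℝ → W),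
      IsOpen O ∧ (J ∩ O).OrdConnected ∧ x ∈ O ∧ y ∈ O ∧
      IsMIntegralCurveOn (I := 𝓘(ℝ, EW)) γ Y (J ∩ O) ∧ γ x = p ∧
      ∀ t' ∈ J ∩ O, C t' (γ t')) ?_ ?_ ht₀ ht
    · intro x hx
      obtain ⟨O, hO, hOc, hxO, hex⟩ := hloc x hx
      filter_upwards [inter_mem_nhdsWithin J (hO.mem_nhds hxO)] with y hy
      constructor
      · intro p hp
        obtain ⟨γ, h1, h2, h3⟩ := hex x ⟨hx, hxO⟩ p hp
        exact ⟨O, γ, hO, hOc, hxO, hy.2, h1, h2, h3⟩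
      · intro p hp
        obtain ⟨γ, h1, h2, h3⟩ := hex y hy p hp
        exact ⟨O, γ, hO, hOc, hy.2, hxO, h1, h2, h3⟩
    · intro x y z hx hy hz hxy hyz p hp
      obtain ⟨O₁, γ₁, hO₁, hc₁, hx₁, hy₁, h₁, hp₁, hC₁⟩ := hxy p hp
      obtain ⟨O₂, γ₂, hO₂, hc₂, hy₂, hz₂, h₂, hp₂, hC₂⟩ := hyz _ (hC₁ y ⟨hy, hy₁⟩)
      have heq : EqOn γ₁ γ₂ ((J ∩ O₁) ∩ (J ∩ O₂)) :=
        hY.eqOn_of_isMIntegralCurveOn (hc₁.inter hc₂) (h₁.mono inter_subset_left)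
          (h₂.mono inter_subset_right) (t₀ := y) ⟨⟨hy, hy₁⟩, hy, hy₂⟩ hp₂.symm
      set γ := O₁.piecewise γ₁ γ₂ with hγ
      have e₁ : ∀ t ∈ J ∩ O₁, γ t = γ₁ t := fun t ht => piecewise_eq_of_mem _ _ _ ht.2
      have e₂ : ∀ t ∈ J ∩ O₂, γ t = γ₂ t := fun t ht => by
        by_cases h : t ∈ O₁
        · rw [e₁ t ⟨ht.1, h⟩, heq ⟨⟨ht.1, h⟩, ht⟩]
        · exact piecewise_eq_of_notMem _ _ _ h
      have hsub : ∀ O, (J ∩ (O₁ ∪ O₂)) ∩ O ⊆ J ∩ O := fun O t ht => ⟨ht.1.1, ht.2⟩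
      refine ⟨O₁ ∪ O₂, γ, hO₁.union hO₂, ?_, Or.inl hx₁, Or.inr hz₂, ?_, ?_, ?_⟩
      · rw [inter_union_distrib_left, ← isPreconnected_iff_ordConnected]
        exact IsPreconnected.union y ⟨hy, hy₁⟩ ⟨hy, hy₂⟩ hc₁.isPreconnected hc₂.isPreconnected
      · refine isMIntegralCurveOn_of_local fun t ht => ?_
        rcases ht.2 with h | h
        · exact ⟨O₁, γ₁, hO₁, h, h₁.mono (hsub _), fun s hs => e₁ s (hsub _ hs)⟩
        · exact ⟨O₂, γ₂, hO₂, h, h₂.mono (hsub _), fun s hs => e₂ s (hsub _ hs)⟩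
      · rw [e₁ x ⟨hx, hx₁⟩, hp₁]
      · rintro t ⟨ht, h | h⟩
        · rw [e₁ t ⟨ht, h⟩]
          exact hC₁ t ⟨ht, h⟩
        · rw [e₂ t ⟨ht, h⟩]
          exact hC₂ t ⟨ht, h⟩
  have key' : ∀ t : ℝ, ∃ (O : Set ℝ) (γ : ℝ → W), t ∈ J → (IsOpen O ∧ (J ∩ O).OrdConnected ∧
      t₀ ∈ O ∧ t ∈ O ∧ IsMIntegralCurveOn (I := 𝓘(ℝ, EW)) γ Y (J ∩ O) ∧ γ t₀ = p₀ ∧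
      ∀ t' ∈ J ∩ O, C t' (γ t')) := by
    intro t
    by_cases ht : t ∈ J
    · obtain ⟨O, γ, h⟩ := key t ht p₀ hp₀
      exact ⟨O, γ, fun _ => h⟩
    · exact ⟨∅, fun _ => p₀, fun h => absurd h ht⟩
  choose O γ h using key'
  -- The diagonal of the chosen family is the solution: members defined on overlapping intervals
  -- agree there, since all start at `p₀` at time `t₀`.
  refine ⟨fun t => γ t t, isMIntegralCurveOn_of_local fun t ht => ?_, (h t₀ ht₀).2.2.2.2.2.1, ?_⟩
  · obtain ⟨h1, h2, h3, h4, h5, h6, -⟩ := h t ht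
    refine ⟨O t, γ t, h1, h4, h5, fun s hs => ?_⟩
    obtain ⟨-, k2, k3, k4, k5, k6, -⟩ := h s hs.1
    exact hY.eqOn_of_isMIntegralCurveOn (k2.inter h2) (k5.mono inter_subset_left)
      (h5.mono inter_subset_right) (t₀ := t₀) ⟨⟨ht₀, k3⟩, ht₀, h3⟩ (k6.trans h6.symm)
      ⟨⟨hs.1, k4⟩, hs⟩
  · intro t ht
    obtain ⟨-, -, -, h4, -, -, h7⟩ := h t ht
    exact h7 t ⟨ht, h4⟩

end Glue

/-! ### Lifting integral curves from the orbit space -/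

section Reconstruction

variable {EW F K W : Type*} [NormedAddCommGroup EW] [NormedSpace ℝ EW] [NormedAddCommGroup F]
  [NormedSpace ℝ F] [CompleteSpace EW] [CompleteSpace F]
  [Group K] [TopologicalSpace W] [ChartedSpace EW W] [MulAction K W]
  [ChartedSpace F (MulAction.orbitRel.Quotient K W)] [T2Space W] [IsManifold 𝓘(ℝ, EW) ∞ W]
  [T2Space (MulAction.orbitRel.Quotient K W)] [IsManifold 𝓘(ℝ, F) ∞ (MulAction.orbitRel.Quotient K W)]

/-- Integral curves of the reduced vector field lift to integral curves of the vector field. -/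
theorem exists_lift_isMIntegralCurveOn {Y : (w : W) → TangentSpace 𝓘(ℝ, EW) w}
    {Z : (q : MulAction.orbitRel.Quotient K W) → TangentSpace 𝓘(ℝ, F) q}
    (hY : IsSmoothVectorField Y) (hZ : IsSmoothVectorField Z)
    (hsm : ∀ a : K, ContMDiff 𝓘(ℝ, EW) 𝓘(ℝ, EW) ∞ (fun w : W => a • w))
    (hinv : PreservesVectorField EW K Y)
    (hπ : ContMDiff 𝓘(ℝ, EW) 𝓘(ℝ, F) ∞
      (Quotient.mk (MulAction.orbitRel K W) : W → MulAction.orbitRel.Quotient K W))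
    (hYZ : ∀ w, mfderiv 𝓘(ℝ, EW) 𝓘(ℝ, F)
        (Quotient.mk (MulAction.orbitRel K W) : W → MulAction.orbitRel.Quotient K W) w (Y w) =
        Z (Quotient.mk (MulAction.orbitRel K W) w))
    {J : Set ℝ} (hJ : J.OrdConnected) {c : ℝ → MulAction.orbitRel.Quotient K W}
    (hc : IsMIntegralCurveOn (I := 𝓘(ℝ, F)) c Z J) {t₀ : ℝ} (ht₀ : t₀ ∈ J) {p₀ : W}
    (hp₀ : Quotient.mk (MulAction.orbitRel K W) p₀ = c t₀) :
    ∃ γ : ℝ → W, IsMIntegralCurveOn (I := 𝓘(ℝ, EW)) γ Y J ∧ γ t₀ = p₀ ∧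
      ∀ t ∈ J, Quotient.mk (MulAction.orbitRel K W) (γ t) = c t := by
  refine hY.exists_isMIntegralCurveOn_of_local hJ
    (fun t p => Quotient.mk (MulAction.orbitRel K W) p = c t) (fun s hs => ?_) ht₀ hp₀
  obtain ⟨w, hw⟩ := Quotient.exists_rep (c s)
  obtain ⟨δ, hδs, ε, hε, hδ⟩ := hY.exists_isMIntegralCurveOn_Ioo w s
  have hsO : s ∈ Ioo (s - ε) (s + ε) := by constructor <;> linarith
  have hoc : (J ∩ Ioo (s - ε) (s + ε)).OrdConnected := hJ.inter ordConnected_Ioo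
  have hδ' := hδ.mono (inter_subset_right : J ∩ Ioo (s - ε) (s + ε) ⊆ _)
  have hπδ : EqOn (Quotient.mk (MulAction.orbitRel K W) ∘ δ) c (J ∩ Ioo (s - ε) (s + ε)) := by
    refine hZ.eqOn_of_isMIntegralCurveOn hoc ?_ (hc.mono inter_subset_left) ⟨hs, hsO⟩ ?_
    · exact isMIntegralCurveOn_comp_of_related (fun t _ => hπ.mdifferentiableAt (by simp))
        (fun t _ => hYZ _) hδ'
    · rw [Function.comp_apply, hδs, hw]
  refine ⟨_, isOpen_Ioo, hoc, hsO, fun t ht p hp => ?_⟩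
  -- Any start `p` over `c t` is a translate of `δ t`, so translating `δ` gives a solution on the
  -- same interval. This makes the time of existence independent of `p`.
  obtain ⟨a, ha⟩ := orbitMk_eq_iff.1 (hp.trans (hπδ ht).symm)
  refine ⟨fun t => a • δ t, isMIntegralCurveOn_smul hsm hinv hδ' a, ha, fun t' ht' => ?_⟩
  rw [← hπδ ht']
  exact orbitMk_eq_iff.2 ⟨a, rfl⟩

end Reconstruction

/-! ### Left logarithmic derivative -/

section LeftLogarithmicDerivative

variable {E M : Type*} [NormedAddCommGroup E] [NormedSpace ℝ E]
  [TopologicalSpace M] [ChartedSpace E M]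

/-- Intervals may be single points, where derivatives within `J` are not unique and every
differential equation holds trivially. -/
theorem hasMFDerivWithinAt_of_subsingleton {g : ℝ → M} {J : Set ℝ} (hJ : J.Subsingleton) {t : ℝ}
    (ht : t ∈ J) (g' : ℝ →L[ℝ] E) : HasMFDerivWithinAt 𝓘(ℝ, ℝ) 𝓘(ℝ, E) g J t g' := by
  obtain rfl : J = {t} := hJ.eq_singleton_of_mem ht
  refine ⟨continuousWithinAt_singleton, ?_⟩
  have h : HasFDerivWithinAt (𝕜 := ℝ) (E := ℝ) (F := E) (writtenInExtChartAt 𝓘(ℝ, ℝ) 𝓘(ℝ, E) t g)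
      g' ((extChartAt 𝓘(ℝ, ℝ) t).symm ⁻¹' {t} ∩ range 𝓘(ℝ, ℝ)) (extChartAt 𝓘(ℝ, ℝ) t t) :=
    HasFDerivWithinAt.of_subsingleton fun a ha b hb => by simp_all [mfld_simps, chartAt_self_eq]
  exact h

/-- On the fibre over `x` the bundle trivialization centred at `x` is the identity, so smoothness in
the tangent bundle is smoothness in the model space. -/
theorem contDiffOn_of_contMDiffOn_mk [IsManifold 𝓘(ℝ, E) ∞ M] {x : M} {ξ : ℝ → E} {J : Set ℝ}
    (h : ContMDiffOn 𝓘(ℝ, ℝ) 𝓘(ℝ, E).tangent ∞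
      (fun t => (⟨x, ξ t⟩ : TangentBundle 𝓘(ℝ, E) M)) J) : ContDiffOn ℝ ∞ ξ J := by
  intro t ht
  have h1 := (Bundle.contMDiffWithinAt_totalSpace.1 (h t ht)).2
  have h2 : ∀ v : E, (trivializationAt E (TangentSpace 𝓘(ℝ, E)) x
      (⟨x, v⟩ : TangentBundle 𝓘(ℝ, E) M)).2 = v := fun v =>
    congrArg Prod.snd ((tangentBundleCore 𝓘(ℝ, E) M).localTrivAt_apply_mk x v)
  have h3 := h1.congr_of_eventuallyEq (f₁ := ξ) (Eventually.of_forall fun s => (h2 (ξ s)).symm)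
    (h2 (ξ t)).symm
  exact contMDiffWithinAt_iff_contDiffWithinAt.1 h3

variable {G : Type*} [Group G] [TopologicalSpace G] [ChartedSpace E G] [LieGroup 𝓘(ℝ, E) ∞ G]

theorem mulInvariantVectorField_mfderiv_inv_mul (g : G) (v : E) :
    @Eq E (mulInvariantVectorField (I := 𝓘(ℝ, E)) (G := G)
      (mfderiv 𝓘(ℝ, E) 𝓘(ℝ, E) (g⁻¹ * ·) g v : E) g) v := by
  have hd : ∀ a b : G, MDifferentiableAt 𝓘(ℝ, E) 𝓘(ℝ, E) (a * ·) b := fun a b =>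
    (contMDiff_mul_left (I := 𝓘(ℝ, E)) (n := ∞)).mdifferentiableAt (by simp)
  have h1 := mfderiv_comp_apply_of_eq g (hd g 1) (hd g⁻¹ g) (inv_mul_cancel g) v
  have h2 : (g * ·) ∘ (g⁻¹ * ·) = id := by ext x; simp
  have h3 := DFunLike.congr_fun (mfderiv_congr (I := 𝓘(ℝ, E)) (I' := 𝓘(ℝ, E)) (x := g) h2) v
  have h4 := DFunLike.congr_fun (mfderiv_id (I := 𝓘(ℝ, E)) (x := g)) v
  exact h1.symm.trans (h3.trans h4)

/-- A smooth curve in a Lie group solves `g' = g · ξ` for a smooth curve `ξ` in the Lie algebra. -/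
theorem exists_leftLogDeriv {J : Set ℝ} (hJ : J.OrdConnected) {g : ℝ → G}
    (hg : ContMDiffOn 𝓘(ℝ, ℝ) 𝓘(ℝ, E) ∞ g J) :
    ∃ ξ : ℝ → E, ContDiffOn ℝ ∞ ξ J ∧ ∀ t ∈ J, HasMFDerivWithinAt 𝓘(ℝ, ℝ) 𝓘(ℝ, E) g J t
      ((1 : ℝ →L[ℝ] ℝ).smulRight
        (mulInvariantVectorField (I := 𝓘(ℝ, E)) (G := G) (ξ t) (g t) : E)) := by
  rcases J.subsingleton_or_nontrivial with hs | hn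
  · exact ⟨0, contDiffOn_const, fun t ht => hasMFDerivWithinAt_of_subsingleton hs ht _⟩
  have hJu : UniqueDiffOn ℝ J := uniqueDiffOn_convex hJ.convex (hJ.convex.nontrivial_iff_nonempty_interior.1 hn)
  have hJm : UniqueMDiffOn 𝓘(ℝ, ℝ) J := hJu.uniqueMDiffOn
  have h1 := hg.contMDiffOn_tangentMapWithin (m := ∞) (by simp) hJm
  have h2 : ContMDiff 𝓘(ℝ, ℝ) 𝓘(ℝ, ℝ).tangent ∞
      (fun t : ℝ => (⟨t, (1 : ℝ)⟩ : TangentBundle 𝓘(ℝ, ℝ) ℝ)) :=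
    contMDiff_vectorSpace_iff_contDiff.2 contDiff_const
  have h3 : ContMDiffOn 𝓘(ℝ, ℝ) 𝓘(ℝ, E).tangent ∞
      (fun t : ℝ => tangentMapWithin 𝓘(ℝ, ℝ) 𝓘(ℝ, E) g J ⟨t, (1 : ℝ)⟩) J :=
    h1.comp h2.contMDiffOn (fun t ht => ht)
  have h4 := contMDiff_tangent_mul_left.comp_contMDiffOn (hg.inv.prodMk h3)
  -- `ξ = g⁻¹ g'`, formed in the tangent bundle so that smoothness follows from joint smoothness of
  -- left translation of tangent vectors.
  set ξ : ℝ → E := fun t => mfderiv 𝓘(ℝ, E) 𝓘(ℝ, E) ((g t)⁻¹ * ·) (g t)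
    (mfderivWithin 𝓘(ℝ, ℝ) 𝓘(ℝ, E) g J t (1 : ℝ)) with hξ
  refine ⟨ξ, contDiffOn_of_contMDiffOn_mk (x := (1 : G)) (h4.congr fun t ht => ?_), fun t ht => ?_⟩
  · exact tangentBundle_mk_eq (inv_mul_cancel (g t)).symm rfl
  · have h5 := ((hg.mdifferentiableOn (by simp)) t ht).hasMFDerivWithinAt
    refine h5.congr_mfderiv ?_
    have h6 := mulInvariantVectorField_mfderiv_inv_mul (E := E) (g t)
      (mfderivWithin 𝓘(ℝ, ℝ) 𝓘(ℝ, E) g J t (1 : ℝ))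
    have h7 : ∀ (L : ℝ →L[ℝ] E) (w : E), w = L 1 → L = (1 : ℝ →L[ℝ] ℝ).smulRight w := by
      rintro L _ rfl
      ext
      simp
    exact h7 _ _ h6

end LeftLogarithmicDerivative

/-! ### The reconstruction equation -/

section ReconstructionEquation

variable {EK EW F K W : Type*} [NormedAddCommGroup EK] [NormedSpace ℝ EK]
  [NormedAddCommGroup EW] [NormedSpace ℝ EW] [CompleteSpace EW]
  [Group K] [TopologicalSpace K] [ChartedSpace EK K] [LieGroup 𝓘(ℝ, EK) ∞ K]
  [TopologicalSpace W] [ChartedSpace EW W] [IsManifold 𝓘(ℝ, EW) ∞ W] [T2Space W]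
  [MulAction K W] [ContMDiffSMul 𝓘(ℝ, EK) 𝓘(ℝ, EW) ∞ K W]

/-- If `g₀ • b` is an integral curve of an invariant vector field and `g₀' = g₀ · ξ`, then `g • b` is
an integral curve if and only if `g' = g · ξ`. -/
theorem isMIntegralCurveOn_smul_iff (hfree : ∀ (a : K) (w : W), a • w = w → a = 1)
    {Y : (w : W) → TangentSpace 𝓘(ℝ, EW) w} (hY : IsSmoothVectorField Y)
    (hinv : PreservesVectorField EW K Y) {J : Set ℝ} (hJ : J.OrdConnected) {b : ℝ → W}
    (hb : ContMDiffOn 𝓘(ℝ, ℝ) 𝓘(ℝ, EW) ∞ b J) {g₀ : ℝ → K}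
    (hg₀ : IsMIntegralCurveOn (I := 𝓘(ℝ, EW)) (fun t => g₀ t • b t) Y J) {ξ : ℝ → EK}
    (hξ : ∀ t ∈ J, HasMFDerivWithinAt 𝓘(ℝ, ℝ) 𝓘(ℝ, EK) g₀ J t ((1 : ℝ →L[ℝ] ℝ).smulRight
      (mulInvariantVectorField (I := 𝓘(ℝ, EK)) (G := K) (ξ t) (g₀ t) : EK))) (g : ℝ → K) :
    IsMIntegralCurveOn (I := 𝓘(ℝ, EW)) (fun t => g t • b t) Y J ↔
      ∀ t ∈ J, HasMFDerivWithinAt 𝓘(ℝ, ℝ) 𝓘(ℝ, EK) g J t ((1 : ℝ →L[ℝ] ℝ).smulRight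
        (mulInvariantVectorField (I := 𝓘(ℝ, EK)) (G := K) (ξ t) (g t) : EK)) := by
  have hsm : ∀ a : K, ContMDiff 𝓘(ℝ, EW) 𝓘(ℝ, EW) ∞ (fun w : W => a • w) :=
    contMDiff_const_smul' (EK := EK)
  have hfree' : ∀ (a b : K) (w : W), a • w = b • w → a = b := fun a b w hab => by
    have : (b⁻¹ * a) • w = w := by rw [mul_smul, inv_smul_eq_iff, hab]
    exact (inv_mul_eq_one.1 (hfree _ _ this)).symm
  have htrans : ∀ (a : K), ∀ t ∈ J, HasMFDerivWithinAt 𝓘(ℝ, ℝ) 𝓘(ℝ, EK) (fun t => a * g₀ t) J t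
      ((1 : ℝ →L[ℝ] ℝ).smulRight
        (mulInvariantVectorField (I := 𝓘(ℝ, EK)) (G := K) (ξ t) (a * g₀ t) : EK)) := by
    intro a t ht
    have hd : MDifferentiableAt 𝓘(ℝ, EK) 𝓘(ℝ, EK) (a * ·) (g₀ t) :=
      (contMDiff_mul_left (I := 𝓘(ℝ, EK)) (n := ∞)).mdifferentiableAt (by simp)
    exact (hd.hasMFDerivAt.comp_hasMFDerivWithinAt t (hξ t ht)).congr_mfderiv
      (comp_one_smulRight_eq (F := EK) (F' := EK)
        (mfderiv_mul_left_mulInvariantVectorField (E := EK) (G := K) (ξ t) a (g₀ t)))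
  have hint : ∀ a : K, IsMIntegralCurveOn (I := 𝓘(ℝ, EW)) (fun t => a • g₀ t • b t) Y J :=
    fun a => isMIntegralCurveOn_smul hsm hinv hg₀ a
  constructor
  · intro h t ht
    -- This constant makes `g • b` and `a • g₀ • b` agree at time `t`. Uniqueness makes them agree
    -- on `J`, and freeness gives `g = a g₀` there.
    set a := g t * (g₀ t)⁻¹ with ha
    have h1 : EqOn (fun t => g t • b t) (fun t => a • g₀ t • b t) J :=
      hY.eqOn_of_isMIntegralCurveOn hJ h (hint a) ht (by simp [ha, smul_smul])
    have h2 : ∀ s ∈ J, g s = a * g₀ s := fun s hs =>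
      hfree' _ _ (b s) ((h1 hs).trans (smul_smul _ _ _))
    refine ((htrans a t ht).congr_mono h2 (h2 t ht) subset_rfl).congr_mfderiv ?_
    exact congrArg (fun k : K => (1 : ℝ →L[ℝ] ℝ).smulRight
        (mulInvariantVectorField (I := 𝓘(ℝ, EK)) (G := K) (ξ t) k : EK)) (h2 t ht).symm
  · intro h t ht
    rcases J.subsingleton_or_nontrivial with hs | hn
    · exact hasMFDerivWithinAt_of_subsingleton hs ht _
    have hJu : UniqueMDiffOn 𝓘(ℝ, ℝ) J := (uniqueDiffOn_convex hJ.convex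
      (hJ.convex.nontrivial_iff_nonempty_interior.1 hn)).uniqueMDiffOn
    -- At the single time `t` the curves `g` and `a g₀` agree to first order. Hence `g • b` has
    -- there the velocity of the integral curve `(a g₀) • b`, and no uniqueness theorem on the group
    -- is needed.
    set a := g t * (g₀ t)⁻¹ with ha
    have hat : a * g₀ t = g t := by simp [ha]
    obtain ⟨b', hb'⟩ : ∃ b' : ℝ →L[ℝ] EW, HasMFDerivWithinAt 𝓘(ℝ, ℝ) 𝓘(ℝ, EW) b J t b' :=
      ⟨_, ((hb.mdifferentiableOn (by simp)) t ht).hasMFDerivWithinAt⟩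
    have h1 := hasMFDerivWithinAt_smul (h t ht) hb'
    have h2 := hasMFDerivWithinAt_smul (htrans a t ht) hb'
    have h3 : HasMFDerivWithinAt 𝓘(ℝ, ℝ) 𝓘(ℝ, EW) (fun t => (a * g₀ t) • b t) J t
        ((1 : ℝ →L[ℝ] ℝ).smulRight (Y (a • g₀ t • b t) : EW)) :=
      (hint a t ht).congr_mono (fun s _ => mul_smul _ _ _) (mul_smul _ _ _) subset_rfl
    have h4 := (hJu t ht).eq h2 h3
    have h5 : a • g₀ t • b t = g t • b t := by rw [smul_smul, hat]
    refine h1.congr_mfderiv (Eq.trans ?_ (h4.trans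
      (congrArg (fun w : W => (1 : ℝ →L[ℝ] ℝ).smulRight (Y w : EW)) h5)))
    let D : K → ℝ →L[ℝ] EW := fun k =>
      (mfderiv 𝓘(ℝ, EK) 𝓘(ℝ, EW) (fun a : K => a • b t) k : EK →L[ℝ] EW).comp
        ((1 : ℝ →L[ℝ] ℝ).smulRight
          (mulInvariantVectorField (I := 𝓘(ℝ, EK)) (G := K) (ξ t) k : EK)) +
      (mfderiv 𝓘(ℝ, EW) 𝓘(ℝ, EW) (fun w : W => k • w) (b t) : EW →L[ℝ] EW).comp b'
    exact congrArg D hat.symm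

/-- The reconstruction equation for a smooth lift `b` of an integral curve on the orbit space. -/
theorem exists_reconstruction_equation [NormedAddCommGroup F] [NormedSpace ℝ F] [CompleteSpace F]
    [ChartedSpace F (MulAction.orbitRel.Quotient K W)]
    [T2Space (MulAction.orbitRel.Quotient K W)]
    [IsManifold 𝓘(ℝ, F) ∞ (MulAction.orbitRel.Quotient K W)]
    (hfree : ∀ (a : K) (w : W), a • w = w → a = 1) {m : ℕ}
    (hs : ∀ w : W, LocalSlice EK EW K m w)
    {Y : (w : W) → TangentSpace 𝓘(ℝ, EW) w}
    {Z : (q : MulAction.orbitRel.Quotient K W) → TangentSpace 𝓘(ℝ, F) q}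
    (hY : IsSmoothVectorField Y) (hZ : IsSmoothVectorField Z) (hinv : PreservesVectorField EW K Y)
    (hπ : ContMDiff 𝓘(ℝ, EW) 𝓘(ℝ, F) ∞
      (Quotient.mk (MulAction.orbitRel K W) : W → MulAction.orbitRel.Quotient K W))
    (hYZ : ∀ w, mfderiv 𝓘(ℝ, EW) 𝓘(ℝ, F)
        (Quotient.mk (MulAction.orbitRel K W) : W → MulAction.orbitRel.Quotient K W) w (Y w) =
        Z (Quotient.mk (MulAction.orbitRel K W) w))
    {J : Set ℝ} (hJ : J.OrdConnected) {b : ℝ → W} (hb : ContMDiffOn 𝓘(ℝ, ℝ) 𝓘(ℝ, EW) ∞ b J)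
    (hc : IsMIntegralCurveOn (I := 𝓘(ℝ, F)) (Quotient.mk (MulAction.orbitRel K W) ∘ b) Z J) :
    ∃ ξ : ℝ → EK, ContDiffOn ℝ ∞ ξ J ∧ ∀ g : ℝ → K,
      IsMIntegralCurveOn (I := 𝓘(ℝ, EW)) (fun t => g t • b t) Y J ↔
      ∀ t ∈ J, HasMFDerivWithinAt 𝓘(ℝ, ℝ) 𝓘(ℝ, EK) g J t ((1 : ℝ →L[ℝ] ℝ).smulRight
        (mulInvariantVectorField (I := 𝓘(ℝ, EK)) (G := K) (ξ t) (g t) : EK)) := by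
  rcases J.eq_empty_or_nonempty with rfl | ⟨t₀, ht₀⟩
  · exact ⟨0, contDiffOn_const, fun g => ⟨fun _ t ht => absurd ht (notMem_empty t),
      fun _ t ht => absurd ht (notMem_empty t)⟩⟩
  -- One integral curve `γ` over the projection of `b` is enough: it equals `g₀ • b`, and `ξ` is the
  -- logarithmic derivative of `g₀`.
  obtain ⟨γ, hγ, -, hγc⟩ := exists_lift_isMIntegralCurveOn hY hZ (contMDiff_const_smul' (EK := EK))
    hinv hπ hYZ hJ hc ht₀ (p₀ := b t₀) rfl
  have hex : ∀ t, ∃ a : K, t ∈ J → γ t = a • b t := by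
    intro t
    by_cases ht : t ∈ J
    · obtain ⟨a, ha⟩ := orbitMk_eq_iff.1 (hγc t ht)
      exact ⟨a, fun _ => ha.symm⟩
    · exact ⟨1, fun h => absurd h ht⟩
  choose g₀ hg₀ using hex
  have hγs := hY.contMDiffOn_of_isMIntegralCurveOn hJ hγ
  have hg₀s : ContMDiffOn 𝓘(ℝ, ℝ) 𝓘(ℝ, EK) ∞ g₀ J := fun t ht =>
    LocalSlice.contMDiffWithinAt_of_eq_smul hfree hs ht hg₀ (hγs t ht) (hb t ht)
  obtain ⟨ξ, hξ, hξg⟩ := exists_leftLogDeriv hJ hg₀s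
  refine ⟨ξ, hξ, isMIntegralCurveOn_smul_iff hfree hY hinv hJ hb ?_ hξg⟩
  exact isMIntegralCurveOn_of_local fun t _ => ⟨univ, γ, isOpen_univ, mem_univ t,
    hγ.mono inter_subset_left, fun s hs => (hg₀ s hs.1).symm⟩

end ReconstructionEquation

/-! ### Isotropy along integral curves -/

section Flow

/-- The isotropy group is constant along integral curves of an invariant vector field. -/
theorem stabilizer_eq_of_isMIntegralCurveOn {E G P : Type*} [NormedAddCommGroup E]
    [NormedSpace ℝ E] [FiniteDimensional ℝ E] [Group G] [TopologicalSpace P] [ChartedSpace E P]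
    [IsManifold 𝓘(ℝ, E) ∞ P] [T2Space P] [MulAction G P]
    {X : (p : P) → TangentSpace 𝓘(ℝ, E) p} {J : Set ℝ} {γ : ℝ → P} (hX : IsSmoothVectorField X)
    (hsm : ∀ g : G, ContMDiff 𝓘(ℝ, E) 𝓘(ℝ, E) ∞ (fun p : P => g • p))
    (hinv : PreservesVectorField E G X) (hJ : J.OrdConnected)
    (hγ : IsMIntegralCurveOn (I := 𝓘(ℝ, E)) γ X J) {s t : ℝ} (hs : s ∈ J) (ht : t ∈ J) :
    MulAction.stabilizer G (γ s) = MulAction.stabilizer G (γ t) := by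
  -- If `g` fixes `γ s`, then `g • γ` and `γ` are integral curves through the same point, so `g`
  -- fixes `γ t` as well.
  have key : ∀ s ∈ J, ∀ t ∈ J, MulAction.stabilizer G (γ s) ≤ MulAction.stabilizer G (γ t) :=
    fun s hs t ht g hg => hX.eqOn_of_isMIntegralCurveOn hJ
      (isMIntegralCurveOn_smul hsm hinv hγ g) hγ hs hg ht
  exact le_antisymm (key s hs t ht) (key t ht s hs)

variable {EG E G P : Type*} [NormedAddCommGroup EG] [NormedSpace ℝ EG]
  [NormedAddCommGroup E] [NormedSpace ℝ E]
  [Group G] [TopologicalSpace G] [ChartedSpace EG G]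
  [TopologicalSpace P] [ChartedSpace E P] [MulAction G P]

theorem mem_range_dimPartIncl [ContMDiffSMul 𝓘(ℝ, EG) 𝓘(ℝ, E) ∞ G P] {H : Subgroup G} {d : ℕ}
    {p : P} : p ∈ range (dimPartIncl EG E (P := P) H d) ↔
      p ∈ isotropySet P H ∧ HasSliceChart E (isotropySet P H) p d := by
  constructor
  · rintro ⟨w, rfl⟩
    exact ⟨w.1.2, w.2⟩
  · rintro ⟨h1, h2⟩
    exact ⟨⟨⟨p, h1⟩, h2⟩, rfl⟩

theorem isEmbedding_dimPartIncl [ContMDiffSMul 𝓘(ℝ, EG) 𝓘(ℝ, E) ∞ G P] {H : Subgroup G} {d : ℕ} :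
    IsEmbedding (dimPartIncl EG E (P := P) H d) :=
  IsEmbedding.subtypeVal.comp IsEmbedding.subtypeVal

variable [FiniteDimensional ℝ E] [IsManifold 𝓘(ℝ, E) ∞ P] [T2Space P]
  {X : (p : P) → TangentSpace 𝓘(ℝ, E) p} {J : Set ℝ} {γ : ℝ → P}

/-- An integral curve of an invariant vector field that meets a part of constant dimension of an
isotropy submanifold stays in it. -/
theorem mem_range_dimPartIncl_of_isMIntegralCurveOn [ContMDiffSMul 𝓘(ℝ, EG) 𝓘(ℝ, E) ∞ G P]
    {H : Subgroup G} (hH : IsEmbeddedSubmanifold E (isotropySet P H)) {d : ℕ}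
    (hX : IsSmoothVectorField X)
    (hinv : PreservesVectorField E G X) (hJ : J.OrdConnected)
    (hγ : IsMIntegralCurveOn (I := 𝓘(ℝ, E)) γ X J) {s t : ℝ} (hs : s ∈ J) (ht : t ∈ J)
    (h : γ s ∈ range (dimPartIncl EG E (P := P) H d)) :
    γ t ∈ range (dimPartIncl EG E (P := P) H d) := by
  obtain ⟨h1, h2⟩ := mem_range_dimPartIncl.1 h
  have hmem : ∀ t ∈ J, γ t ∈ isotropySet P H := fun t ht =>
    (stabilizer_eq_of_isMIntegralCurveOn (G := G) hX (contMDiff_const_smul' (EK := EG)) hinv hJ hγ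
      ht hs).trans h1
  have hd : ∀ t, ∃ d, t ∈ J → HasSliceChart E (isotropySet P H) (γ t) d := fun t => by
    by_cases ht : t ∈ J
    · obtain ⟨d, hd⟩ := hH _ (hmem t ht)
      exact ⟨d, fun _ => hd⟩
    · exact ⟨0, fun h => absurd h ht⟩
  choose D hD using hd
  -- A slice chart serves all nearby points of `P_H`, so the dimension is locally constant along `γ`
  -- and therefore constant on the interval.
  have hconst : D s = D t := by
    refine hJ.isPreconnected.induction₂ (fun x y => D x = D y) (fun x hx => ?_)
      (fun x y z _ _ _ h h' => h.trans h') (fun x y _ _ h => h.symm) hs ht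
    filter_upwards [(hγ x hx).continuousWithinAt.eventually (hD x hx).eventually,
      self_mem_nhdsWithin] with y hy hyJ
    exact (hy (hmem y hyJ)).unique (hD y hyJ)
  exact mem_range_dimPartIncl.2 ⟨hmem t ht, by
    rw [h2.unique (hD s hs), hconst]
    exact hD t ht⟩

end Flow

/-! ### The action of `G_H` on `P_H` -/

section Isotropy

theorem isotropyAction_free {G P : Type*} [Group G] [MulAction G P] {H : Subgroup G}
    (a : NormalizerQuotient H) (p : ↥(isotropySet P H)) (h : a • p = p) :
    a = 1 := by
  induction a using QuotientGroup.induction_on with | H n => ?_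
  have h1 : (n : G) • (p : P) = p := congrArg Subtype.val h
  have h2 : (n : G) ∈ MulAction.stabilizer G (p : P) := h1
  rw [show MulAction.stabilizer G (p : P) = H from p.2] at h2
  exact (QuotientGroup.eq_one_iff n).2 h2

/-- An element of `G` that maps a point of `P_H` to a point of `P_H` normalizes `H`. -/
theorem mem_normalizer_of_smul_mem {G P : Type*} [Group G] [MulAction G P] {H : Subgroup G}
    {g : G} {p : P} (hp : p ∈ isotropySet P H)
    (hgp : g • p ∈ isotropySet P H) : g ∈ Subgroup.normalizer (H : Set G) := by
  have hp' : MulAction.stabilizer G p = H := hp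
  have hgp' : MulAction.stabilizer G (g • p) = H := hgp
  refine Subgroup.mem_normalizer_iff.2 fun h => ?_
  conv_lhs => rw [← hp']
  conv_rhs => rw [← hgp']
  rw [MulAction.mem_stabilizer_iff, MulAction.mem_stabilizer_iff, smul_smul, inv_mul_cancel_right,
    mul_smul, smul_left_cancel_iff]

variable {EG E G P : Type*} [NormedAddCommGroup EG] [NormedSpace ℝ EG]
  [NormedAddCommGroup E] [NormedSpace ℝ E]
  [Group G] [TopologicalSpace G] [ChartedSpace EG G]
  [TopologicalSpace P] [ChartedSpace E P] [MulAction G P] {H : Subgroup G}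

variable [ContMDiffSMul 𝓘(ℝ, EG) 𝓘(ℝ, E) ∞ G P] {d : ℕ}

theorem dimPart_free (a : NormalizerQuotient H) (p : ↥(dimPart EG E (P := P) H d)) (h : a • p = p) :
    a = 1 :=
  isotropyAction_free a (p : ↥(isotropySet P H)) (congrArg Subtype.val h)

/-- An element of `G` relating two points of `P_H` normalizes `H`, because isotropy groups along an
orbit are conjugate. Its class in `G_H` then relates the points. -/
theorem injective_reducedIncl : Function.Injective (reducedIncl EG E (P := P) H d) := by
  intro q q'
  obtain ⟨w, rfl⟩ := Quotient.exists_rep q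
  obtain ⟨w', rfl⟩ := Quotient.exists_rep q'
  intro h
  obtain ⟨g, hg⟩ := orbitMk_eq_iff.1 h
  have hgw : g • dimPartIncl EG E H d w' ∈ isotropySet P H := by
    rw [hg]
    exact w.1.2
  refine orbitMk_eq_iff.2 ⟨((⟨g, mem_normalizer_of_smul_mem w'.1.2 hgw⟩ :
    ↥(Subgroup.normalizer (H : Set G))) : NormalizerQuotient H), ?_⟩
  exact Subtype.ext (Subtype.ext hg)

theorem isOpen_dimPart : IsOpen (dimPart EG E (P := P) H d : Set ↥(isotropySet P H)) := by
  rw [isOpen_iff_mem_nhds]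
  intro p hp
  have h1 : HasSliceChart E (isotropySet P H) (p : P) d := hp
  filter_upwards [continuous_subtype_val.continuousAt.eventually h1.eventually] with q hq
  exact hq q.2

/-- The action of `G_H` on the parts of constant dimension of `P_H` is smooth. -/
theorem contMDiffSMul_dimPart {k : ℕ}
    [ChartedSpace (EuclideanSpace ℝ (Fin k)) (NormalizerQuotient H)]
    [ChartedSpace (EuclideanSpace ℝ (Fin d)) ↥(dimPart EG E (P := P) H d)]
    (hK : IsSmoothSpan EG (EuclideanSpace ℝ (Fin k))
      (Subtype.val : ↥(Subgroup.normalizer (H : Set G)) → G)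
      (QuotientGroup.mk : _ → NormalizerQuotient H))
    (hW : IsSmoothSpan E (EuclideanSpace ℝ (Fin d)) (dimPartIncl EG E (P := P) H d)
      (id : ↥(dimPart EG E (P := P) H d) → _)) :
    ContMDiffSMul (𝓡 k) (𝓡 d) ∞ (NormalizerQuotient H) ↥(dimPart EG E (P := P) H d) := by
  refine ⟨fun p => ?_⟩
  -- A local section lifts the group factor to `G`, where the action on `P` is smooth; the result
  -- lies in the embedded part of `P_H`.
  obtain ⟨V, σ, hV, hpV, hσ, hπσ⟩ := hK.exists_sec p.1
  have h1 : ContMDiffAt ((𝓡 k).prod (𝓡 d)) 𝓘(ℝ, EG) ∞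
      (fun x : NormalizerQuotient H × ↥(dimPart EG E (P := P) H d) => (σ x.1 : G)) p :=
    ContMDiffAt.comp p (g := fun a => (σ a : G)) (hσ.contMDiffAt (hV.mem_nhds hpV))
      contMDiffAt_fst
  have h2 : ContMDiffAt ((𝓡 k).prod (𝓡 d)) 𝓘(ℝ, E) ∞
      (fun x : NormalizerQuotient H × ↥(dimPart EG E (P := P) H d) =>
        dimPartIncl EG E H d x.2) p :=
    ContMDiffAt.comp p (g := dimPartIncl EG E H d) hW.contMDiff_incl.contMDiffAt contMDiffAt_snd
  have h3 : ContMDiffAt ((𝓡 k).prod (𝓡 d)) 𝓘(ℝ, E) ∞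
      (fun x : NormalizerQuotient H × ↥(dimPart EG E (P := P) H d) =>
        (σ x.1 : G) • dimPartIncl EG E H d x.2) p :=
    ContMDiffAt.comp p (ContMDiffSMul.contMDiff_smul (I := 𝓘(ℝ, EG)) (I' := 𝓘(ℝ, E)) (n := ∞)
      (G := G) (M := P)).contMDiffAt (h1.prodMk h2)
  have h4 : ContMDiffAt ((𝓡 k).prod (𝓡 d)) 𝓘(ℝ, E) ∞
      (fun x : NormalizerQuotient H × ↥(dimPart EG E (P := P) H d) =>
        dimPartIncl EG E H d (x.1 • x.2)) p := by
    refine h3.congr_of_eventuallyEq ?_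
    filter_upwards [continuous_fst.continuousAt.preimage_mem_nhds (hV.mem_nhds hpV)] with x hx
    exact congrArg (fun a : NormalizerQuotient H => dimPartIncl EG E H d (a • x.2))
      (hπσ x.1 hx).symm
  exact hW.contMDiffWithinAt (s := univ) (g := fun x : NormalizerQuotient H ×
    ↥(dimPart EG E (P := P) H d) => x.1 • x.2) h4

variable [FiniteDimensional ℝ E]

theorem existsUnique_mem_dimPart (hH : IsEmbeddedSubmanifold E (isotropySet P H))
    (p : ↥(isotropySet P H)) : ∃! d : ℕ, p ∈ dimPart EG E (P := P) H d := by
  obtain ⟨d, hd⟩ := hH p p.2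
  exact ⟨d, hd, fun d' hd' => HasSliceChart.unique hd' hd⟩

/-- The complement is the union of the other parts, which are open. Closedness is what lets
properness pass to a single part. -/
theorem isClosed_dimPart (hH : IsEmbeddedSubmanifold E (isotropySet P H)) :
    IsClosed (dimPart EG E (P := P) H d : Set ↥(isotropySet P H)) := by
  have : (dimPart EG E (P := P) H d : Set ↥(isotropySet P H)) =
      (⋃ d' ∈ {d' | d' ≠ d}, (dimPart EG E (P := P) H d' : Set ↥(isotropySet P H)))ᶜ := by
    ext p
    obtain ⟨d₀, hd₀, hun⟩ := existsUnique_mem_dimPart (EG := EG) hH p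
    simp only [mem_compl_iff, mem_iUnion, not_exists]
    constructor
    · intro hp d' hd' hp'
      exact hd' ((hun d' hp').trans (hun d hp).symm)
    · intro h
      by_cases hd : d₀ = d
      · exact hd ▸ hd₀
      · exact absurd hd₀ (h d₀ hd)
  rw [this]
  exact (isOpen_biUnion fun d' _ => isOpen_dimPart).isClosed_compl

/-- A proper map restricted to a closed subset is proper, and properness of a composition with an
injective continuous map passes to the first factor. -/
theorem properSMul_dimPart (hH : IsEmbeddedSubmanifold E (isotropySet P H))
    (h : ProperSMul (NormalizerQuotient H) ↥(isotropySet P H)) :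
    ProperSMul (NormalizerQuotient H) ↥(dimPart EG E (P := P) H d) := by
  have hc : IsClosedEmbedding (Subtype.val : ↥(dimPart EG E (P := P) H d) → ↥(isotropySet P H)) :=
    (isClosed_dimPart hH).isClosedEmbedding_subtypeVal
  have hsm : Continuous fun x : NormalizerQuotient H × ↥(dimPart EG E (P := P) H d) => x.1 • x.2 := by
    rw [hc.isInducing.continuous_iff]
    exact continuous_fst.smul (continuous_subtype_val.comp continuous_snd)
  refine ⟨isProperMap_of_comp_of_inj (hsm.prodMk continuous_snd)
    (hc.continuous.prodMap hc.continuous) ?_ (hc.injective.prodMap hc.injective)⟩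
  exact (ProperSMul.isProperMap_smul_pair (G := NormalizerQuotient H)
    (X := ↥(isotropySet P H))).comp (isProperMap_id.prodMap hc.isProperMap)

end Isotropy

/-! ### Reduced vector fields and their equations -/

section Reduction

variable {EG E G P : Type*} [NormedAddCommGroup EG] [NormedSpace ℝ EG]
  [NormedAddCommGroup E] [NormedSpace ℝ E]
  [Group G] [TopologicalSpace G] [ChartedSpace EG G]
  [TopologicalSpace P] [ChartedSpace E P] [MulAction G P]
  [ContMDiffSMul 𝓘(ℝ, EG) 𝓘(ℝ, E) ∞ G P] {H : Subgroup G} {k d m : ℕ}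
  [ChartedSpace (EuclideanSpace ℝ (Fin d)) ↥(dimPart EG E (P := P) H d)]
  {X : (p : P) → TangentSpace 𝓘(ℝ, E) p}
  {XH : (p : ↥(dimPart EG E (P := P) H d)) → TangentSpace (𝓡 d) p}

/-- The restriction of an invariant vector field to `P_H` is invariant under `G_H`. -/
theorem preservesVectorField_restrict
    (hsm : ∀ a : NormalizerQuotient H, ContMDiff (𝓡 d) (𝓡 d) ∞
      (fun w : ↥(dimPart EG E (P := P) H d) => a • w))
    (hW : IsSmoothSpan E (EuclideanSpace ℝ (Fin d)) (dimPartIncl EG E (P := P) H d)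
      (id : ↥(dimPart EG E (P := P) H d) → _))
    (hinv : PreservesVectorField E G X)
    (hXH : ∀ w, mfderiv (𝓡 d) 𝓘(ℝ, E) (dimPartIncl EG E H d) w (XH w) =
      X (dimPartIncl EG E H d w)) :
    PreservesVectorField (EuclideanSpace ℝ (Fin d)) (NormalizerQuotient H) XH := by
  intro a w
  -- The identity is checked after inclusion into `P`, where the action of a class in `G_H` becomes
  -- that of a representative, which preserves `X`.
  refine hW.mfderiv_incl_injective (w := a • w) ?_
  have hι : ∀ w, MDifferentiableAt (𝓡 d) 𝓘(ℝ, E) (dimPartIncl EG E (P := P) H d) w := fun w =>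
    hW.contMDiff_incl.mdifferentiableAt (by simp)
  have h1 := mfderiv_comp_apply w (hι (a • w)) ((hsm a).mdifferentiableAt (by simp)) (XH w)
  refine h1.symm.trans (Eq.trans ?_ (hXH (a • w)).symm)
  induction a using QuotientGroup.induction_on with | H n => ?_
  have h2 := mfderiv_comp_apply w
    ((contMDiff_const_smul' (EK := EG) (EW := E) (W := P) (n : G)).mdifferentiableAt
      (x := dimPartIncl EG E H d w) (by simp)) (hι w) (XH w)
  refine h2.trans (Eq.trans ?_ (hinv n (dimPartIncl EG E H d w)))
  exact congrArg (mfderiv 𝓘(ℝ, E) 𝓘(ℝ, E) (fun q : P => (n : G) • q) (dimPartIncl EG E H d w) :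
    E → E) (hXH w)

variable [ChartedSpace (EuclideanSpace ℝ (Fin k)) (NormalizerQuotient H)]
  [ChartedSpace (EuclideanSpace ℝ (Fin m)) (ReducedSpace EG E P H d)]
  {Xred : (q : ReducedSpace EG E P H d) → TangentSpace (𝓡 m) q}

/-- A function on the orbit space is smooth if and only if its pull-back is. -/
theorem contMDiff_comp_reducedProj_iff
    (hQ : IsSmoothSpan (EuclideanSpace ℝ (Fin d)) (EuclideanSpace ℝ (Fin m))
      (id : ↥(dimPart EG E (P := P) H d) → _) (reducedProj EG E H d))
    (f : ReducedSpace EG E P H d → ℝ) : ContMDiff (𝓡 m) 𝓘(ℝ, ℝ) ∞ f ↔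
      ContMDiff (𝓡 d) 𝓘(ℝ, ℝ) ∞ (f ∘ reducedProj EG E H d) :=
  ⟨fun hf => hf.comp (hQ.contMDiff (g := id) contMDiff_id), fun hf => hQ.contMDiff_of_ext fun _ =>
    ⟨univ, f ∘ reducedProj EG E H d, isOpen_univ, mem_univ _, hf.contMDiffOn, fun _ _ => rfl⟩⟩

theorem contMDiff_comp_reducedIncl
    (hW : IsSmoothSpan E (EuclideanSpace ℝ (Fin d)) (dimPartIncl EG E (P := P) H d)
      (id : ↥(dimPart EG E (P := P) H d) → _))
    (hQ : IsSmoothSpan (EuclideanSpace ℝ (Fin d)) (EuclideanSpace ℝ (Fin m))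
      (id : ↥(dimPart EG E (P := P) H d) → _) (reducedProj EG E H d))
    {f : MulAction.orbitRel.Quotient G P → ℝ}
    (hf : ContMDiff 𝓘(ℝ, E) 𝓘(ℝ, ℝ) ∞ (f ∘ orbitProj G)) :
    ContMDiff (𝓡 m) 𝓘(ℝ, ℝ) ∞ (f ∘ reducedIncl EG E H d) :=
  (contMDiff_comp_reducedProj_iff hQ _).2 (hf.comp hW.contMDiff_incl)

/-- Inclusion into `P` followed by `ρ` equals `ρ_H` followed by `ε_H`; the chain rule is applied to
both factorizations. -/
theorem mfderiv_comp_reducedIncl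
    (hW : IsSmoothSpan E (EuclideanSpace ℝ (Fin d)) (dimPartIncl EG E (P := P) H d)
      (id : ↥(dimPart EG E (P := P) H d) → _))
    (hQ : IsSmoothSpan (EuclideanSpace ℝ (Fin d)) (EuclideanSpace ℝ (Fin m))
      (id : ↥(dimPart EG E (P := P) H d) → _) (reducedProj EG E H d))
    (hXH : ∀ w, mfderiv (𝓡 d) 𝓘(ℝ, E) (dimPartIncl EG E H d) w (XH w) =
      X (dimPartIncl EG E H d w))
    (hred : ∀ w, mfderiv (𝓡 d) (𝓡 m) (reducedProj EG E H d) w (XH w) =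
      Xred (reducedProj EG E H d w))
    {f : MulAction.orbitRel.Quotient G P → ℝ}
    (hf : ContMDiff 𝓘(ℝ, E) 𝓘(ℝ, ℝ) ∞ (f ∘ orbitProj G)) (w : ↥(dimPart EG E (P := P) H d)) :
    (mfderiv (𝓡 m) 𝓘(ℝ, ℝ) (f ∘ reducedIncl EG E H d) (reducedProj EG E H d w)
      (Xred (reducedProj EG E H d w)) : ℝ) =
    mfderiv 𝓘(ℝ, E) 𝓘(ℝ, ℝ) (f ∘ orbitProj G) (dimPartIncl EG E H d w)
      (X (dimPartIncl EG E H d w)) := by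
  have h1 := mfderiv_comp_apply w
    ((contMDiff_comp_reducedIncl hW hQ hf).mdifferentiableAt (x := reducedProj EG E H d w)
      (by simp)) ((hQ.contMDiff (g := id) contMDiff_id).mdifferentiableAt (by simp)) (XH w)
  have h2 := mfderiv_comp_apply w
    (hf.mdifferentiableAt (x := dimPartIncl EG E H d w) (by simp))
    (hW.contMDiff_incl.mdifferentiableAt (by simp)) (XH w)
  have h3 : @Eq ℝ (mfderiv (𝓡 m) 𝓘(ℝ, ℝ) (f ∘ reducedIncl EG E H d) (reducedProj EG E H d w)
      (Xred (reducedProj EG E H d w))) (mfderiv (𝓡 m) 𝓘(ℝ, ℝ) (f ∘ reducedIncl EG E H d)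
        (reducedProj EG E H d w) (mfderiv (𝓡 d) (𝓡 m) (reducedProj EG E H d) w (XH w))) :=
    congrArg (mfderiv (𝓡 m) 𝓘(ℝ, ℝ) (f ∘ reducedIncl EG E H d) (reducedProj EG E H d w) :
      EuclideanSpace ℝ (Fin m) → ℝ) (hred w).symm
  refine h3.trans (h1.symm.trans (h2.trans ?_))
  exact congrArg (mfderiv 𝓘(ℝ, E) 𝓘(ℝ, ℝ) (f ∘ orbitProj G) (dimPartIncl EG E H d w) : E → ℝ)
    (hXH w)

/-- Invariant vector fields related by the inclusion of `P_H` and the orbit map satisfy the reduced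
and the reconstruction equations. -/
theorem isReductionOn_of_related [LieGroup (𝓡 k) ∞ (NormalizerQuotient H)]
    [T2Space P] [IsManifold (𝓡 d) ∞ ↥(dimPart EG E (P := P) H d)]
    [IsManifold (𝓡 m) ∞ (ReducedSpace EG E P H d)] [T2Space (ReducedSpace EG E P H d)]
    [ContMDiffSMul (𝓡 k) (𝓡 d) ∞ (NormalizerQuotient H) ↥(dimPart EG E (P := P) H d)]
    (hW : IsSmoothSpan E (EuclideanSpace ℝ (Fin d)) (dimPartIncl EG E (P := P) H d)
      (id : ↥(dimPart EG E (P := P) H d) → _))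
    (hQ : IsSmoothSpan (EuclideanSpace ℝ (Fin d)) (EuclideanSpace ℝ (Fin m))
      (id : ↥(dimPart EG E (P := P) H d) → _) (reducedProj EG E H d))
    (hs : ∀ w : ↥(dimPart EG E (P := P) H d), LocalSlice (EuclideanSpace ℝ (Fin k))
      (EuclideanSpace ℝ (Fin d)) (NormalizerQuotient H) m w)
    (hinv : PreservesVectorField (EuclideanSpace ℝ (Fin d)) (NormalizerQuotient H) XH)
    (hsmH : IsSmoothVectorField XH) (hsmred : IsSmoothVectorField Xred)
    (hXH : ∀ w, mfderiv (𝓡 d) 𝓘(ℝ, E) (dimPartIncl EG E H d) w (XH w) =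
      X (dimPartIncl EG E H d w))
    (hred : ∀ w, mfderiv (𝓡 d) (𝓡 m) (reducedProj EG E H d) w (XH w) =
      Xred (reducedProj EG E H d w)) :
    IsReductionOn (k := k) EG E X H XH Xred := by
  have hρ : ContMDiff (𝓡 d) (𝓡 m) ∞ (reducedProj EG E (P := P) H d) :=
    hQ.contMDiff (g := id) contMDiff_id
  have hiff : ∀ {γ : ℝ → ↥(dimPart EG E (P := P) H d)} {J : Set ℝ},
      IsMIntegralCurveOn (I := 𝓘(ℝ, E)) (dimPartIncl EG E H d ∘ γ) X J ↔
        IsMIntegralCurveOn (I := 𝓡 d) γ XH J := hW.isMIntegralCurveOn_restrict_iff hXH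
  have : T2Space ↥(dimPart EG E (P := P) H d) := isEmbedding_dimPartIncl.t2Space
  refine ⟨hXH, hred, fun f hf => ⟨contMDiff_comp_reducedIncl hW hQ hf,
    mfderiv_comp_reducedIncl hW hQ hXH hred hf⟩, fun J _ γ hγ => ?_, fun J hJ c hc t₀ ht₀ p₀ hp₀ =>
    ?_, fun J hJ b hb hc => ?_⟩
  · exact isMIntegralCurveOn_comp_of_related (fun t _ => hρ.mdifferentiableAt (by simp))
      (fun t _ => hred (γ t)) (hiff.1 hγ)
  · obtain ⟨γ, hγ, hγ₀, hγc⟩ := exists_lift_isMIntegralCurveOn hsmH hsmred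
      (contMDiff_const_smul' (EK := EuclideanSpace ℝ (Fin k))) hinv hρ hred hJ hc ht₀ hp₀
    exact ⟨γ, hγ₀, hiff.2 hγ, hγc⟩
  · obtain ⟨ξ, hξ, h⟩ := exists_reconstruction_equation dimPart_free hs hsmH hsmred hinv hρ hred
      hJ hb hc
    exact ⟨ξ, hξ, fun g => hiff.trans (h g)⟩

end Reduction

/-! ### Assembly of the theorem -/

section Main

variable {EG E G P : Type*}
  [NormedAddCommGroup EG] [NormedSpace ℝ EG]
  [NormedAddCommGroup E] [NormedSpace ℝ E] [FiniteDimensional ℝ E]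
  [Group G] [TopologicalSpace G] [ChartedSpace EG G]
  [TopologicalSpace P] [ChartedSpace E P] [IsManifold 𝓘(ℝ, E) ∞ P] [T2Space P]
  [MulAction G P] [ContMDiffSMul 𝓘(ℝ, EG) 𝓘(ℝ, E) ∞ G P]
  {X : (p : P) → TangentSpace 𝓘(ℝ, E) p}

/-- `H` is the isotropy group of one point of the curve, closed as the preimage of a point under the
orbit map. -/
theorem IsPolite.exists_mem_range_dimPartIncl (hpolite : IsPolite E G P)
    (hX : IsSmoothVectorField X) (hinv : PreservesVectorField E G X) {J : Set ℝ}
    (hJ : J.OrdConnected) (hne : J.Nonempty) {γ : ℝ → P}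
    (hγ : IsMIntegralCurveOn (I := 𝓘(ℝ, E)) γ X J) :
    ∃ H : Subgroup G, IsClosed (H : Set G) ∧ ∃ d : ℕ,
      ∀ t ∈ J, γ t ∈ range (dimPartIncl EG E (P := P) H d) := by
  obtain ⟨t₀, ht₀⟩ := hne
  have hcl : IsClosed (MulAction.stabilizer G (γ t₀) : Set G) :=
    isClosed_singleton.preimage (contMDiff_smul_const' (EK := EG) (EW := E) (γ t₀)).continuous
  have hH := (hpolite _ hcl).1
  obtain ⟨d, hd⟩ := hH (γ t₀) rfl
  exact ⟨_, hcl, d, fun t ht => mem_range_dimPartIncl_of_isMIntegralCurveOn hH hX hinv hJ hγ ht₀ ht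
    (mem_range_dimPartIncl.2 ⟨rfl, hd⟩)⟩

variable [SecondCountableTopology P]

/-- The part of constant dimension of `P_H` is a principal bundle over its orbit space, and an
invariant vector field is reduced to the orbit space. -/
theorem exists_bundle_dimPart {H : Subgroup G} {k : ℕ}
    [ChartedSpace (EuclideanSpace ℝ (Fin k)) (NormalizerQuotient H)]
    [LieGroup (𝓡 k) ∞ (NormalizerQuotient H)] [T2Space (NormalizerQuotient H)]
    (hK : IsSmoothSpan EG (EuclideanSpace ℝ (Fin k))
      (Subtype.val : ↥(Subgroup.normalizer (H : Set G)) → G)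
      (QuotientGroup.mk : _ → NormalizerQuotient H))
    (hH : IsEmbeddedSubmanifold E (isotropySet P H))
    (hproper : ProperSMul (NormalizerQuotient H) ↥(isotropySet P H))
    (hX : IsSmoothVectorField X) (hinv : PreservesVectorField E G X) (d : ℕ) :
    ∃ (_ : ChartedSpace (EuclideanSpace ℝ (Fin d)) ↥(dimPart EG E (P := P) H d))
      (_ : IsManifold (𝓡 d) ∞ ↥(dimPart EG E (P := P) H d)) (m : ℕ)
      (_ : ChartedSpace (EuclideanSpace ℝ (Fin m)) (ReducedSpace EG E P H d))
      (_ : IsManifold (𝓡 m) ∞ (ReducedSpace EG E P H d)),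
      Manifold.IsSmoothEmbedding (𝓡 d) 𝓘(ℝ, E) ∞ (dimPartIncl EG E (P := P) H d) ∧
      T2Space (ReducedSpace EG E P H d) ∧
      SecondCountableTopology (ReducedSpace EG E P H d) ∧
      IsSmoothPrincipalBundle (k := k) (d := d) (m := m) (NormalizerQuotient H)
        ↥(dimPart EG E (P := P) H d) (ReducedSpace EG E P H d) (reducedProj EG E H d) ∧
      (∀ f : ReducedSpace EG E P H d → ℝ, ContMDiff (𝓡 m) 𝓘(ℝ, ℝ) ∞ f ↔
        ContMDiff (𝓡 d) 𝓘(ℝ, ℝ) ∞ (f ∘ reducedProj EG E H d)) ∧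
      Function.Injective (reducedIncl EG E (P := P) H d) ∧
      ∃ (XH : (p : ↥(dimPart EG E (P := P) H d)) → TangentSpace (𝓡 d) p)
        (Xred : (q : ReducedSpace EG E P H d) → TangentSpace (𝓡 m) q),
        IsSmoothVectorField XH ∧ IsSmoothVectorField Xred ∧
        IsReductionOn (k := k) EG E X H XH Xred := by
  obtain ⟨hc, hemb⟩ := exists_spanChart_isSmoothEmbedding
    (isEmbedding_dimPartIncl (EG := EG) (E := E) (P := P) (H := H) (d := d))
    (fun p => mem_range_dimPartIncl)
  let _ := SpanChart.chartedSpace hc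
  have _ := SpanChart.isManifold hc
  have hW := SpanChart.isSmoothSpan hc
  have _ : T2Space ↥(dimPart EG E (P := P) H d) := isEmbedding_dimPartIncl.t2Space
  have _ : SecondCountableTopology ↥(dimPart EG E (P := P) H d) :=
    isEmbedding_dimPartIncl.secondCountableTopology
  have _ := contMDiffSMul_dimPart hK hW
  have _ : ProperSMul (NormalizerQuotient H) ↥(dimPart EG E (P := P) H d) :=
    properSMul_dimPart hH hproper
  -- Freeness and properness of the action on this part supply a slice through every point, from
  -- which the charts of the orbit space and the trivializations follow.
  have hs := fun w => Classical.choice (nonempty_localSlice (EK := EuclideanSpace ℝ (Fin k))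
    (EW := EuclideanSpace ℝ (Fin d)) (dimPart_free (EG := EG) (E := E) (P := P) (H := H) (d := d)) w)
  obtain ⟨hq⟩ := LocalSlice.nonempty_spanChart_all hs
  let _ := SpanChart.chartedSpace hq
  have _ := SpanChart.isManifold hq
  have hQ := SpanChart.isSmoothSpan hq
  have hsm := contMDiff_const_smul' (EK := EuclideanSpace ℝ (Fin k))
    (EW := EuclideanSpace ℝ (Fin d)) (K := NormalizerQuotient H)
    (W := ↥(dimPart EG E (P := P) H d))
  have ht2 : T2Space (ReducedSpace EG E P H d) := t2Space_quotient_mulAction_of_properSMul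
  have _ : ContinuousConstSMul (NormalizerQuotient H) ↥(dimPart EG E (P := P) H d) :=
    ⟨fun a => (hsm a).continuous⟩
  have hsc : SecondCountableTopology (ReducedSpace EG E P H d) :=
    ContinuousConstSMul.secondCountableTopology
  obtain ⟨XH, hsmH, hXH⟩ := hW.exists_restrict hX fun J hJ γ hγ t₀ ht₀ h t ht =>
    mem_range_dimPartIncl_of_isMIntegralCurveOn hH hX hinv hJ hγ ht₀ ht h
  have hinvH := preservesVectorField_restrict hsm hW hinv hXH
  obtain ⟨Xred, hsmred, hred⟩ := hQ.exists_project hsmH hsm hinvH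
  exact ⟨_, ‹_›, _, _, ‹_›, hemb, ht2, hsc,
    ⟨‹_›, hQ.contMDiff (g := id) contMDiff_id, hQ.exists_trivialization dimPart_free hs⟩,
    contMDiff_comp_reducedProj_iff hQ, injective_reducedIncl, XH, Xred, hsmH, hsmred,
    isReductionOn_of_related hW hQ hs hinvH hsmH hsmred hXH hred⟩

variable [FiniteDimensional ℝ EG] [LieGroup 𝓘(ℝ, EG) ∞ G] [T2Space G] [SecondCountableTopology G]

theorem IsPolite.admitsReductionAndReconstruction (hpolite : IsPolite E G P)
    (hX : IsSmoothVectorField X) (hinv : PreservesVectorField E G X) :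
    AdmitsReductionAndReconstruction EG E G X := by
  refine ⟨fun H _ J hJ γ hγ t₀ ht₀ h t ht => ?_, fun J hJ hne γ hγ =>
    hpolite.exists_mem_range_dimPartIncl hX hinv hJ hne hγ, fun H hH => ?_⟩
  · exact (stabilizer_eq_of_isMIntegralCurveOn (G := G) hX (contMDiff_const_smul' (EK := EG)) hinv
      hJ hγ ht ht₀).trans h
  have _ : IsTopologicalGroup G := topologicalGroup_of_lieGroup 𝓘(ℝ, EG) ∞
  have _ : IsClosed (H.subgroupOf (Subgroup.normalizer (H : Set G)) :
      Set ↥(Subgroup.normalizer (H : Set G))) := hH.preimage continuous_subtype_val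
  have _ : SecondCountableTopology ↥(Subgroup.normalizer (H : Set G)) :=
    IsEmbedding.subtypeVal.secondCountableTopology
  obtain ⟨k, ⟨hc⟩⟩ := exists_spanChart_quotient (E := EG) (Subgroup.le_normalizer (H := H)) hH
    (isClosed_normalizer hH)
  let _ := SpanChart.chartedSpace hc
  have _ := SpanChart.isManifold hc
  have hK := SpanChart.isSmoothSpan hc
  have hL := hK.lieGroup
  obtain ⟨hemb, hproper⟩ := hpolite H hH
  exact ⟨inferInstance, inferInstance, existsUnique_mem_dimPart hemb, fun d => isOpen_dimPart, k, _,
    hL, hK.contMDiff_iff_exists_ext IsInducing.subtypeVal,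
    exists_bundle_dimPart hK hemb hproper hX hinv⟩

end Main

end PoliteAction

end

open scoped Manifold ContDiff in
theorem theorem2 {EG E G P : Type*}
    [NormedAddCommGroup EG] [NormedSpace ℝ EG] [FiniteDimensional ℝ EG]
    [NormedAddCommGroup E] [NormedSpace ℝ E] [FiniteDimensional ℝ E]
    [Group G] [TopologicalSpace G] [ChartedSpace EG G] [LieGroup 𝓘(ℝ, EG) ∞ G]
    [T2Space G] [SecondCountableTopology G]
    [TopologicalSpace P] [ChartedSpace E P] [IsManifold 𝓘(ℝ, E) ∞ P]
    [T2Space P] [SecondCountableTopology P]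
    [MulAction G P] [ContMDiffSMul 𝓘(ℝ, EG) 𝓘(ℝ, E) ∞ G P]
    (hpolite : PoliteAction.IsPolite E G P)
    (X : (p : P) → TangentSpace 𝓘(ℝ, E) p) (hX : PoliteAction.IsSmoothVectorField X)
    (hinv : PoliteAction.PreservesVectorField E G X) :
    PoliteAction.AdmitsReductionAndReconstruction EG E G X :=
  hpolite.admitsReductionAndReconstruction hX hinv
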